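/- Conventions. Let $\mathbb{V}$ be a small category. A profunctor $\mathbb{B} \to \mathbb{V}$ is a functor $P(\bullet;\bullet)\colon \mathbb{V}^{op}\times\mathbb{B}\to\mathbf{Set}$; profunctors are composed along a port by coends, $(P\diamond Q)(A;C)=\int^{B}P(A;B)\times Q(B;C)$, and nested expressions denote such composites, e.g. $\mathbb{V}(A;(X\otimes Y)\triangleleft(Z\otimes W))=\int^{U,U'}\mathbb{V}(A;U\triangleleft U')\times\mathbb{V}(U;X\otimes Y)\times\mathbb{V}(U';Z\otimes W)$; this includes nested occurrences of the (virtual) units. A promonoidal structure on $\mathbb{V}$ consists of profunctors $\mathbb{V}(\bullet;\bullet\otimes\bullet)\colon\mathbb{V}\times\mathbb{V}\to\mathbb{V}$ (splits) and $\mathbb{V}(\bullet;I)\colon 1\to\mathbb{V}$ (units) with natural isomorphisms $\mathbb{V}(\bullet;(X\otimes Y)\otimes Z)\cong\mathbb{V}(\bullet;X\otimes(Y\otimes Z))$, $\mathbb{V}(\bullet;I\otimes X)\cong\mathbb{V}(\bullet;X)\cong\mathbb{V}(\bullet;X\otimes I)$ satisfying the pentagon and triangle equations. A produoidal category is a category with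 two promonoidal structures $(\otimes,I)$ and $(\triangleleft,N)$ and natural laxators $$\psi_2\colon\mathbb{V}(\bullet;(X\triangleleft Y)\otimes(Z\triangleleft W))\to\mathbb{V}(\bullet;(X\otimes Z)\triangleleft(Y\otimes W)),\quad \psi_0\colon\mathbb{V}(\bullet;I)\to\mathbb{V}(\bullet;I\triangleleft I),$$ $$\varphi_2\colon\mathbb{V}(\bullet;N\otimes N)\to\mathbb{V}(\bullet;N),\quad \varphi_0\colon\mathbb{V}(\bullet;I)\to\mathbb{V}(\bullet;N),$$ satisfying the coherence equations of a duoidal category (compatibility of $\psi_2$ with both associators; of $\psi_2,\psi_0$ with the unitors of $\otimes$; of $\psi_2,\varphi_2$ with the unitors of $\triangleleft$; $(N,\varphi_2,\varphi_0)$ is a $\otimes$-monoid and $(I,\psi_0,\varphi_0)$ is a $\triangleleft$-comonoid). It is normal if $\varphi_0$ is an isomorphism. A promonad on $\mathbb{V}$ is a profunctor $P\colon\mathbb{V}\to\mathbb{V}$ with natural maps $(-)^\circ\colon\mathbb{V}(X;Y)\to P(X;Y)$ and $\star\colon P(X;Y)\times P(Y;Z)\to P(X;Z)$ such that $\star$ is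 associative and dinatural in $Y$, and $f^\circ\star p$ and $p\star f^\circ$ are the left and right actions of $f$ on $p$. Its Kleisli category has the objects of $\mathbb{V}$ and hom-sets $P(X;Y)$. Theorem. Let $\mathbb{V}$ be a small produoidal category, with structures $(\otimes,I)$, $(\triangleleft,N)$. The profunctor $$\mathcal{N}\mathbb{V}(A;B)=\mathbb{V}(A;N\otimes B\otimes N)$$ is a promonad, whose inclusion is $\mathbb{V}(A;B)\cong\mathbb{V}(A;I\otimes B\otimes I)\to\mathbb{V}(A;N\otimes B\otimes N)$, given by the unitors and $\varphi_0$, and whose multiplication is $\int^{B}\mathcal{N}\mathbb{V}(A;B)\times\mathcal{N}\mathbb{V}(B;C)\cong\mathbb{V}(A;N\otimes N\otimes C\otimes N\otimes N)\to\mathbb{V}(A;N\otimes C\otimes N)$, given by Yoneda reduction, the associators and $\varphi_2$. Moreover, the Kleisli category of this promonad carries the structure of a normal produoidal category $(\otimes_N,I_N,\triangleleft_N,N_N)$ with splits and units $$\begin{aligned} \mathcal{N}\mathbb{V}(A;B\otimes_N C)&=\mathbb{V}(A;N\otimes B\otimes N\otimes C\otimes N),\\ \mathcal{N}\mathbb{V}(A;B\triangleleft_N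 C)&=\mathbb{V}(A;(N\otimes B\otimes N)\triangleleft(N\otimes C\otimes N)),\\ \mathcal{N}\mathbb{V}(A;I_N)&=\mathbb{V}(A;N),\\ \mathcal{N}\mathbb{V}(A;N_N)&=\mathbb{V}(A;N), \end{aligned}$$ naturally in $A$, $B$, $C$ as objects of the Kleisli category (the symbol $=$ denotes natural bijection). Here the morphisms of the Kleisli category act on the right-hand sides through the associators, by multiplying adjacent copies of $N$ with $\varphi_2$ and, in the case of $\triangleleft_N$, by distributing the outer copies of $N$ over $\triangleleft$ by the unitors $N\cong N\triangleleft N$ and $\psi_2$. -/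

import Mathlib

open CategoryTheory Opposite
open scoped CategoryTheory.Prod

universe u

namespace Produo

section Coend

theorem map_id_op {V : Type u} [SmallCategory V] (P : Vᵒᵖ ⥤ Type u) (X : V) (p : P.obj (op X)) :
    P.map (𝟙 X).op p = p := by simp

variable {B V : Type u} [SmallCategory B] [SmallCategory V]

/-- The relation generating dinatural equivalence: for `f : b ⟶ b'`,
`(x ≺ f | y) ∼ (x | f ≻ y)`. -/
inductive Dinatural (F : Profunctor.{u} B V) (G : Bᵒᵖ ⥤ Type u) (A : Vᵒᵖ) :
    (Σ b : B, (F.obj b).obj A × G.obj (op b)) →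
      (Σ b : B, (F.obj b).obj A × G.obj (op b)) → Prop
  | slide {b b' : B} (f : b ⟶ b') (x : (F.obj b).obj A) (y : G.obj (op b')) :
      Dinatural F G A ⟨b', (F.map f).app A x, y⟩ ⟨b, x, G.map f.op y⟩

/-- Profunctor composition along a port: the presheaf `A ↦ ∫^b F(A; b) × G(b)`, where the coend is
the coproduct of the products quotiented by dinatural equivalence. -/
def comp (F : Profunctor.{u} B V) (G : Bᵒᵖ ⥤ Type u) : Vᵒᵖ ⥤ Type u where
  obj A := Quot (Dinatural F G A)
  map {A A'} g := ↾ (Quot.map (fun s => ⟨s.1, (F.obj s.1).map g s.2.1, s.2.2⟩) (by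
    rintro _ _ ⟨f, x, y⟩
    have h : (F.obj _).map g ((F.map f).app A x) = (F.map f).app A' ((F.obj _).map g x) := by
      simp
    simp only [h]
    exact .slide f _ y))
  map_id A := by
    ext s; induction s using Quot.ind; simp [Quot.map]
  map_comp f g := by
    ext s; induction s using Quot.ind; simp [Quot.map]

/-- The class of a pair in a coend. -/
def comp.mk (F : Profunctor.{u} B V) (G : Bᵒᵖ ⥤ Type u) {A : Vᵒᵖ} (b : B)
    (x : (F.obj b).obj A) (y : G.obj (op b)) : (comp F G).obj A :=
  Quot.mk _ ⟨b, x, y⟩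

theorem comp.ind {F : Profunctor.{u} B V} {G : Bᵒᵖ ⥤ Type u} {A : Vᵒᵖ}
    {p : (comp F G).obj A → Prop}
    (h : ∀ b x y, p (comp.mk F G b x y)) (s : (comp F G).obj A) : p s := by
  induction s using Quot.ind with
  | _ s => exact h s.1 s.2.1 s.2.2

theorem comp.sound (F : Profunctor.{u} B V) (G : Bᵒᵖ ⥤ Type u) {A : Vᵒᵖ} {b b' : B} (f : b ⟶ b')
    (x : (F.obj b).obj A) (y : G.obj (op b')) :
    comp.mk F G b' ((F.map f).app A x) y = comp.mk F G b x (G.map f.op y) :=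
  Quot.sound (.slide f x y)

@[simp]
theorem comp.map_mk (F : Profunctor.{u} B V) (G : Bᵒᵖ ⥤ Type u) {A A' : Vᵒᵖ} (g : A ⟶ A') (b : B)
    (x : (F.obj b).obj A) (y : G.obj (op b)) :
    (comp F G).map g (comp.mk F G b x y) = comp.mk F G b ((F.obj b).map g x) y := rfl

/-- The universal property of the coend: a dinatural family, natural in the remaining port,
induces a map out of the composite. -/
def comp.desc {F : Profunctor.{u} B V} {G : Bᵒᵖ ⥤ Type u} {H : Vᵒᵖ ⥤ Type u}
    (φ : ∀ (b : B) (_ : G.obj (op b)), F.obj b ⟶ H)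
    (hφ : ∀ {b b' : B} (f : b ⟶ b') (y : G.obj (op b')), F.map f ≫ φ b' y = φ b (G.map f.op y)) :
    comp F G ⟶ H where
  app A := ↾ (Quot.lift (fun s => (φ s.1 s.2.2).app A s.2.1) (by
    rintro _ _ ⟨f, x, y⟩
    simp [← hφ f y]))
  naturality A A' g := by
    ext s; induction s using Quot.ind with
    | _ s => exact NatTrans.naturality_apply (φ s.1 s.2.2) g s.2.1

@[simp]
theorem comp.desc_mk {F : Profunctor.{u} B V} {G : Bᵒᵖ ⥤ Type u} {H : Vᵒᵖ ⥤ Type u}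
    (φ : ∀ (b : B) (_ : G.obj (op b)), F.obj b ⟶ H)
    (hφ : ∀ {b b' : B} (f : b ⟶ b') (y : G.obj (op b')), F.map f ≫ φ b' y = φ b (G.map f.op y))
    {A : Vᵒᵖ} (b : B) (x : (F.obj b).obj A) (y : G.obj (op b)) :
    (comp.desc φ hφ).app A (comp.mk F G b x y) = (φ b y).app A x := rfl

/-- The coprojections of the coend. -/
def comp.ι (F : Profunctor.{u} B V) (G : Bᵒᵖ ⥤ Type u) (b : B) (y : G.obj (op b)) :
    F.obj b ⟶ comp F G where
  app A := ↾ (fun x => comp.mk F G b x y)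

@[simp]
theorem comp.ι_app (F : Profunctor.{u} B V) (G : Bᵒᵖ ⥤ Type u) (b : B) (y : G.obj (op b))
    {A : Vᵒᵖ} (x : (F.obj b).obj A) : (comp.ι F G b y).app A x = comp.mk F G b x y := rfl

theorem comp.ι_dinatural (F : Profunctor.{u} B V) (G : Bᵒᵖ ⥤ Type u) {b b' : B} (f : b ⟶ b')
    (y : G.obj (op b')) : F.map f ≫ comp.ι F G b' y = comp.ι F G b (G.map f.op y) := by
  ext A x
  simpa using comp.sound F G f x y

/-- Functoriality of profunctor composition in both factors. -/
def compMap {F F' : Profunctor.{u} B V} {G G' : Bᵒᵖ ⥤ Type u} (α : F ⟶ F') (β : G ⟶ G') :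
    comp F G ⟶ comp F' G' :=
  comp.desc (fun b y => α.app b ≫ comp.ι F' G' b (β.app _ y)) (by
    intro b b' f y
    rw [α.naturality_assoc, comp.ι_dinatural]
    simp)

@[simp]
theorem compMap_mk {F F' : Profunctor.{u} B V} {G G' : Bᵒᵖ ⥤ Type u} (α : F ⟶ F') (β : G ⟶ G')
    {A : Vᵒᵖ} (b : B) (x : (F.obj b).obj A) (y : G.obj (op b)) :
    (compMap α β).app A (comp.mk F G b x y) = comp.mk F' G' b ((α.app b).app A x) (β.app _ y) :=
  rfl

theorem comp.hom_ext {F : Profunctor.{u} B V} {G : Bᵒᵖ ⥤ Type u} {H : Vᵒᵖ ⥤ Type u}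
    {f g : comp F G ⟶ H} (h : ∀ b y, comp.ι F G b y ≫ f = comp.ι F G b y ≫ g) : f = g := by
  ext A s
  induction s using comp.ind with
  | _ b x y => simpa using congrArg (fun k => k.app A x) (h b y)

@[simp]
theorem comp.ι_desc {F : Profunctor.{u} B V} {G : Bᵒᵖ ⥤ Type u} {H : Vᵒᵖ ⥤ Type u}
    (φ : ∀ (b : B) (_ : G.obj (op b)), F.obj b ⟶ H)
    (hφ : ∀ {b b' : B} (f : b ⟶ b') (y : G.obj (op b')), F.map f ≫ φ b' y = φ b (G.map f.op y))
    (b : B) (y : G.obj (op b)) : comp.ι F G b y ≫ comp.desc φ hφ = φ b y := rfl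

theorem comp.ι_compMap {F F' : Profunctor.{u} B V} {G G' : Bᵒᵖ ⥤ Type u} (α : F ⟶ F')
    (β : G ⟶ G') (b : B) (y : G.obj (op b)) :
    comp.ι F G b y ≫ compMap α β = α.app b ≫ comp.ι F' G' b (β.app _ y) := rfl

theorem comp.ι_compMap_assoc {F F' : Profunctor.{u} B V} {G G' : Bᵒᵖ ⥤ Type u} (α : F ⟶ F')
    (β : G ⟶ G') (b : B) (y : G.obj (op b)) {H : Vᵒᵖ ⥤ Type u} (k : comp F' G' ⟶ H) :
    comp.ι F G b y ≫ compMap α β ≫ k = α.app b ≫ comp.ι F' G' b (β.app _ y) ≫ k := rfl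

/-- The external product of two presheaves, as a presheaf on the product category. -/
abbrev ext (P Q : Vᵒᵖ ⥤ Type u) : (V × V)ᵒᵖ ⥤ Type u where
  obj b := P.obj (op b.unop.1) × Q.obj (op b.unop.2)
  map f := ↾ (fun y => (P.map f.unop.1.op y.1, Q.map f.unop.2.op y.2))

@[simp]
theorem ext_map (P Q : Vᵒᵖ ⥤ Type u) {b b' : (V × V)ᵒᵖ} (f : b ⟶ b') (y : (ext P Q).obj b) :
    (ext P Q).map f y = (P.map f.unop.1.op y.1, Q.map f.unop.2.op y.2) := rfl

/-- Functoriality of the external product. -/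
def extMap {P P' Q Q' : Vᵒᵖ ⥤ Type u} (f : P ⟶ P') (g : Q ⟶ Q') : ext P Q ⟶ ext P' Q' where
  app b := ↾ (fun y => (f.app _ y.1, g.app _ y.2))
  naturality b b' h := by
    refine ConcreteCategory.hom_ext _ _ fun y => ?_
    have h₁ := NatTrans.naturality_apply f h.unop.1.op (Prod.fst y)
    have h₂ := NatTrans.naturality_apply g h.unop.2.op (Prod.snd y)
    exact congrArg₂ Prod.mk h₁ h₂

@[simp]
theorem extMap_app {P P' Q Q' : Vᵒᵖ ⥤ Type u} (f : P ⟶ P') (g : Q ⟶ Q') {b : (V × V)ᵒᵖ}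
    (y : (ext P Q).obj b) : (extMap f g).app b y = (f.app _ y.1, g.app _ y.2) := rfl

/-- For a profunctor `T(•; •₁, •₂) : V × V ⇸ V` and presheaves `P`, `Q`, the nested expression
`T(•; •₁, •₂) ⋄ P(•₁) ⋄ Q(•₂)`, that is `A ↦ ∫^{X,Y} T(A; X, Y) × P(X) × Q(Y)`. -/
def conv (T : Profunctor.{u} (V × V) V) (P Q : Vᵒᵖ ⥤ Type u) : Vᵒᵖ ⥤ Type u :=
  comp T (ext P Q)

/-- Functoriality of nesting. -/
def convMap (T : Profunctor.{u} (V × V) V) {P P' Q Q' : Vᵒᵖ ⥤ Type u} (f : P ⟶ P')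
    (g : Q ⟶ Q') : conv T P Q ⟶ conv T P' Q' :=
  compMap (𝟙 T) (extMap f g)

/-- The profunctor `T(•; •, Z)` in the left output port. -/
abbrev portL (T : Profunctor.{u} (V × V) V) (Z : V) : Profunctor.{u} V V :=
  (CategoryTheory.Functor.curry.obj T).flip.obj Z

/-- The profunctor `T(•; X, •)` in the right output port. -/
abbrev portR (T : Profunctor.{u} (V × V) V) (X : V) : Profunctor.{u} V V :=
  (CategoryTheory.Functor.curry.obj T).obj X

/-- Reindexing of the profunctor `T(•; •, Z)` along a morphism `Z ⟶ Z'`. -/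
abbrev portLMap (T : Profunctor.{u} (V × V) V) {Z Z' : V} (h : Z ⟶ Z') : portL T Z ⟶ portL T Z' :=
  (CategoryTheory.Functor.curry.obj T).flip.map h

/-- Reindexing of the profunctor `T(•; X, •)` along a morphism `X ⟶ X'`. -/
abbrev portRMap (T : Profunctor.{u} (V × V) V) {X X' : V} (f : X ⟶ X') : portR T X ⟶ portR T X' :=
  (CategoryTheory.Functor.curry.obj T).map f

/-- Plugging `p ∈ P(X)` and `q ∈ Q(Y)` into `T(•; X, Y)`. -/
def plug (T : Profunctor.{u} (V × V) V) {P Q : Vᵒᵖ ⥤ Type u} {X Y : V} (p : P.obj (op X))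
    (q : Q.obj (op Y)) : T.obj (X, Y) ⟶ conv T P Q :=
  comp.ι T (ext P Q) (X, Y) (p, q)

theorem plug_dinatural (T : Profunctor.{u} (V × V) V) {P Q : Vᵒᵖ ⥤ Type u} {X X' Y Y' : V}
    (f : X ⟶ X') (g : Y ⟶ Y') (p : P.obj (op X')) (q : Q.obj (op Y')) :
    T.map (f ×ₘ g) ≫ plug T p q = plug T (P.map f.op p) (Q.map g.op q) :=
  comp.ι_dinatural T (ext P Q) (f ×ₘ g) (p, q)

/-- Plugging `r ∈ R(Z)` into the right port of `T(•; •, Z) ⋄ G`, and mapping `G` to `P`. -/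
def plugR (T : Profunctor.{u} (V × V) V) {G P R : Vᵒᵖ ⥤ Type u} (g : G ⟶ P) {Z : V}
    (r : R.obj (op Z)) : comp (portL T Z) G ⟶ conv T P R :=
  comp.desc (fun _ y => plug T (g.app _ y) r) (by
    intro X X' f y
    have := plug_dinatural T f (𝟙 Z) (g.app _ y) r
    simpa using this)

/-- Plugging `p ∈ P(X)` into the left port of `T(•; X, •) ⋄ G`, and mapping `G` to `Q`. -/
def plugL (T : Profunctor.{u} (V × V) V) {G P Q : Vᵒᵖ ⥤ Type u} {X : V} (p : P.obj (op X))
    (g : G ⟶ Q) : comp (portR T X) G ⟶ conv T P Q :=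
  comp.desc (fun _ y => plug T p (g.app _ y)) (by
    intro Y Y' f y
    have := plug_dinatural T (𝟙 X) f p (g.app _ y)
    simpa using this)

theorem compMap_plugR (T : Profunctor.{u} (V × V) V) {G G' P R : Vᵒᵖ ⥤ Type u} (g : G ⟶ G')
    (g' : G' ⟶ P) {Z Z' : V} (h : Z ⟶ Z') (r : R.obj (op Z')) :
    compMap (portLMap T h) g ≫ plugR T g' r = plugR T (g ≫ g') (R.map h.op r) := by
  refine comp.hom_ext fun X y => ?_
  have := plug_dinatural T (𝟙 X) h (g'.app _ (g.app _ y)) r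
  rw [map_id_op] at this
  exact this

theorem compMap_plugL (T : Profunctor.{u} (V × V) V) {G G' P Q : Vᵒᵖ ⥤ Type u} {X X' : V}
    (f : X ⟶ X') (g : G ⟶ G') (p : P.obj (op X')) (g' : G' ⟶ Q) :
    compMap (portRMap T f) g ≫ plugL T p g' = plugL T (P.map f.op p) (g ≫ g') := by
  refine comp.hom_ext fun Y y => ?_
  have := plug_dinatural T f (𝟙 Y) p (g'.app _ (g.app _ y))
  rw [map_id_op] at this
  exact this

theorem map_ι_portL (T : Profunctor.{u} (V × V) V) (G : Vᵒᵖ ⥤ Type u) {X X' Z Z' : V}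
    (f : X ⟶ X') (h : Z ⟶ Z') (y : G.obj (op X')) :
    T.map (f ×ₘ h) ≫ comp.ι (portL T Z') G X' y =
      comp.ι (portL T Z) G X (G.map f.op y) ≫ compMap (portLMap T h) (𝟙 G) := by
  have h₁ := comp.ι_dinatural (portL T Z') G f y
  have h₂ : T.map (f ×ₘ h) = T.map (𝟙 X ×ₘ h) ≫ (portL T Z').map f := by
    simp [← Functor.map_comp]
  rw [h₂, Category.assoc, h₁]
  rfl

theorem map_ι_portR (T : Profunctor.{u} (V × V) V) (G : Vᵒᵖ ⥤ Type u) {X X' Y Y' : V}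
    (f : X ⟶ X') (g : Y ⟶ Y') (y : G.obj (op Y')) :
    T.map (f ×ₘ g) ≫ comp.ι (portR T X') G Y' y =
      comp.ι (portR T X) G Y (G.map g.op y) ≫ compMap (portRMap T f) (𝟙 G) := by
  have h₁ := comp.ι_dinatural (portR T X') G g y
  have h₂ : T.map (f ×ₘ g) = T.map (f ×ₘ 𝟙 Y) ≫ (portR T X').map g := by
    simp [← Functor.map_comp]
  rw [h₂, Category.assoc, h₁]
  rfl

theorem plug_convMap (T : Profunctor.{u} (V × V) V) {P P' Q Q' : Vᵒᵖ ⥤ Type u} (f : P ⟶ P')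
    (g : Q ⟶ Q') {X Y : V} (p : P.obj (op X)) (q : Q.obj (op Y)) :
    plug T p q ≫ convMap T f g = plug T (f.app _ p) (g.app _ q) := rfl

theorem convMap_id (T : Profunctor.{u} (V × V) V) (P Q : Vᵒᵖ ⥤ Type u) :
    convMap T (𝟙 P) (𝟙 Q) = 𝟙 (conv T P Q) := by
  refine comp.hom_ext fun b y => ?_
  rfl

theorem convMap_comp (T : Profunctor.{u} (V × V) V) {P P' P'' Q Q' Q'' : Vᵒᵖ ⥤ Type u}
    (f : P ⟶ P') (f' : P' ⟶ P'') (g : Q ⟶ Q') (g' : Q' ⟶ Q'') :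
    convMap T f g ≫ convMap T f' g' = convMap T (f ≫ f') (g ≫ g') := by
  refine comp.hom_ext fun b y => ?_
  rfl

end Coend

section Promonoidal

/-- The data of a promonoidal category: profunctors `V(•; • ⊗ •) : V × V ⇸ V` and
`V(•; N) : 1 ⇸ V` with natural isomorphisms `α`, `λ`, `ρ`. -/
structure PromonoidalData (V : Type u) [SmallCategory V] where
  /-- The splits, `V(A; X ⊗ Y) = (tensor.obj (X, Y)).obj (op A)`. -/
  tensor : Profunctor.{u} (V × V) V
  /-- The units, `V(A; N) = unit.obj (op A)`. -/
  unit : Vᵒᵖ ⥤ Type u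
  /-- `α : V(•; •₁ ⊗ Z) ⋄ V(•₁; X ⊗ Y) ≅ V(•; X ⊗ •₁) ⋄ V(•₁; Y ⊗ Z)`. -/
  assoc (X Y Z : V) :
    comp (portL tensor Z) (tensor.obj (X, Y)) ≅ comp (portR tensor X) (tensor.obj (Y, Z))
  assoc_naturality {X X' Y Y' Z Z' : V} (f : X ⟶ X') (g : Y ⟶ Y') (h : Z ⟶ Z') :
    compMap (portLMap tensor h) (tensor.map (f ×ₘ g)) ≫ (assoc X' Y' Z').hom =
      (assoc X Y Z).hom ≫ compMap (portRMap tensor f) (tensor.map (g ×ₘ h))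
  /-- `λ : V(•; •₁ ⊗ X) ⋄ V(•₁; N) ≅ V(•; X)`. -/
  leftUnitor (X : V) : comp (portL tensor X) unit ≅ yoneda.obj X
  leftUnitor_naturality {X X' : V} (f : X ⟶ X') :
    compMap (portLMap tensor f) (𝟙 unit) ≫ (leftUnitor X').hom =
      (leftUnitor X).hom ≫ yoneda.map f
  /-- `ρ : V(•; X ⊗ •₁) ⋄ V(•₁; N) ≅ V(•; X)`. -/
  rightUnitor (X : V) : comp (portR tensor X) unit ≅ yoneda.obj X
  rightUnitor_naturality {X X' : V} (f : X ⟶ X') :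
    compMap (portRMap tensor f) (𝟙 unit) ≫ (rightUnitor X').hom =
      (rightUnitor X).hom ≫ yoneda.map f

namespace PromonoidalData

variable {V : Type u} [SmallCategory V] (M : PromonoidalData V)

/-- The nested virtual structure `V(•; P ⊗ Q)` for presheaves `P`, `Q`. -/
abbrev tens (P Q : Vᵒᵖ ⥤ Type u) : Vᵒᵖ ⥤ Type u := conv M.tensor P Q

/-- Functoriality of `tens`. -/
abbrev tensMap {P P' Q Q' : Vᵒᵖ ⥤ Type u} (f : P ⟶ P') (g : Q ⟶ Q') :
    M.tens P Q ⟶ M.tens P' Q' := convMap M.tensor f g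

theorem assoc_plug {X X' Y Y' Z Z' : V} {P Q R : Vᵒᵖ ⥤ Type u} (f : X ⟶ X') (g : Y ⟶ Y')
    (h : Z ⟶ Z') (p : P.obj (op X')) (q : Q.obj (op Y')) (r : R.obj (op Z')) :
    compMap (portLMap M.tensor h) (M.tensor.map (f ×ₘ g)) ≫ (M.assoc X' Y' Z').hom ≫
        plugL M.tensor p (plug M.tensor q r) =
      (M.assoc X Y Z).hom ≫
        plugL M.tensor (P.map f.op p) (plug M.tensor (Q.map g.op q) (R.map h.op r)) := by
  rw [← Category.assoc, M.assoc_naturality, Category.assoc, compMap_plugL, plug_dinatural]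

theorem assoc_inv_plug {X X' Y Y' Z Z' : V} {P Q R : Vᵒᵖ ⥤ Type u} (f : X ⟶ X') (g : Y ⟶ Y')
    (h : Z ⟶ Z') (p : P.obj (op X')) (q : Q.obj (op Y')) (r : R.obj (op Z')) :
    compMap (portRMap M.tensor f) (M.tensor.map (g ×ₘ h)) ≫ (M.assoc X' Y' Z').inv ≫
        plugR M.tensor (plug M.tensor p q) r =
      (M.assoc X Y Z).inv ≫
        plugR M.tensor (plug M.tensor (P.map f.op p) (Q.map g.op q)) (R.map h.op r) := by
  rw [← plug_dinatural, ← compMap_plugR, ← Category.assoc, ← Category.assoc]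
  congr 1
  rw [Iso.eq_inv_comp, ← Category.assoc, ← M.assoc_naturality, Category.assoc,
    Iso.hom_inv_id, Category.comp_id]

/-- The associator `α` with arbitrary presheaves in the ports: the canonical map
`(P ⊗ Q) ⊗ R ⟶ P ⊗ (Q ⊗ R)` which applies `α` to the two nested splits of a representative and
keeps the elements of `P`, `Q`, `R`. -/
def α (P Q R : Vᵒᵖ ⥤ Type u) : M.tens (M.tens P Q) R ⟶ M.tens P (M.tens Q R) :=
  comp.desc
    (fun b y => Quot.lift
      (fun s => comp.ι (portL M.tensor b.2) (M.tensor.obj s.1) b.1 s.2.1 ≫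
        (M.assoc s.1.1 s.1.2 b.2).hom ≫
          plugL M.tensor s.2.2.1 (plug M.tensor s.2.2.2 y.2))
      (by
        rintro _ _ ⟨f, x, p⟩
        have h := M.assoc_plug f.1 f.2 (𝟙 b.2) p.1 p.2 (Prod.snd y)
        have h' := congrArg (fun k => comp.ι (portL M.tensor b.2) _ b.1 x ≫ k) h
        simpa [comp.ι_compMap_assoc] using h')
      (Prod.fst y))
    (by
      rintro b b' f ⟨y, r⟩
      induction y using comp.ind with
      | _ c s p =>
        have h := M.assoc_plug (𝟙 c.1) (𝟙 c.2) f.2 p.1 p.2 r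
        rw [map_id_op, map_id_op, ← prod_id, CategoryTheory.Functor.map_id] at h
        have h' := map_ι_portL M.tensor (M.tensor.obj c) f.1 f.2 s
        refine (congrArg (· ≫ (M.assoc c.1 c.2 b'.2).hom ≫
          plugL M.tensor p.1 (plug M.tensor p.2 r)) h').trans ?_
        exact congrArg (comp.ι (portL M.tensor b.2) (M.tensor.obj c) b.1
          ((M.tensor.obj c).map f.1.op s) ≫ ·) h)

/-- The inverse associator with arbitrary presheaves in the ports. -/
def αInv (P Q R : Vᵒᵖ ⥤ Type u) : M.tens P (M.tens Q R) ⟶ M.tens (M.tens P Q) R :=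
  comp.desc
    (fun b y => Quot.lift
      (fun s => comp.ι (portR M.tensor b.1) (M.tensor.obj s.1) b.2 s.2.1 ≫
        (M.assoc b.1 s.1.1 s.1.2).inv ≫
          plugR M.tensor (plug M.tensor y.1 s.2.2.1) s.2.2.2)
      (by
        rintro _ _ ⟨f, x, p⟩
        have h := M.assoc_inv_plug (𝟙 b.1) f.1 f.2 (Prod.fst y) p.1 p.2
        have h' := congrArg (fun k => comp.ι (portR M.tensor b.1) _ b.2 x ≫ k) h
        simpa [comp.ι_compMap_assoc] using h')
      (Prod.snd y))
    (by
      rintro b b' f ⟨p, y⟩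
      induction y using comp.ind with
      | _ c s q =>
        have h := M.assoc_inv_plug f.1 (𝟙 c.1) (𝟙 c.2) p q.1 q.2
        rw [map_id_op, map_id_op, ← prod_id, CategoryTheory.Functor.map_id] at h
        have h' := map_ι_portR M.tensor (M.tensor.obj c) f.1 f.2 s
        refine (congrArg (· ≫ (M.assoc b'.1 c.1 c.2).inv ≫
          plugR M.tensor (plug M.tensor p q.1) q.2) h').trans ?_
        exact congrArg (comp.ι (portR M.tensor b.1) (M.tensor.obj c) b.2
          ((M.tensor.obj c).map f.2.op s) ≫ ·) h)

/-- The left unitor with an arbitrary presheaf in the port. -/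
def lam (P : Vᵒᵖ ⥤ Type u) : M.tens M.unit P ⟶ P :=
  comp.desc
    (fun b y => comp.ι (portL M.tensor b.2) M.unit b.1 y.1 ≫ (M.leftUnitor b.2).hom ≫
      yonedaEquiv.symm y.2)
    (by
      rintro b b' f ⟨n, p⟩
      have h := congrArg (· ≫ yonedaEquiv.symm p) (M.leftUnitor_naturality f.2)
      rw [Category.assoc, Category.assoc, yonedaEquiv_symm_naturality_left] at h
      have h' := map_ι_portL M.tensor M.unit f.1 f.2 n
      refine (congrArg (· ≫ (M.leftUnitor b'.2).hom ≫ yonedaEquiv.symm p) h').trans ?_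
      exact congrArg (comp.ι (portL M.tensor b.2) M.unit b.1 (M.unit.map f.1.op n) ≫ ·) h)

/-- The right unitor with an arbitrary presheaf in the port. -/
def rho (P : Vᵒᵖ ⥤ Type u) : M.tens P M.unit ⟶ P :=
  comp.desc
    (fun b y => comp.ι (portR M.tensor b.1) M.unit b.2 y.2 ≫ (M.rightUnitor b.1).hom ≫
      yonedaEquiv.symm y.1)
    (by
      rintro b b' f ⟨p, n⟩
      have h := congrArg (· ≫ yonedaEquiv.symm p) (M.rightUnitor_naturality f.1)
      rw [Category.assoc, Category.assoc, yonedaEquiv_symm_naturality_left] at h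
      have h' := map_ι_portR M.tensor M.unit f.1 f.2 n
      refine (congrArg (· ≫ (M.rightUnitor b'.1).hom ≫ yonedaEquiv.symm p) h').trans ?_
      exact congrArg (comp.ι (portR M.tensor b.1) M.unit b.2 (M.unit.map f.2.op n) ≫ ·) h)

/-- The inverse left unitor with an arbitrary presheaf in the port. -/
def lamInv (P : Vᵒᵖ ⥤ Type u) : P ⟶ M.tens M.unit P where
  app A := ↾ (fun p =>
    (plugR M.tensor (𝟙 M.unit) p).app A ((M.leftUnitor A.unop).inv.app A (𝟙 A.unop)))
  naturality A A' f := by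
    refine ConcreteCategory.hom_ext _ _ fun p => ?_
    have h : (M.leftUnitor A'.unop).inv ≫ plugR M.tensor (𝟙 M.unit) (P.map f p) =
        yoneda.map f.unop ≫ (M.leftUnitor A.unop).inv ≫ plugR M.tensor (𝟙 M.unit) p := by
      rw [Iso.inv_comp_eq, ← Category.assoc, ← M.leftUnitor_naturality, Category.assoc,
        Iso.hom_inv_id_assoc, compMap_plugR, Category.id_comp]
      rfl
    have h₁ := congrArg (fun k => k.app A' (𝟙 A'.unop)) h
    have h₂ := NatTrans.naturality_apply
      ((M.leftUnitor A.unop).inv ≫ plugR M.tensor (𝟙 M.unit) p) f (𝟙 A.unop)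
    refine h₁.trans (Eq.trans ?_ h₂)
    simp

/-- The inverse right unitor with an arbitrary presheaf in the port. -/
def rhoInv (P : Vᵒᵖ ⥤ Type u) : P ⟶ M.tens P M.unit where
  app A := ↾ (fun p =>
    (plugL M.tensor p (𝟙 M.unit)).app A ((M.rightUnitor A.unop).inv.app A (𝟙 A.unop)))
  naturality A A' f := by
    refine ConcreteCategory.hom_ext _ _ fun p => ?_
    have h : (M.rightUnitor A'.unop).inv ≫ plugL M.tensor (P.map f p) (𝟙 M.unit) =
        yoneda.map f.unop ≫ (M.rightUnitor A.unop).inv ≫ plugL M.tensor p (𝟙 M.unit) := by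
      rw [Iso.inv_comp_eq, ← Category.assoc, ← M.rightUnitor_naturality, Category.assoc,
        Iso.hom_inv_id_assoc, compMap_plugL, Category.id_comp]
      rfl
    have h₁ := congrArg (fun k => k.app A' (𝟙 A'.unop)) h
    have h₂ := NatTrans.naturality_apply
      ((M.rightUnitor A.unop).inv ≫ plugL M.tensor p (𝟙 M.unit)) f (𝟙 A.unop)
    refine h₁.trans (Eq.trans ?_ h₂)
    simp

end PromonoidalData


/-- A promonoidal category: the data above subject to the pentagon and triangle equations. An object
`A` in a nested expression stands for the presheaf `V(•; A)`. -/
structure Promonoidal (V : Type u) [SmallCategory V] extends PromonoidalData V where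
  pentagon (A B C D : V) :
    letI a := yoneda.obj A; letI b := yoneda.obj B; letI c := yoneda.obj C; letI d := yoneda.obj D
    letI M := toPromonoidalData
    M.tensMap (M.α a b c) (𝟙 d) ≫ M.α a (M.tens b c) d ≫ M.tensMap (𝟙 a) (M.α b c d) =
      M.α (M.tens a b) c d ≫ M.α a b (M.tens c d)
  triangle (A B : V) :
    letI a := yoneda.obj A; letI b := yoneda.obj B
    letI M := toPromonoidalData
    M.α a M.unit b ≫ M.tensMap (𝟙 a) (M.lam b) = M.tensMap (M.rho a) (𝟙 b)

/-- The data of a produoidal category: a parallel promonoidal structure `(⊗, I)`, a sequential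
promonoidal structure `(◁, N)`, and the laxators. -/
structure ProduoidalData (V : Type u) [SmallCategory V] where
  /-- The parallel promonoidal structure `(⊗, I)`. -/
  par : Promonoidal V
  /-- The sequential promonoidal structure `(◁, N)`. -/
  seq : Promonoidal V
  /-- `ψ₂ : V(•; (X ◁ Y) ⊗ (Z ◁ W)) ⟶ V(•; (X ⊗ Z) ◁ (Y ⊗ W))`. -/
  ψ₂ (X Y Z W : V) :
    par.tens (seq.tensor.obj (X, Y)) (seq.tensor.obj (Z, W)) ⟶
      seq.tens (par.tensor.obj (X, Z)) (par.tensor.obj (Y, W))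
  ψ₂_naturality {X X' Y Y' Z Z' W W' : V} (f : X ⟶ X') (g : Y ⟶ Y') (h : Z ⟶ Z') (k : W ⟶ W') :
    par.tensMap (seq.tensor.map (f ×ₘ g)) (seq.tensor.map (h ×ₘ k)) ≫ ψ₂ X' Y' Z' W' =
      ψ₂ X Y Z W ≫ seq.tensMap (par.tensor.map (f ×ₘ h)) (par.tensor.map (g ×ₘ k))
  /-- `ψ₀ : V(•; I) ⟶ V(•; I ◁ I)`. -/
  ψ₀ : par.unit ⟶ seq.tens par.unit par.unit
  /-- `φ₂ : V(•; N ⊗ N) ⟶ V(•; N)`. -/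
  φ₂ : par.tens seq.unit seq.unit ⟶ seq.unit
  /-- `φ₀ : V(•; I) ⟶ V(•; N)`. -/
  φ₀ : par.unit ⟶ seq.unit

namespace ProduoidalData

variable {V : Type u} [SmallCategory V] (D : ProduoidalData V)

theorem ψ₂_plug {X X' Y Y' Z Z' W W' : V} {P Q R S : Vᵒᵖ ⥤ Type u} (f : X ⟶ X') (g : Y ⟶ Y')
    (h : Z ⟶ Z') (k : W ⟶ W') (p : P.obj (op X')) (q : Q.obj (op Y')) (r : R.obj (op Z'))
    (s : S.obj (op W')) :
    D.par.tensMap (D.seq.tensor.map (f ×ₘ g)) (D.seq.tensor.map (h ×ₘ k)) ≫ D.ψ₂ X' Y' Z' W' ≫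
        D.seq.tensMap (plug D.par.tensor p r) (plug D.par.tensor q s) =
      D.ψ₂ X Y Z W ≫
        D.seq.tensMap (plug D.par.tensor (P.map f.op p) (R.map h.op r))
          (plug D.par.tensor (Q.map g.op q) (S.map k.op s)) := by
  rw [← Category.assoc, D.ψ₂_naturality, Category.assoc, convMap_comp, plug_dinatural,
    plug_dinatural]

/-- The laxator `ψ₂` with arbitrary presheaves in the ports. -/
def ψ (P Q R S : Vᵒᵖ ⥤ Type u) :
    D.par.tens (D.seq.tens P Q) (D.seq.tens R S) ⟶
      D.seq.tens (D.par.tens P R) (D.par.tens Q S) :=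
  comp.desc
    (fun _ y => Quot.lift₂
      (fun s t =>
        plug D.par.tensor (P := D.seq.tensor.obj s.1) (Q := D.seq.tensor.obj t.1) s.2.1 t.2.1 ≫
          D.ψ₂ s.1.1 s.1.2 t.1.1 t.1.2 ≫
            D.seq.tensMap (plug D.par.tensor s.2.2.1 t.2.2.1) (plug D.par.tensor s.2.2.2 t.2.2.2))
      (by
        rintro s _ _ ⟨f, x, p⟩
        have h := D.ψ₂_plug (𝟙 s.1.1) (𝟙 s.1.2) f.1 f.2 s.2.2.1 s.2.2.2 p.1 p.2
        rw [map_id_op, map_id_op, ← prod_id, CategoryTheory.Functor.map_id] at h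
        exact congrArg
          (plug D.par.tensor (P := D.seq.tensor.obj s.1) (Q := D.seq.tensor.obj _) s.2.1 x ≫ ·) h)
      (by
        rintro _ _ t ⟨f, x, p⟩
        have h := D.ψ₂_plug f.1 f.2 (𝟙 t.1.1) (𝟙 t.1.2) p.1 p.2 t.2.2.1 t.2.2.2
        rw [map_id_op, map_id_op, ← prod_id (t.1.1), CategoryTheory.Functor.map_id] at h
        exact congrArg
          (plug D.par.tensor (P := D.seq.tensor.obj _) (Q := D.seq.tensor.obj t.1) x t.2.1 ≫ ·) h)
      (Prod.fst y) (Prod.snd y))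
    (by
      rintro b b' f ⟨y, z⟩
      induction y using comp.ind with
      | _ c s p =>
        induction z using comp.ind with
        | _ d t r =>
          have h := plug_dinatural D.par.tensor (P := D.seq.tensor.obj c)
            (Q := D.seq.tensor.obj d) f.1 f.2 s t
          exact congrArg (· ≫ D.ψ₂ c.1 c.2 d.1 d.2 ≫
            D.seq.tensMap (plug D.par.tensor p.1 r.1) (plug D.par.tensor p.2 r.2)) h)

end ProduoidalData

/-- A produoidal category: laxators, unitors and associators satisfy the coherence conditions of a
duoidal category. -/
structure Produoidal (V : Type u) [SmallCategory V] extends ProduoidalData V where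
  /-- Compatibility of `ψ₂` with the associator of `⊗`. -/
  ψ_assoc_par (A B C D E F : V) :
    letI a := yoneda.obj A; letI b := yoneda.obj B; letI c := yoneda.obj C
    letI d := yoneda.obj D; letI e := yoneda.obj E; letI f := yoneda.obj F
    letI p := toProduoidalData.par; letI s := toProduoidalData.seq; letI ψ := toProduoidalData.ψ
    p.tensMap (ψ a b c d) (𝟙 (s.tens e f)) ≫ ψ (p.tens a c) (p.tens b d) e f ≫
        s.tensMap (p.α a c e) (p.α b d f) =
      p.α (s.tens a b) (s.tens c d) (s.tens e f) ≫ p.tensMap (𝟙 (s.tens a b)) (ψ c d e f) ≫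
        ψ a b (p.tens c e) (p.tens d f)
  /-- Compatibility of `ψ₂` with the associator of `◁`. -/
  ψ_assoc_seq (A B C D E F : V) :
    letI a := yoneda.obj A; letI b := yoneda.obj B; letI c := yoneda.obj C
    letI d := yoneda.obj D; letI e := yoneda.obj E; letI f := yoneda.obj F
    letI p := toProduoidalData.par; letI s := toProduoidalData.seq; letI ψ := toProduoidalData.ψ
    ψ (s.tens a b) c (s.tens d e) f ≫ s.tensMap (ψ a b d e) (𝟙 (p.tens c f)) ≫
        s.α (p.tens a d) (p.tens b e) (p.tens c f) =
      p.tensMap (s.α a b c) (s.α d e f) ≫ ψ a (s.tens b c) d (s.tens e f) ≫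
        s.tensMap (𝟙 (p.tens a d)) (ψ b c e f)
  /-- Compatibility of `ψ₂`, `ψ₀` with the left unitor of `⊗`. -/
  ψ_unit_left (A B : V) :
    letI a := yoneda.obj A; letI b := yoneda.obj B
    letI p := toProduoidalData.par; letI s := toProduoidalData.seq; letI ψ := toProduoidalData.ψ
    p.tensMap ψ₀ (𝟙 (s.tens a b)) ≫ ψ p.unit p.unit a b ≫ s.tensMap (p.lam a) (p.lam b) =
      p.lam (s.tens a b)
  /-- Compatibility of `ψ₂`, `ψ₀` with the right unitor of `⊗`. -/
  ψ_unit_right (A B : V) :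
    letI a := yoneda.obj A; letI b := yoneda.obj B
    letI p := toProduoidalData.par; letI s := toProduoidalData.seq; letI ψ := toProduoidalData.ψ
    p.tensMap (𝟙 (s.tens a b)) ψ₀ ≫ ψ a b p.unit p.unit ≫ s.tensMap (p.rho a) (p.rho b) =
      p.rho (s.tens a b)
  /-- Compatibility of `ψ₂`, `φ₂` with the left unitor of `◁`. -/
  φ_unit_left (A B : V) :
    letI a := yoneda.obj A; letI b := yoneda.obj B
    letI p := toProduoidalData.par; letI s := toProduoidalData.seq; letI ψ := toProduoidalData.ψ
    ψ s.unit a s.unit b ≫ s.tensMap φ₂ (𝟙 (p.tens a b)) ≫ s.lam (p.tens a b) =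
      p.tensMap (s.lam a) (s.lam b)
  /-- Compatibility of `ψ₂`, `φ₂` with the right unitor of `◁`. -/
  φ_unit_right (A B : V) :
    letI a := yoneda.obj A; letI b := yoneda.obj B
    letI p := toProduoidalData.par; letI s := toProduoidalData.seq; letI ψ := toProduoidalData.ψ
    ψ a s.unit b s.unit ≫ s.tensMap (𝟙 (p.tens a b)) φ₂ ≫ s.rho (p.tens a b) =
      p.tensMap (s.rho a) (s.rho b)
  /-- Associativity of the `⊗`-monoid `N`. -/
  φ₂_assoc :
    letI p := toProduoidalData.par; letI n := toProduoidalData.seq.unit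
    p.tensMap φ₂ (𝟙 n) ≫ φ₂ = p.α n n n ≫ p.tensMap (𝟙 n) φ₂ ≫ φ₂
  /-- Left unitality of `N`. -/
  φ₂_unit_left :
    letI p := toProduoidalData.par; letI n := toProduoidalData.seq.unit
    p.tensMap φ₀ (𝟙 n) ≫ φ₂ = p.lam n
  /-- Right unitality of `N`. -/
  φ₂_unit_right :
    letI p := toProduoidalData.par; letI n := toProduoidalData.seq.unit
    p.tensMap (𝟙 n) φ₀ ≫ φ₂ = p.rho n
  /-- Coassociativity of the `◁`-comonoid `I`. -/
  ψ₀_coassoc :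
    letI s := toProduoidalData.seq; letI i := toProduoidalData.par.unit
    ψ₀ ≫ s.tensMap ψ₀ (𝟙 i) ≫ s.α i i i = ψ₀ ≫ s.tensMap (𝟙 i) ψ₀
  /-- Left counitality of `I`. -/
  ψ₀_counit_left :
    letI s := toProduoidalData.seq; letI i := toProduoidalData.par.unit
    ψ₀ ≫ s.tensMap φ₀ (𝟙 i) ≫ s.lam i = 𝟙 i
  /-- Right counitality of `I`. -/
  ψ₀_counit_right :
    letI s := toProduoidalData.seq; letI i := toProduoidalData.par.unit
    ψ₀ ≫ s.tensMap (𝟙 i) φ₀ ≫ s.rho i = 𝟙 i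

/-- A produoidal category is normal when `φ₀ : V(•; I) ⟶ V(•; N)` is an isomorphism. -/
def Produoidal.Normal {V : Type u} [SmallCategory V] (D : Produoidal V) : Prop :=
  IsIso D.φ₀

end Promonoidal

section Promonad

variable {V : Type u} [SmallCategory V]

/-- A promonad structure on an endoprofunctor `P(X; Y) = (P.obj Y).obj (op X)`: an inclusion
`V(X; Y) → P(X; Y)` and a multiplication `P(X; Y) × P(Y; Z) → P(X; Z)`, both natural, such that the
actions are given by multiplication and the multiplication is dinatural and associative. -/
structure Promonad (P : Profunctor.{u} V V) where
  /-- The inclusion `f ↦ f°`, out of the hom profunctor `V(•; •)`. -/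
  incl : yoneda ⟶ P
  /-- The multiplication `p ★ q`. -/
  mul {X Y Z : V} (p : (P.obj Y).obj (op X)) (q : (P.obj Z).obj (op Y)) : (P.obj Z).obj (op X)
  mul_natural_left {X' X Y Z : V} (f : X' ⟶ X) (p : (P.obj Y).obj (op X))
    (q : (P.obj Z).obj (op Y)) : mul ((P.obj Y).map f.op p) q = (P.obj Z).map f.op (mul p q)
  mul_natural_right {X Y Z Z' : V} (p : (P.obj Y).obj (op X)) (q : (P.obj Z).obj (op Y))
    (g : Z ⟶ Z') : mul p ((P.map g).app _ q) = (P.map g).app _ (mul p q)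
  incl_mul {X Y Z : V} (f : X ⟶ Y) (p : (P.obj Z).obj (op Y)) :
    mul ((incl.app Y).app (op X) f) p = (P.obj Z).map f.op p
  mul_incl {X Y Z : V} (p : (P.obj Y).obj (op X)) (f : Y ⟶ Z) :
    mul p ((incl.app Z).app (op Y) f) = (P.map f).app _ p
  mul_dinatural {X Y Y' Z : V} (p : (P.obj Y).obj (op X)) (f : Y ⟶ Y')
    (q : (P.obj Z).obj (op Y')) :
    mul p ((P.obj Z).map f.op q) = mul ((P.map f).app _ p) q
  mul_assoc {X Y Z W : V} (p : (P.obj Y).obj (op X)) (q : (P.obj Z).obj (op Y))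
    (r : (P.obj W).obj (op Z)) : mul (mul p q) r = mul p (mul q r)

/-- The objects of the Kleisli category of a promonad are the objects of the base. -/
structure Kleisli {P : Profunctor.{u} V V} (M : Promonad P) : Type u where
  /-- The underlying object of the base category. -/
  of : V

/-- The Kleisli category of a promonad: `Hom(X; Y) = P(X; Y)`. -/
instance {P : Profunctor.{u} V V} (M : Promonad P) : SmallCategory (Kleisli M) where
  Hom X Y := (P.obj Y.of).obj (op X.of)
  id X := (M.incl.app X.of).app (op X.of) (𝟙 X.of)
  comp p q := M.mul p q
  id_comp p := (M.incl_mul _ p).trans (map_id_op _ _ p)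
  comp_id p := (M.mul_incl p _).trans (by simp)
  assoc p q r := M.mul_assoc p q r

end Promonad

section Normalization

namespace ProduoidalData

variable {V : Type u} [SmallCategory V] (D : ProduoidalData V)

/-- The presheaf `V(•; N)`. -/
abbrev n : Vᵒᵖ ⥤ Type u := D.seq.unit

/-- `V(•; N ⊗ P ⊗ N)`. -/
abbrev free (P : Vᵒᵖ ⥤ Type u) : Vᵒᵖ ⥤ Type u := D.par.tens D.n (D.par.tens P D.n)

/-- `V(•; N ⊗ P ⊗ N) ⟶ V(•; N ⊗ Q ⊗ N)` induced by `P ⟶ Q`. -/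
abbrev freeMap {P Q : Vᵒᵖ ⥤ Type u} (f : P ⟶ Q) : D.free P ⟶ D.free Q :=
  D.par.tensMap (𝟙 D.n) (D.par.tensMap f (𝟙 D.n))

/-- `N ⊗ (N ⊗ P) ⟶ N ⊗ P`, by associativity and `φ₂`. -/
def mergeL (P : Vᵒᵖ ⥤ Type u) : D.par.tens D.n (D.par.tens D.n P) ⟶ D.par.tens D.n P :=
  D.par.αInv D.n D.n P ≫ D.par.tensMap D.φ₂ (𝟙 P)

/-- `(P ⊗ N) ⊗ N ⟶ P ⊗ N`, by associativity and `φ₂`. -/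
def mergeR (P : Vᵒᵖ ⥤ Type u) : D.par.tens (D.par.tens P D.n) D.n ⟶ D.par.tens P D.n :=
  D.par.α P D.n D.n ≫ D.par.tensMap (𝟙 P) D.φ₂

/-- `N ⊗ (N ⊗ P ⊗ N) ⊗ N ⟶ N ⊗ P ⊗ N`, by associativity and `φ₂`. -/
def merge (P : Vᵒᵖ ⥤ Type u) : D.free (D.free P) ⟶ D.free P :=
  D.par.tensMap (𝟙 D.n) (D.par.α D.n (D.par.tens P D.n) D.n) ≫
    D.mergeL (D.par.tens (D.par.tens P D.n) D.n) ≫ D.par.tensMap (𝟙 D.n) (D.mergeR P)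

/-- The profunctor `𝓝V(A; B) = V(A; N ⊗ B ⊗ N)`. -/
def norm : Profunctor.{u} V V where
  obj B := D.free (yoneda.obj B)
  map f := D.freeMap (yoneda.map f)
  map_id B := by
    rw [CategoryTheory.Functor.map_id]
    exact (congrArg (D.par.tensMap (𝟙 D.n)) (convMap_id _ _ _)).trans (convMap_id _ _ _)
  map_comp f g := by
    rw [CategoryTheory.Functor.map_comp, convMap_comp, convMap_comp]
    rfl

/-- The map `V(•; B) ⟶ V(•; N ⊗ B ⊗ N)`, by unitality and `φ₀`. -/
def normIncl (P : Vᵒᵖ ⥤ Type u) : P ⟶ D.free P :=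
  D.par.rhoInv P ≫ D.par.lamInv (D.par.tens P D.par.unit) ≫
    D.par.tensMap D.φ₀ (D.par.tensMap (𝟙 P) D.φ₀)

/-- Given `act : N ⊗ P ⊗ N ⟶ P`, the action of `p ∈ 𝓝V(A'; A)` on `x ∈ P(A)`: the Yoneda reduction
`∫^A V(A'; N ⊗ A ⊗ N) × P(A) ≅ V(A'; N ⊗ P ⊗ N)` followed by `act`. -/
def actOn {P : Vᵒᵖ ⥤ Type u} (act : D.free P ⟶ P) {A' A : V}
    (p : (D.norm.obj A).obj (op A')) (x : P.obj (op A)) : P.obj (op A') :=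
  (D.freeMap (yonedaEquiv.symm x) ≫ act).app (op A') p

/-- The presheaf morphism `V(•; B) ⟶ V(•; N ⊗ B' ⊗ N)` corresponding to `q ∈ 𝓝V(B; B')`. -/
abbrev hat {B B' : V} (q : (D.norm.obj B').obj (op B)) :
    yoneda.obj B ⟶ D.free (yoneda.obj B') :=
  yonedaEquiv.symm q

/-- `V(•; N ⊗ B ⊗ N ⊗ C ⊗ N)`. -/
abbrev normPar (B C : V) : Vᵒᵖ ⥤ Type u :=
  D.free (D.par.tens (yoneda.obj B) (D.par.tens D.n (yoneda.obj C)))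

/-- The action of `q ∈ 𝓝V(B; B')` on `V(•; N ⊗ B ⊗ N ⊗ C ⊗ N)`: apply `q` and multiply the two pairs
of adjacent `N`s by `φ₂`. -/
def normParMapLeft {B B' : V} (q : (D.norm.obj B').obj (op B)) (C : V) :
    D.normPar B C ⟶ D.normPar B' C :=
  letI b' := yoneda.obj B'
  letI c := yoneda.obj C
  D.freeMap
      (D.par.tensMap (D.hat q) (𝟙 (D.par.tens D.n c)) ≫
        D.par.α D.n (D.par.tens b' D.n) (D.par.tens D.n c) ≫
        D.par.tensMap (𝟙 D.n)
          (D.par.α b' D.n (D.par.tens D.n c) ≫ D.par.tensMap (𝟙 b') (D.mergeL c))) ≫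
    D.par.tensMap (𝟙 D.n) (D.par.α D.n (D.par.tens b' (D.par.tens D.n c)) D.n) ≫
    D.mergeL (D.par.tens (D.par.tens b' (D.par.tens D.n c)) D.n)

/-- The action of `q ∈ 𝓝V(C; C')` on `V(•; N ⊗ B ⊗ N ⊗ C ⊗ N)`: apply `q` and multiply the two pairs
of adjacent `N`s by `φ₂`. -/
def normParMapRight (B : V) {C C' : V} (q : (D.norm.obj C').obj (op C)) :
    D.normPar B C ⟶ D.normPar B C' :=
  letI b := yoneda.obj B
  letI c' := yoneda.obj C'
  D.freeMap
      (D.par.tensMap (𝟙 b)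
        (D.par.tensMap (𝟙 D.n) (D.hat q) ≫ D.mergeL (D.par.tens c' D.n) ≫
          D.par.αInv D.n c' D.n) ≫
        D.par.αInv b (D.par.tens D.n c') D.n) ≫
    D.par.tensMap (𝟙 D.n) (D.mergeR (D.par.tens b (D.par.tens D.n c')))

/-- The covariant action of `q ∈ 𝓝V(B; B')` and `r ∈ 𝓝V(C; C')` on `V(•; N ⊗ B ⊗ N ⊗ C ⊗ N)`. -/
def normParMap {B B' C C' : V} (q : (D.norm.obj B').obj (op B)) (r : (D.norm.obj C').obj (op C)) :
    D.normPar B C ⟶ D.normPar B' C' :=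
  D.normParMapLeft q C ≫ D.normParMapRight B' r

/-- `V(•; (N ⊗ B ⊗ N) ◁ (N ⊗ C ⊗ N))`. -/
abbrev normSeq (B C : V) : Vᵒᵖ ⥤ Type u :=
  D.seq.tens (D.free (yoneda.obj B)) (D.free (yoneda.obj C))

/-- `N ⊗ (P ◁ Q) ⊗ N ⟶ (N ⊗ P ⊗ N) ◁ (N ⊗ Q ⊗ N)`, by the unitors `N ≅ N ◁ N` and `ψ₂`. -/
def distrib (P Q : Vᵒᵖ ⥤ Type u) :
    D.free (D.seq.tens P Q) ⟶ D.seq.tens (D.free P) (D.free Q) :=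
  D.par.tensMap (D.seq.lamInv D.n)
      (D.par.tensMap (𝟙 (D.seq.tens P Q)) (D.seq.lamInv D.n) ≫ D.ψ P Q D.n D.n) ≫
    D.ψ D.n D.n (D.par.tens P D.n) (D.par.tens Q D.n)

/-- `N ⊗ ((N ⊗ P ⊗ N) ◁ (N ⊗ Q ⊗ N)) ⊗ N ⟶ (N ⊗ P ⊗ N) ◁ (N ⊗ Q ⊗ N)`. -/
def mergeSeq (P Q : Vᵒᵖ ⥤ Type u) :
    D.free (D.seq.tens (D.free P) (D.free Q)) ⟶ D.seq.tens (D.free P) (D.free Q) :=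
  D.distrib (D.free P) (D.free Q) ≫ D.seq.tensMap (D.merge P) (D.merge Q)

/-- The covariant action of `q ∈ 𝓝V(B; B')` and `r ∈ 𝓝V(C; C')` on `V(•; (N ⊗ B ⊗ N) ◁ (N ⊗ C ⊗ N))`. -/
def normSeqMap {B B' C C' : V} (q : (D.norm.obj B').obj (op B)) (r : (D.norm.obj C').obj (op C)) :
    D.normSeq B C ⟶ D.normSeq B' C' :=
  D.seq.tensMap (D.freeMap (D.hat q) ≫ D.merge (yoneda.obj B'))
    (D.freeMap (D.hat r) ≫ D.merge (yoneda.obj C'))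

/-- `N ⊗ N ⊗ N ⟶ N`, by `φ₂`. -/
def mergeUnit : D.free D.n ⟶ D.n :=
  D.par.tensMap (𝟙 D.n) D.φ₂ ≫ D.φ₂

end ProduoidalData

end Normalization

end Produo

open Produo

universe v w

/-! ### Abstract monoidal and duoidal structures -/

namespace Produo

/-! The theorem is the restriction to free objects of a statement about bimodules. Day convolution
makes the presheaves on `V` monoidal in two ways, and the laxators extend to arbitrary presheaves
(`Promonoidal.day`, `Produoidal.dayLaxator`). In this duoidal category `N`, the unit of the
sequential tensor, is a monoid for the parallel tensor. In any duoidal category whose parallel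
tensor preserves coequalizers on both sides, the bimodules over `N` form a normal duoidal category
(`Laxator.bimod`). The parallel tensor is the relative tensor product over `N`. The sequential
tensor is that of the base, with `N` acting through the comultiplication `N ≅ N ◁ N` and the
interchange `ψ`. Both units are `N` itself, so `φ₀` is an identity.

The presheaf `N ⊗ B ⊗ N` is the free bimodule on the representable `B`. Freeness and the Yoneda
lemma identify `V(A; N ⊗ B ⊗ N)` with the bimodule morphisms from the free bimodule on `A` to the
one on `B` (`evEquiv`), and under this identification the proposed multiplication is composition
(`lift_star`). Hence the promonad laws hold, and the Kleisli category is the full subcategory of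
free bimodules on representables (`freeFunctorFullyFaithful`).

A duoidal structure on `E` restricts along a fully faithful `J : K ⥤ E`, with splits `E(J A; J X ⊗ J
Y)`, as soon as `J` computes both tensors by coends (`Convolutive`). Then every nested composite of
profunctors is the nerve of the corresponding nested tensor of `E`. Each structural map of `K` is
carried to one of `E` by invertible comparisons, and so are the axioms (`Represents.eq`,
`Laxator.produoidal`). For free bimodules convolutivity follows from presenting both tensors by the
splits of `V`: every element of a tensor of bimodules comes from free bimodules on representables,
and so does every identification between such elements (`Presentation.convolutive`).

It remains to recognize the splits. The sequential ones have the stated form by construction. For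
the parallel ones, the relative tensor product of the free bimodules on `B` and `C` is the free
bimodule on `B ⊗ N ⊗ C`, because the defining coequalizer is split by inserting the unit of `N`
(`freeFuse`). -/

theorem sq_assoc {E : Type w} [Category.{v} E] {X Y Y' Z W : E} {f : X ⟶ Y} {g : Y ⟶ Z}
    {f' : X ⟶ Y'} {g' : Y' ⟶ Z} (h : f ≫ g = f' ≫ g') (k : Z ⟶ W) :
    f ≫ g ≫ k = f' ≫ g' ≫ k := by
  rw [← Category.assoc, h, Category.assoc]

/-- A monoidal structure on a category, presented by a two-variable tensor on morphisms. -/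
structure TensorStr (E : Type w) [Category.{v} E] where
  obj : E → E → E
  map {P P' Q Q' : E} (f : P ⟶ P') (g : Q ⟶ Q') : obj P Q ⟶ obj P' Q'
  unit : E
  assoc (P Q R : E) : obj (obj P Q) R ≅ obj P (obj Q R)
  lam (P : E) : obj unit P ≅ P
  rho (P : E) : obj P unit ≅ P
  map_id (P Q : E) : map (𝟙 P) (𝟙 Q) = 𝟙 (obj P Q)
  map_comp {P P' P'' Q Q' Q'' : E} (f : P ⟶ P') (f' : P' ⟶ P'') (g : Q ⟶ Q') (g' : Q' ⟶ Q'') :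
    map (f ≫ f') (g ≫ g') = map f g ≫ map f' g'
  assoc_nat {P P' Q Q' R R' : E} (f : P ⟶ P') (g : Q ⟶ Q') (h : R ⟶ R') :
    map (map f g) h ≫ (assoc P' Q' R').hom = (assoc P Q R).hom ≫ map f (map g h)
  lam_nat {P P' : E} (f : P ⟶ P') : map (𝟙 unit) f ≫ (lam P').hom = (lam P).hom ≫ f
  rho_nat {P P' : E} (f : P ⟶ P') : map f (𝟙 unit) ≫ (rho P').hom = (rho P).hom ≫ f
  pentagon (P Q R S : E) :
    map (assoc P Q R).hom (𝟙 S) ≫ (assoc P (obj Q R) S).hom ≫ map (𝟙 P) (assoc Q R S).hom =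
      (assoc (obj P Q) R S).hom ≫ (assoc P Q (obj R S)).hom
  triangle (P Q : E) :
    (assoc P unit Q).hom ≫ map (𝟙 P) (lam Q).hom = map (rho P).hom (𝟙 Q)

/-- Laxators making a pair of monoidal structures into a duoidal structure. -/
structure Laxator {E : Type w} [Category.{v} E] (p s : TensorStr E) where
  ψ (P Q R S : E) : p.obj (s.obj P Q) (s.obj R S) ⟶ s.obj (p.obj P R) (p.obj Q S)
  ψ₀ : p.unit ⟶ s.obj p.unit p.unit
  φ₂ : p.obj s.unit s.unit ⟶ s.unit
  φ₀ : p.unit ⟶ s.unit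
  ψ_nat {P P' Q Q' R R' S S' : E} (f : P ⟶ P') (g : Q ⟶ Q') (h : R ⟶ R') (k : S ⟶ S') :
    p.map (s.map f g) (s.map h k) ≫ ψ P' Q' R' S' = ψ P Q R S ≫ s.map (p.map f h) (p.map g k)
  ψ_assoc_par (a b c d e f : E) :
    p.map (ψ a b c d) (𝟙 (s.obj e f)) ≫ ψ (p.obj a c) (p.obj b d) e f ≫
        s.map (p.assoc a c e).hom (p.assoc b d f).hom =
      (p.assoc (s.obj a b) (s.obj c d) (s.obj e f)).hom ≫ p.map (𝟙 (s.obj a b)) (ψ c d e f) ≫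
        ψ a b (p.obj c e) (p.obj d f)
  ψ_assoc_seq (a b c d e f : E) :
    ψ (s.obj a b) c (s.obj d e) f ≫ s.map (ψ a b d e) (𝟙 (p.obj c f)) ≫
        (s.assoc (p.obj a d) (p.obj b e) (p.obj c f)).hom =
      p.map (s.assoc a b c).hom (s.assoc d e f).hom ≫ ψ a (s.obj b c) d (s.obj e f) ≫
        s.map (𝟙 (p.obj a d)) (ψ b c e f)
  ψ_unit_left (a b : E) :
    p.map ψ₀ (𝟙 (s.obj a b)) ≫ ψ p.unit p.unit a b ≫ s.map (p.lam a).hom (p.lam b).hom =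
      (p.lam (s.obj a b)).hom
  ψ_unit_right (a b : E) :
    p.map (𝟙 (s.obj a b)) ψ₀ ≫ ψ a b p.unit p.unit ≫ s.map (p.rho a).hom (p.rho b).hom =
      (p.rho (s.obj a b)).hom
  φ_unit_left (a b : E) :
    ψ s.unit a s.unit b ≫ s.map φ₂ (𝟙 (p.obj a b)) ≫ (s.lam (p.obj a b)).hom =
      p.map (s.lam a).hom (s.lam b).hom
  φ_unit_right (a b : E) :
    ψ a s.unit b s.unit ≫ s.map (𝟙 (p.obj a b)) φ₂ ≫ (s.rho (p.obj a b)).hom =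
      p.map (s.rho a).hom (s.rho b).hom
  φ₂_assoc :
    p.map φ₂ (𝟙 s.unit) ≫ φ₂ =
      (p.assoc s.unit s.unit s.unit).hom ≫ p.map (𝟙 s.unit) φ₂ ≫ φ₂
  φ₂_unit_left : p.map φ₀ (𝟙 s.unit) ≫ φ₂ = (p.lam s.unit).hom
  φ₂_unit_right : p.map (𝟙 s.unit) φ₀ ≫ φ₂ = (p.rho s.unit).hom
  ψ₀_coassoc :
    ψ₀ ≫ s.map ψ₀ (𝟙 p.unit) ≫ (s.assoc p.unit p.unit p.unit).hom = ψ₀ ≫ s.map (𝟙 p.unit) ψ₀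
  ψ₀_counit_left : ψ₀ ≫ s.map φ₀ (𝟙 p.unit) ≫ (s.lam p.unit).hom = 𝟙 p.unit
  ψ₀_counit_right : ψ₀ ≫ s.map (𝟙 p.unit) φ₀ ≫ (s.rho p.unit).hom = 𝟙 p.unit

/-! ### Jointly surjective families of presheaf morphisms -/

section Covers

variable {V : Type u} [SmallCategory V]

/-- A family of presheaf morphisms that is jointly surjective. -/
def Covers {ι : Type w} {P : Vᵒᵖ ⥤ Type u} (F : ι → Vᵒᵖ ⥤ Type u) (m : ∀ i, F i ⟶ P) : Prop :=
  ∀ (A : Vᵒᵖ) (x : P.obj A), ∃ (i : ι) (y : (F i).obj A), (m i).app A y = x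

theorem Covers.hom_ext {ι : Type w} {P H : Vᵒᵖ ⥤ Type u} {F : ι → Vᵒᵖ ⥤ Type u}
    {m : ∀ i, F i ⟶ P} (hm : Covers F m) {f g : P ⟶ H} (h : ∀ i, m i ≫ f = m i ≫ g) : f = g := by
  ext A x
  obtain ⟨i, y, rfl⟩ := hm A x
  exact congrArg (fun k => k.app A y) (h i)

theorem Covers.id (P : Vᵒᵖ ⥤ Type u) : Covers (fun _ : Unit => P) (fun _ => 𝟙 P) :=
  fun _ x => ⟨(), x, rfl⟩

/-- By the Yoneda lemma, an element of `P` is the image of an identity under the map that it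
classifies. -/
theorem Covers.yoneda (P : Vᵒᵖ ⥤ Type u) :
    Covers (fun i : Σ X : V, (CategoryTheory.yoneda.obj X ⟶ P) => CategoryTheory.yoneda.obj i.1)
      (fun i => i.2) :=
  fun A x => ⟨⟨A.unop, yonedaEquiv.symm x⟩, 𝟙 A.unop,
    yonedaEquiv.apply_symm_apply (show P.obj (op A.unop) from x)⟩

/-- A representative of an element of the coend carries elements of `P` and `Q`, and these lift
separately. Iterating this covers every nested tensor of presheaves by nested tensors of
representables, so an equation between natural maps need only be checked on representables. -/
theorem Covers.conv (T : Profunctor.{u} (V × V) V) {ι : Type v} {κ : Type w}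
    {P Q : Vᵒᵖ ⥤ Type u} {F : ι → Vᵒᵖ ⥤ Type u} {G : κ → Vᵒᵖ ⥤ Type u}
    {m : ∀ i, F i ⟶ P} {n : ∀ i, G i ⟶ Q} (hm : Covers F m) (hn : Covers G n) :
    Covers (fun i : ι × κ => Produo.conv T (F i.1) (G i.2))
      (fun i => convMap T (m i.1) (n i.2)) := by
  intro A s
  induction s using comp.ind with
  | _ b t y =>
    obtain ⟨p, q⟩ := y
    obtain ⟨i, p, rfl⟩ := hm _ p
    obtain ⟨j, q, rfl⟩ := hn _ q
    exact ⟨(i, j), comp.mk T (ext (F i) (G j)) b t (p, q), rfl⟩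

end Covers

/-! ### Associators and unitors with arbitrary presheaves in the ports -/

namespace PromonoidalData

variable {V : Type u} [SmallCategory V] (M : PromonoidalData V)

theorem conv_hom_ext {T : Profunctor.{u} (V × V) V} {P Q H : Vᵒᵖ ⥤ Type u}
    {f g : conv T P Q ⟶ H}
    (h : ∀ (X Y : V) (p : P.obj (op X)) (q : Q.obj (op Y)), plug T p q ≫ f = plug T p q ≫ g) :
    f = g :=
  comp.hom_ext fun b y => h b.1 b.2 y.1 y.2

/-- This is how `α` was defined on representatives. Since such plugged maps are jointly epic
(`conv_conv_hom_ext`), the rules of this kind for `α`, `αInv`, `lam` and `rho` are all that later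
arguments need about these definitions. -/
theorem plugR_α {X Y Z : V} {P Q R : Vᵒᵖ ⥤ Type u} (p : P.obj (op X)) (q : Q.obj (op Y))
    (r : R.obj (op Z)) :
    plugR M.tensor (plug M.tensor p q) r ≫ M.α P Q R =
      (M.assoc X Y Z).hom ≫ plugL M.tensor p (plug M.tensor q r) :=
  comp.hom_ext fun _ _ => rfl

theorem plugL_αInv {X Y Z : V} {P Q R : Vᵒᵖ ⥤ Type u} (p : P.obj (op X)) (q : Q.obj (op Y))
    (r : R.obj (op Z)) :
    plugL M.tensor p (plug M.tensor q r) ≫ M.αInv P Q R =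
      (M.assoc X Y Z).inv ≫ plugR M.tensor (plug M.tensor p q) r :=
  comp.hom_ext fun _ _ => rfl

theorem plugR_lam {Z : V} {P : Vᵒᵖ ⥤ Type u} (p : P.obj (op Z)) :
    plugR M.tensor (𝟙 M.unit) p ≫ M.lam P = (M.leftUnitor Z).hom ≫ yonedaEquiv.symm p :=
  comp.hom_ext fun _ _ => rfl

theorem plugL_rho {Z : V} {P : Vᵒᵖ ⥤ Type u} (p : P.obj (op Z)) :
    plugL M.tensor p (𝟙 M.unit) ≫ M.rho P = (M.rightUnitor Z).hom ≫ yonedaEquiv.symm p :=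
  comp.hom_ext fun _ _ => rfl

theorem plugR_convMap (T : Profunctor.{u} (V × V) V) {G P P' R R' : Vᵒᵖ ⥤ Type u} (g : G ⟶ P)
    {Z : V} (r : R.obj (op Z)) (f : P ⟶ P') (h : R ⟶ R') :
    plugR T g r ≫ convMap T f h = plugR T (g ≫ f) (h.app _ r) :=
  comp.hom_ext fun _ _ => rfl

theorem plugL_convMap (T : Profunctor.{u} (V × V) V) {G P P' R R' : Vᵒᵖ ⥤ Type u} (g : G ⟶ P)
    {Z : V} (r : R.obj (op Z)) (f : P ⟶ P') (h : R ⟶ R') :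
    plugL T r g ≫ convMap T h f = plugL T (h.app _ r) (g ≫ f) :=
  comp.hom_ext fun _ _ => rfl

/-- Morphisms out of `(P ⊗ Q) ⊗ R` are determined by their values on plugged elements. -/
theorem conv_conv_hom_ext {T : Profunctor.{u} (V × V) V} {P Q R H : Vᵒᵖ ⥤ Type u}
    {f g : conv T (conv T P Q) R ⟶ H}
    (h : ∀ (X Y Z : V) (p : P.obj (op X)) (q : Q.obj (op Y)) (r : R.obj (op Z)),
      plugR T (plug T p q) r ≫ f = plugR T (plug T p q) r ≫ g) : f = g := by
  ext A s
  induction s using comp.ind with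
  | _ b t y =>
    obtain ⟨y, r⟩ := y
    induction y using comp.ind with
    | _ c s y =>
      exact congrArg (fun k => k.app A (comp.mk (portL T b.2) (T.obj c) b.1 t s))
        (h c.1 c.2 b.2 y.1 y.2 r)

/-- Morphisms out of `P ⊗ (Q ⊗ R)` are determined by their values on plugged elements. -/
theorem conv_conv_hom_ext' {T : Profunctor.{u} (V × V) V} {P Q R H : Vᵒᵖ ⥤ Type u}
    {f g : conv T P (conv T Q R) ⟶ H}
    (h : ∀ (X Y Z : V) (p : P.obj (op X)) (q : Q.obj (op Y)) (r : R.obj (op Z)),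
      plugL T p (plug T q r) ≫ f = plugL T p (plug T q r) ≫ g) : f = g := by
  ext A s
  induction s using comp.ind with
  | _ b t y =>
    obtain ⟨p, y⟩ := y
    induction y using comp.ind with
    | _ c s y =>
      exact congrArg (fun k => k.app A (comp.mk (portR T b.1) (T.obj c) b.2 t s))
        (h b.1 c.1 c.2 p y.1 y.2)

theorem conv_unit_hom_ext {P H : Vᵒᵖ ⥤ Type u} {f g : M.tens M.unit P ⟶ H}
    (h : ∀ (Z : V) (p : P.obj (op Z)),
      plugR M.tensor (𝟙 M.unit) p ≫ f = plugR M.tensor (𝟙 M.unit) p ≫ g) : f = g := by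
  ext A s
  induction s using comp.ind with
  | _ b t y =>
    exact congrArg (fun k => k.app A (comp.mk (portL M.tensor b.2) M.unit b.1 t y.1)) (h b.2 y.2)

theorem conv_unit_hom_ext' {P H : Vᵒᵖ ⥤ Type u} {f g : M.tens P M.unit ⟶ H}
    (h : ∀ (Z : V) (p : P.obj (op Z)),
      plugL M.tensor p (𝟙 M.unit) ≫ f = plugL M.tensor p (𝟙 M.unit) ≫ g) : f = g := by
  ext A s
  induction s using comp.ind with
  | _ b t y =>
    exact congrArg (fun k => k.app A (comp.mk (portR M.tensor b.1) M.unit b.2 t y.2)) (h b.1 y.1)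

theorem tensMap_id (P Q : Vᵒᵖ ⥤ Type u) : M.tensMap (𝟙 P) (𝟙 Q) = 𝟙 (M.tens P Q) :=
  convMap_id _ P Q

theorem tensMap_comp {P P' P'' Q Q' Q'' : Vᵒᵖ ⥤ Type u} (f : P ⟶ P') (f' : P' ⟶ P'')
    (g : Q ⟶ Q') (g' : Q' ⟶ Q'') :
    M.tensMap f g ≫ M.tensMap f' g' = M.tensMap (f ≫ f') (g ≫ g') :=
  convMap_comp _ f f' g g'

theorem α_natural {P P' Q Q' R R' : Vᵒᵖ ⥤ Type u} (f : P ⟶ P') (g : Q ⟶ Q') (h : R ⟶ R') :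
    M.tensMap (M.tensMap f g) h ≫ M.α P' Q' R' = M.α P Q R ≫ M.tensMap f (M.tensMap g h) := by
  refine conv_conv_hom_ext fun X Y Z p q r => ?_
  rw [← Category.assoc, plugR_convMap, plug_convMap, plugR_α, ← Category.assoc, plugR_α,
    Category.assoc, plugL_convMap, plug_convMap]

theorem α_αInv (P Q R : Vᵒᵖ ⥤ Type u) : M.α P Q R ≫ M.αInv P Q R = 𝟙 _ := by
  refine conv_conv_hom_ext fun X Y Z p q r => ?_
  rw [← Category.assoc, plugR_α, Category.assoc, plugL_αInv, Iso.hom_inv_id_assoc,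
    Category.comp_id]

theorem αInv_α (P Q R : Vᵒᵖ ⥤ Type u) : M.αInv P Q R ≫ M.α P Q R = 𝟙 _ := by
  refine conv_conv_hom_ext' fun X Y Z p q r => ?_
  rw [← Category.assoc, plugL_αInv, Category.assoc, plugR_α, Iso.inv_hom_id_assoc,
    Category.comp_id]

theorem lam_natural {P P' : Vᵒᵖ ⥤ Type u} (f : P ⟶ P') :
    M.tensMap (𝟙 M.unit) f ≫ M.lam P' = M.lam P ≫ f := by
  refine conv_unit_hom_ext M fun Z p => ?_
  rw [← Category.assoc, plugR_convMap, Category.id_comp, plugR_lam, ← Category.assoc, plugR_lam,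
    Category.assoc, yonedaEquiv_symm_naturality_right]

theorem rho_natural {P P' : Vᵒᵖ ⥤ Type u} (f : P ⟶ P') :
    M.tensMap f (𝟙 M.unit) ≫ M.rho P' = M.rho P ≫ f := by
  refine conv_unit_hom_ext' M fun Z p => ?_
  rw [← Category.assoc, plugL_convMap, Category.id_comp, plugL_rho, ← Category.assoc, plugL_rho,
    Category.assoc, yonedaEquiv_symm_naturality_right]

/-- A map out of a representable is determined by its value at the identity, and `lamInv` was
defined by prescribing this value. -/
theorem yoneda_lamInv {P : Vᵒᵖ ⥤ Type u} {Z : V} (p : P.obj (op Z)) :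
    yonedaEquiv.symm p ≫ M.lamInv P =
      (M.leftUnitor Z).inv ≫ plugR M.tensor (𝟙 M.unit) p := by
  apply yonedaEquiv.injective
  simp [yonedaEquiv_apply, lamInv, yonedaEquiv_symm_app_apply]

theorem yoneda_rhoInv {P : Vᵒᵖ ⥤ Type u} {Z : V} (p : P.obj (op Z)) :
    yonedaEquiv.symm p ≫ M.rhoInv P =
      (M.rightUnitor Z).inv ≫ plugL M.tensor p (𝟙 M.unit) := by
  apply yonedaEquiv.injective
  simp [yonedaEquiv_apply, rhoInv, yonedaEquiv_symm_app_apply]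

theorem lam_lamInv (P : Vᵒᵖ ⥤ Type u) : M.lam P ≫ M.lamInv P = 𝟙 _ := by
  refine conv_unit_hom_ext M fun Z p => ?_
  rw [← Category.assoc, plugR_lam, Category.assoc, yoneda_lamInv, Iso.hom_inv_id_assoc,
    Category.comp_id]

theorem rho_rhoInv (P : Vᵒᵖ ⥤ Type u) : M.rho P ≫ M.rhoInv P = 𝟙 _ := by
  refine conv_unit_hom_ext' M fun Z p => ?_
  rw [← Category.assoc, plugL_rho, Category.assoc, yoneda_rhoInv, Iso.hom_inv_id_assoc,
    Category.comp_id]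

theorem lamInv_lam (P : Vᵒᵖ ⥤ Type u) : M.lamInv P ≫ M.lam P = 𝟙 _ := by
  refine (Covers.yoneda P).hom_ext fun ⟨Z, p⟩ => ?_
  obtain ⟨p, rfl⟩ := yonedaEquiv.symm.surjective p
  dsimp only
  rw [← Category.assoc, yoneda_lamInv, Category.assoc, plugR_lam, Iso.inv_hom_id_assoc,
    Category.comp_id]

theorem rhoInv_rho (P : Vᵒᵖ ⥤ Type u) : M.rhoInv P ≫ M.rho P = 𝟙 _ := by
  refine (Covers.yoneda P).hom_ext fun ⟨Z, p⟩ => ?_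
  obtain ⟨p, rfl⟩ := yonedaEquiv.symm.surjective p
  dsimp only
  rw [← Category.assoc, yoneda_rhoInv, Category.assoc, plugL_rho, Iso.inv_hom_id_assoc,
    Category.comp_id]

end PromonoidalData

end Produo

/-! ### Day convolution: presheaves form a duoidal category -/

namespace Produo

namespace Promonoidal

variable {V : Type u} [SmallCategory V] (M : Promonoidal V)

theorem α_pentagon (P Q R S : Vᵒᵖ ⥤ Type u) :
    M.tensMap (M.α P Q R) (𝟙 S) ≫ M.α P (M.tens Q R) S ≫ M.tensMap (𝟙 P) (M.α Q R S) =
      M.α (M.tens P Q) R S ≫ M.α P Q (M.tens R S) := by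
  refine ((((Covers.yoneda P).conv M.tensor (Covers.yoneda Q)).conv M.tensor
    (Covers.yoneda R)).conv M.tensor (Covers.yoneda S)).hom_ext ?_
  rintro ⟨⟨⟨⟨A, p⟩, ⟨B, q⟩⟩, ⟨C, r⟩⟩, ⟨D, s⟩⟩
  
  -- The covering map on the left slides through each associator by naturality and ends up on the
  -- right, where it follows the pentagon for the representables `A`, `B`, `C`, `D`.
  have h := congrArg (· ≫ M.tensMap p (M.tensMap q (M.tensMap r s))) (M.pentagon A B C D)
  simp only [Category.assoc] at h
  have h₁ : M.tensMap (M.tensMap (M.tensMap p q) r) s ≫ M.tensMap (M.α P Q R) (𝟙 S) =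
      M.tensMap (M.α _ _ _) (𝟙 _) ≫ M.tensMap (M.tensMap p (M.tensMap q r)) s := by
    rw [M.tensMap_comp, M.tensMap_comp, M.α_natural, Category.comp_id, Category.id_comp]
  have h₂ : M.tensMap p (M.tensMap (M.tensMap q r) s) ≫ M.tensMap (𝟙 P) (M.α Q R S) =
      M.tensMap (𝟙 _) (M.α _ _ _) ≫ M.tensMap p (M.tensMap q (M.tensMap r s)) := by
    rw [M.tensMap_comp, M.tensMap_comp, M.α_natural, Category.comp_id, Category.id_comp]
  refine Eq.trans ?_ (h.trans ?_)
  · refine (sq_assoc h₁ _).trans (congrArg _ ((sq_assoc (M.α_natural _ _ _) _).trans ?_))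
    exact congrArg _ h₂
  · rw [← M.α_natural, ← Category.assoc, ← M.α_natural, Category.assoc]

theorem α_triangle (P Q : Vᵒᵖ ⥤ Type u) :
    M.α P M.unit Q ≫ M.tensMap (𝟙 P) (M.lam Q) = M.tensMap (M.rho P) (𝟙 Q) := by
  refine (((Covers.yoneda P).conv M.tensor (Covers.id M.unit)).conv M.tensor
    (Covers.yoneda Q)).hom_ext ?_
  rintro ⟨⟨⟨A, p⟩, -⟩, ⟨B, q⟩⟩
  
  have h := congrArg (· ≫ M.tensMap p q) (M.triangle A B)
  rw [← Category.assoc, M.α_natural, convMap_comp, Category.assoc, convMap_comp,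
    M.lam_natural, M.rho_natural, Category.comp_id, Category.comp_id]
  rw [Category.assoc, convMap_comp, convMap_comp, Category.id_comp, Category.id_comp] at h
  exact h

/-- Day convolution. -/
def day : TensorStr (Vᵒᵖ ⥤ Type u) where
  obj := M.tens
  map := M.tensMap
  unit := M.unit
  assoc P Q R := ⟨M.α P Q R, M.αInv P Q R, M.α_αInv P Q R, M.αInv_α P Q R⟩
  lam P := ⟨M.lam P, M.lamInv P, M.lam_lamInv P, M.lamInv_lam P⟩
  rho P := ⟨M.rho P, M.rhoInv P, M.rho_rhoInv P, M.rhoInv_rho P⟩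
  map_id := convMap_id _
  map_comp f f' g g' := (convMap_comp _ f f' g g').symm
  assoc_nat := M.α_natural
  lam_nat := M.lam_natural
  rho_nat := M.rho_natural
  pentagon := M.α_pentagon
  triangle := M.α_triangle

end Promonoidal

namespace ProduoidalData

variable {V : Type u} [SmallCategory V] (D : ProduoidalData V)

/-- On representatives `ψ` applies `ψ₂` to the splits and carries the elements in the ports along
unchanged, while maps of the ports affect only these elements. -/
theorem ψ_natural {P P' Q Q' R R' S S' : Vᵒᵖ ⥤ Type u} (f : P ⟶ P') (g : Q ⟶ Q') (h : R ⟶ R') (k : S ⟶ S') :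
    D.par.tensMap (D.seq.tensMap f g) (D.seq.tensMap h k) ≫ D.ψ P' Q' R' S' =
      D.ψ P Q R S ≫ D.seq.tensMap (D.par.tensMap f h) (D.par.tensMap g k) := by
  ext A s
  induction s using comp.ind with
  | _ b t y =>
    obtain ⟨y, z⟩ := y
    induction y using comp.ind with
    | _ c s p =>
      induction z using comp.ind with
      | _ d r q =>
        change (plug D.par.tensor (P := D.seq.tensor.obj c) (Q := D.seq.tensor.obj d) s r ≫
            D.ψ₂ c.1 c.2 d.1 d.2 ≫ D.seq.tensMap _ _).app A t =
          (plug D.par.tensor (P := D.seq.tensor.obj c) (Q := D.seq.tensor.obj d) s r ≫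
            D.ψ₂ c.1 c.2 d.1 d.2 ≫ D.seq.tensMap _ _ ≫ D.seq.tensMap _ _).app A t
        rw [convMap_comp, plug_convMap, plug_convMap]
        rfl

end ProduoidalData

namespace Produoidal

variable {V : Type u} [SmallCategory V] (D : Produoidal V)

/-- The laxators of a produoidal category extend to all presheaves. -/
def dayLaxator : Laxator D.par.day D.seq.day where
  ψ := D.ψ
  ψ₀ := D.ψ₀
  φ₂ := D.φ₂
  φ₀ := D.φ₀
  ψ_nat := D.ψ_natural
  ψ_assoc_par a b c d e f := by
    -- As for the pentagon: cover the domain by tensors of representables, move the covering maps to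
    -- the far end by naturality, and apply the axiom for representables. The axioms below with
    -- variables are treated alike.
    refine ((((Covers.yoneda a).conv D.seq.tensor (Covers.yoneda b)).conv D.par.tensor
      ((Covers.yoneda c).conv D.seq.tensor (Covers.yoneda d))).conv D.par.tensor
        ((Covers.yoneda e).conv D.seq.tensor (Covers.yoneda f))).hom_ext ?_
    rintro ⟨⟨⟨⟨A, a'⟩, ⟨B, b'⟩⟩, ⟨⟨C, c'⟩, ⟨X, d'⟩⟩⟩, ⟨⟨E, e'⟩, ⟨F, f'⟩⟩⟩
    have h := congrArg (· ≫ D.seq.tensMap (D.par.tensMap a' (D.par.tensMap c' e'))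
      (D.par.tensMap b' (D.par.tensMap d' f'))) (D.ψ_assoc_par A B C X E F)
    simp only [Category.assoc] at h
    have h₁ : D.par.tensMap (D.par.tensMap (D.seq.tensMap a' b') (D.seq.tensMap c' d'))
        (D.seq.tensMap e' f') ≫ D.par.tensMap (D.ψ a b c d) (𝟙 (D.seq.tens e f)) =
        D.par.tensMap (D.ψ _ _ _ _) (𝟙 _) ≫ D.par.tensMap (D.seq.tensMap (D.par.tensMap a' c')
          (D.par.tensMap b' d')) (D.seq.tensMap e' f') := by
      rw [PromonoidalData.tensMap_comp, PromonoidalData.tensMap_comp, D.ψ_natural, Category.id_comp, Category.comp_id]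
    have h₂ : D.par.tensMap (D.seq.tensMap a' b') (D.par.tensMap (D.seq.tensMap c' d')
        (D.seq.tensMap e' f')) ≫ D.par.tensMap (𝟙 (D.seq.tens a b)) (D.ψ c d e f) =
        D.par.tensMap (𝟙 _) (D.ψ _ _ _ _) ≫ D.par.tensMap (D.seq.tensMap a' b')
          (D.seq.tensMap (D.par.tensMap c' e') (D.par.tensMap d' f')) := by
      rw [PromonoidalData.tensMap_comp, PromonoidalData.tensMap_comp, D.ψ_natural, Category.id_comp, Category.comp_id]
    have h₃ := D.ψ_natural (D.par.tensMap a' c') (D.par.tensMap b' d') e' f'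
    have h₄ := D.ψ_natural a' b' (D.par.tensMap c' e') (D.par.tensMap d' f')
    refine Eq.trans ?_ (h.trans ?_)
    · refine (sq_assoc h₁ _).trans (congrArg _ ((sq_assoc h₃ _).trans (congrArg _ ?_)))
      exact (convMap_comp _ _ _ _ _).trans ((congrArg₂ D.seq.tensMap (D.par.α_natural _ _ _) (D.par.α_natural _ _ _)).trans
        (convMap_comp _ _ _ _ _).symm)
    · rw [← h₄, ← reassoc_of% h₂]
      exact sq_assoc (D.par.α_natural _ _ _).symm _
  ψ_assoc_seq a b c d e f := by
    refine ((((Covers.yoneda a).conv D.seq.tensor (Covers.yoneda b)).conv D.seq.tensor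
      (Covers.yoneda c)).conv D.par.tensor
        (((Covers.yoneda d).conv D.seq.tensor (Covers.yoneda e)).conv D.seq.tensor
        (Covers.yoneda f))).hom_ext ?_
    rintro ⟨⟨⟨⟨A, a'⟩, ⟨B, b'⟩⟩, ⟨C, c'⟩⟩, ⟨⟨⟨X, d'⟩, ⟨E, e'⟩⟩, ⟨F, f'⟩⟩⟩
    have h := congrArg (· ≫ D.seq.tensMap (D.par.tensMap a' d') (D.seq.tensMap (D.par.tensMap b' e')
      (D.par.tensMap c' f'))) (D.ψ_assoc_seq A B C X E F)
    simp only [Category.assoc] at h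
    have h₁ := D.ψ_natural (D.seq.tensMap a' b') c' (D.seq.tensMap d' e') f'
    have h₂ : D.seq.tensMap (D.par.tensMap (D.seq.tensMap a' b') (D.seq.tensMap d' e'))
        (D.par.tensMap c' f') ≫ D.seq.tensMap (D.ψ a b d e) (𝟙 (D.par.tens c f)) =
        D.seq.tensMap (D.ψ _ _ _ _) (𝟙 _) ≫ D.seq.tensMap (D.seq.tensMap (D.par.tensMap a' d')
          (D.par.tensMap b' e')) (D.par.tensMap c' f') := by
      rw [PromonoidalData.tensMap_comp, PromonoidalData.tensMap_comp, D.ψ_natural, Category.id_comp, Category.comp_id]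
    have h₃ : D.seq.tensMap (D.par.tensMap a' d') (D.par.tensMap (D.seq.tensMap b' c')
        (D.seq.tensMap e' f')) ≫ D.seq.tensMap (𝟙 (D.par.tens a d)) (D.ψ b c e f) =
        D.seq.tensMap (𝟙 _) (D.ψ _ _ _ _) ≫ D.seq.tensMap (D.par.tensMap a' d')
          (D.seq.tensMap (D.par.tensMap b' e') (D.par.tensMap c' f')) := by
      rw [PromonoidalData.tensMap_comp, PromonoidalData.tensMap_comp, D.ψ_natural, Category.id_comp, Category.comp_id]
    have h₄ := D.ψ_natural a' (D.seq.tensMap b' c') d' (D.seq.tensMap e' f')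
    have h₅ : D.par.tensMap (D.seq.tensMap (D.seq.tensMap a' b') c')
        (D.seq.tensMap (D.seq.tensMap d' e') f') ≫ D.par.tensMap (D.seq.α a b c) (D.seq.α d e f) =
        D.par.tensMap (D.seq.α _ _ _) (D.seq.α _ _ _) ≫
          D.par.tensMap (D.seq.tensMap a' (D.seq.tensMap b' c'))
            (D.seq.tensMap d' (D.seq.tensMap e' f')) := by
      rw [PromonoidalData.tensMap_comp, PromonoidalData.tensMap_comp, D.seq.α_natural, D.seq.α_natural]
    refine Eq.trans ?_ (h.trans ?_)
    · refine (sq_assoc h₁ _).trans (congrArg _ ((sq_assoc h₂ _).trans (congrArg _ ?_)))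
      exact D.seq.α_natural _ _ _
    · rw [← h₃, ← reassoc_of% h₄]
      exact sq_assoc h₅.symm _
  ψ_unit_left a b := by
    -- The unit is a fixed presheaf, not a variable, so it is covered by its identity rather than by
    -- representables.
    refine ((Covers.id D.par.unit).conv D.par.tensor
      ((Covers.yoneda a).conv D.seq.tensor (Covers.yoneda b))).hom_ext ?_
    rintro ⟨-, ⟨⟨A, a'⟩, ⟨B, b'⟩⟩⟩
    have h := congrArg (· ≫ D.seq.tensMap a' b') (D.ψ_unit_left A B)
    simp only [Category.assoc] at h
    have h₁ : D.par.tensMap (𝟙 _) (D.seq.tensMap a' b') ≫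
        D.par.tensMap D.ψ₀ (𝟙 (D.seq.tens a b)) =
        D.par.tensMap D.ψ₀ (𝟙 _) ≫ D.par.tensMap (D.seq.tensMap (𝟙 _) (𝟙 _))
          (D.seq.tensMap a' b') := by
      rw [PromonoidalData.tensMap_comp, PromonoidalData.tensMap_comp, PromonoidalData.tensMap_id, Category.id_comp, Category.comp_id,
        Category.id_comp, Category.comp_id]
    refine (sq_assoc h₁ _).trans (Eq.trans ?_ (h.trans (D.par.lam_natural _).symm))
    refine congrArg _ ((sq_assoc (D.ψ_natural _ _ _ _) _).trans (congrArg _ ?_))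
    exact (convMap_comp _ _ _ _ _).trans ((congrArg₂ D.seq.tensMap (D.par.lam_natural _) (D.par.lam_natural _)).trans
        (convMap_comp _ _ _ _ _).symm)
  ψ_unit_right a b := by
    refine (((Covers.yoneda a).conv D.seq.tensor (Covers.yoneda b)).conv D.par.tensor
      (Covers.id D.par.unit)).hom_ext ?_
    rintro ⟨⟨⟨A, a'⟩, ⟨B, b'⟩⟩, -⟩
    have h := congrArg (· ≫ D.seq.tensMap a' b') (D.ψ_unit_right A B)
    simp only [Category.assoc] at h
    have h₁ : D.par.tensMap (D.seq.tensMap a' b') (𝟙 _) ≫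
        D.par.tensMap (𝟙 (D.seq.tens a b)) D.ψ₀ =
        D.par.tensMap (𝟙 _) D.ψ₀ ≫ D.par.tensMap (D.seq.tensMap a' b')
          (D.seq.tensMap (𝟙 _) (𝟙 _)) := by
      rw [PromonoidalData.tensMap_comp, PromonoidalData.tensMap_comp, PromonoidalData.tensMap_id, Category.id_comp, Category.comp_id,
        Category.id_comp, Category.comp_id]
    refine (sq_assoc h₁ _).trans (Eq.trans ?_ (h.trans (D.par.rho_natural _).symm))
    refine congrArg _ ((sq_assoc (D.ψ_natural _ _ _ _) _).trans (congrArg _ ?_))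
    exact (convMap_comp _ _ _ _ _).trans ((congrArg₂ D.seq.tensMap (D.par.rho_natural _) (D.par.rho_natural _)).trans
        (convMap_comp _ _ _ _ _).symm)
  φ_unit_left a b := by
    refine (((Covers.id D.seq.unit).conv D.seq.tensor (Covers.yoneda a)).conv D.par.tensor
      ((Covers.id D.seq.unit).conv D.seq.tensor (Covers.yoneda b))).hom_ext ?_
    rintro ⟨⟨-, ⟨A, a'⟩⟩, ⟨-, ⟨B, b'⟩⟩⟩
    have h := congrArg (· ≫ D.par.tensMap a' b') (D.φ_unit_left A B)
    simp only [Category.assoc] at h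
    have h₁ : D.seq.tensMap (D.par.tensMap (𝟙 _) (𝟙 _)) (D.par.tensMap a' b') ≫
        D.seq.tensMap D.φ₂ (𝟙 (D.par.tens a b)) =
        D.seq.tensMap D.φ₂ (𝟙 _) ≫ D.seq.tensMap (𝟙 _) (D.par.tensMap a' b') := by
      rw [PromonoidalData.tensMap_comp, PromonoidalData.tensMap_comp, PromonoidalData.tensMap_id, Category.id_comp, Category.comp_id,
        Category.id_comp, Category.comp_id]
    refine Eq.trans ?_ (h.trans ?_)
    · refine (sq_assoc (D.ψ_natural _ _ _ _) _).trans (congrArg _ ?_)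
      exact (sq_assoc h₁ _).trans (congrArg _ (D.seq.lam_natural _))
    · rw [convMap_comp, ← D.seq.lam_natural, ← D.seq.lam_natural]
      exact (convMap_comp _ _ _ _ _).symm
  φ_unit_right a b := by
    refine (((Covers.yoneda a).conv D.seq.tensor (Covers.id D.seq.unit)).conv D.par.tensor
      ((Covers.yoneda b).conv D.seq.tensor (Covers.id D.seq.unit))).hom_ext ?_
    rintro ⟨⟨⟨A, a'⟩, -⟩, ⟨⟨B, b'⟩, -⟩⟩
    have h := congrArg (· ≫ D.par.tensMap a' b') (D.φ_unit_right A B)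
    simp only [Category.assoc] at h
    have h₁ : D.seq.tensMap (D.par.tensMap a' b') (D.par.tensMap (𝟙 _) (𝟙 _)) ≫
        D.seq.tensMap (𝟙 (D.par.tens a b)) D.φ₂ =
        D.seq.tensMap (𝟙 _) D.φ₂ ≫ D.seq.tensMap (D.par.tensMap a' b') (𝟙 _) := by
      rw [PromonoidalData.tensMap_comp, PromonoidalData.tensMap_comp, PromonoidalData.tensMap_id, Category.id_comp, Category.comp_id,
        Category.id_comp, Category.comp_id]
    refine Eq.trans ?_ (h.trans ?_)
    · refine (sq_assoc (D.ψ_natural _ _ _ _) _).trans (congrArg _ ?_)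
      exact (sq_assoc h₁ _).trans (congrArg _ (D.seq.rho_natural _))
    · rw [convMap_comp, ← D.seq.rho_natural, ← D.seq.rho_natural]
      exact (convMap_comp _ _ _ _ _).symm
  -- The remaining axioms involve only the two unit presheaves and hold as given.
  φ₂_assoc := D.φ₂_assoc
  φ₂_unit_left := D.φ₂_unit_left
  φ₂_unit_right := D.φ₂_unit_right
  ψ₀_coassoc := D.ψ₀_coassoc
  ψ₀_counit_left := D.ψ₀_counit_left
  ψ₀_counit_right := D.ψ₀_counit_right

end Produoidal

end Produo

/-! ### Nerves, and tensors computed by convolution -/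

namespace Produo

section Nerve

/-- A pointwise bijective morphism of presheaves is an isomorphism. -/
noncomputable def isoOfBijective {C : Type v} [Category.{w} C] {F G : C ⥤ Type u} (f : F ⟶ G)
    (h : ∀ A, Function.Bijective (f.app A)) : F ≅ G :=
  haveI : IsIso f := (NatTrans.isIso_iff_isIso_app f).2 fun A => (isIso_iff_bijective _).2 (h A)
  asIso f

variable {E : Type w} [Category.{u} E] {K : Type u} [SmallCategory K] (J : K ⥤ E)

/-- The nerve `A ↦ E(J A; P)` of an object along a functor. -/
def nerve (P : E) : Kᵒᵖ ⥤ Type u where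
  obj A := J.obj A.unop ⟶ P
  map f := ↾ (fun x => J.map f.unop ≫ x)

/-- Functoriality of the nerve. -/
def nerveMap {P Q : E} (f : P ⟶ Q) : nerve J P ⟶ nerve J Q where
  app A := ↾ (fun x => x ≫ f)
  naturality A A' g := by
    refine ConcreteCategory.hom_ext _ _ fun x => ?_
    exact Category.assoc (J.map g.unop) x f

theorem nerveMap_id (P : E) : nerveMap J (𝟙 P) = 𝟙 (nerve J P) := by
  ext A x
  exact Category.comp_id (X := J.obj A.unop) x

theorem nerveMap_comp {P Q R : E} (f : P ⟶ Q) (g : Q ⟶ R) :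
    nerveMap J (f ≫ g) = nerveMap J f ≫ nerveMap J g := by
  ext A x
  exact (Category.assoc (W := J.obj A.unop) x f g).symm

/-- The nerve of an isomorphism. -/
def nerveIso {P Q : E} (f : P ≅ Q) : nerve J P ≅ nerve J Q where
  hom := nerveMap J f.hom
  inv := nerveMap J f.inv
  hom_inv_id := by rw [← nerveMap_comp, f.hom_inv_id, nerveMap_id]
  inv_hom_id := by rw [← nerveMap_comp, f.inv_hom_id, nerveMap_id]

/-- The comparison `K(•; X) ⟶ E(J •; J X)`. -/
def nerveYoneda (X : K) : yoneda.obj X ⟶ nerve J (J.obj X) where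
  app A := ↾ (fun f => J.map f)
  naturality A A' g := by
    refine ConcreteCategory.hom_ext _ _ fun x => ?_
    exact J.map_comp g.unop x

theorem nerveYoneda_natural {X Y : K} (f : X ⟶ Y) :
    yoneda.map f ≫ nerveYoneda J Y = nerveYoneda J X ≫ nerveMap J (J.map f) := by
  ext A x
  exact J.map_comp x f

/-- Both maps out of the representable send the identity of `X` to the same element, because `J`
preserves identities. -/
theorem yonedaEquiv_symm_nerve {X : K} {G : Kᵒᵖ ⥤ Type u} {P : E} (x : G.obj (op X))
    (g : G ⟶ nerve J P) :
    yonedaEquiv.symm x ≫ g = nerveYoneda J X ≫ nerveMap J (g.app (op X) x) := by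
  apply yonedaEquiv.injective
  rw [yonedaEquiv_comp, Equiv.apply_symm_apply]
  change (g.app (op X) x : J.obj X ⟶ P) = J.map (𝟙 X) ≫ g.app (op X) x
  rw [J.map_id]
  exact (Category.id_comp (Y := P) _).symm

theorem nerveYoneda_bijective (hJ : J.FullyFaithful) (X : K) (A : Kᵒᵖ) :
    Function.Bijective ((nerveYoneda J X).app A) :=
  hJ.map_bijective A.unop X

end Nerve

namespace TensorStr

variable {E : Type w} [Category.{u} E] {K : Type u} [SmallCategory K] (p : TensorStr E)
  (J : K ⥤ E)

/-- The splits `E(J A; J X ⊗ J Y)`. -/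
def split : Profunctor.{u} (K × K) K where
  obj b := nerve J (p.obj (J.obj b.1) (J.obj b.2))
  map f := nerveMap J (p.map (J.map f.1) (J.map f.2))
  map_id b := by
    rw [← nerveMap_id, ← p.map_id, ← J.map_id, ← J.map_id]
    rfl
  map_comp f g := by
    rw [← nerveMap_comp, ← p.map_comp, ← J.map_comp, ← J.map_comp]
    rfl

/-- The comparison from the convolution of nerves to the nerve of the tensor. -/
def kappa (P Q : E) : conv (p.split J) (nerve J P) (nerve J Q) ⟶ nerve J (p.obj P Q) :=
  comp.desc (fun b y => nerveMap J (p.map (P := J.obj b.1) (Q := J.obj b.2) y.1 y.2)) (by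
    intro b b' f y
    exact (nerveMap_comp J _ _).symm.trans (congrArg _ (p.map_comp _ _ _ _).symm))

/-- The comparison from a composite along the left port to the nerve of the tensor. -/
def kappaL (P : E) (Z : K) :
    comp (portL (p.split J) Z) (nerve J P) ⟶ nerve J (p.obj P (J.obj Z)) :=
  comp.desc (fun b y => nerveMap J (p.map (P := J.obj b) y (𝟙 (J.obj Z)))) (by
    intro b b' f y
    refine (nerveMap_comp J _ _).symm.trans (congrArg _ ((p.map_comp _ _ _ _).symm.trans ?_))
    exact congrArg (p.map _) ((Category.comp_id _).trans (J.map_id Z)))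

/-- The comparison from a composite along the right port to the nerve of the tensor. -/
def kappaR (X : K) (Q : E) :
    comp (portR (p.split J) X) (nerve J Q) ⟶ nerve J (p.obj (J.obj X) Q) :=
  comp.desc (fun b y => nerveMap J (p.map (Q := J.obj b) (𝟙 (J.obj X)) y)) (by
    intro b b' f y
    refine (nerveMap_comp J _ _).symm.trans (congrArg _ ((p.map_comp _ _ _ _).symm.trans ?_))
    exact congrArg (p.map · _) ((Category.comp_id _).trans (J.map_id X)))

theorem kappaL_natural {P P' : E} {Z Z' : K} (m : P ⟶ P') (h : Z ⟶ Z') :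
    compMap (portLMap (p.split J) h) (nerveMap J m) ≫ p.kappaL J P' Z' =
      p.kappaL J P Z ≫ nerveMap J (p.map m (J.map h)) := by
  ext A s
  induction s using comp.ind with
  | _ b t y =>
    change J.obj b ⟶ P at y
    change J.obj A.unop ⟶ p.obj (J.obj b) (J.obj Z) at t
    change (t ≫ p.map (J.map (𝟙 b)) (J.map h)) ≫ p.map (y ≫ m) (𝟙 _) =
      (t ≫ p.map y (𝟙 _)) ≫ p.map m (J.map h)
    simp [← p.map_comp]

theorem kappaR_natural {Q Q' : E} {X X' : K} (f : X ⟶ X') (m : Q ⟶ Q') :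
    compMap (portRMap (p.split J) f) (nerveMap J m) ≫ p.kappaR J X' Q' =
      p.kappaR J X Q ≫ nerveMap J (p.map (J.map f) m) := by
  ext A s
  induction s using comp.ind with
  | _ b t y =>
    change J.obj b ⟶ Q at y
    change J.obj A.unop ⟶ p.obj (J.obj X) (J.obj b) at t
    change (t ≫ p.map (J.map f) (J.map (𝟙 b))) ≫ p.map (𝟙 _) (y ≫ m) =
      (t ≫ p.map (𝟙 _) y) ≫ p.map (J.map f) m
    simp [← p.map_comp]

/-- The functor `J` computes the tensor by convolution: elements of `E(J A; P ⊗ Q)` are classes of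
triples `(t, x, y)` with `t : J A ⟶ J X ⊗ J Y`, `x : J X ⟶ P`, `y : J Y ⟶ Q`. -/
def Convolutive : Prop :=
  ∀ (P Q : E) (A : Kᵒᵖ), Function.Bijective ((p.kappa J P Q).app A)

variable {p J}

/-- Full faithfulness makes the nerve of `J Z` representable, so the co-Yoneda lemma contracts one
variable of the double coend computing `P ⊗ J Z` and leaves the single coend along the left port.
The assumed bijectivity of `kappa` then passes to `kappaL`. -/
theorem Convolutive.bijective_kappaL (hp : p.Convolutive J) (hJ : J.FullyFaithful) (P : E) (Z : K)
    (A : Kᵒᵖ) : Function.Bijective ((p.kappaL J P Z).app A) := by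
  -- The co-Yoneda contraction: `y : J b.2 ⟶ J Z` comes from a unique morphism of `K`, which is
  -- absorbed into the split.
  let r : conv (p.split J) (nerve J P) (nerve J (J.obj Z)) ⟶ comp (portL (p.split J) Z) (nerve J P) :=
    comp.desc (fun b y => (p.split J).map (𝟙 b.1 ×ₘ hJ.preimage y.2) ≫
        comp.ι (portL (p.split J) Z) (nerve J P) b.1 y.1) (by
      rintro b b' f ⟨x, y⟩
      change J.obj b'.1 ⟶ P at x
      change J.obj b'.2 ⟶ (J.obj Z) at y
      have h := map_ι_portL (p.split J) (nerve J P) f.1 (𝟙 Z) x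
      have h₁ : f ≫ (𝟙 b'.1 ×ₘ hJ.preimage y) =
          (𝟙 b.1 ×ₘ hJ.preimage (J.map f.2 ≫ y)) ≫ (f.1 ×ₘ 𝟙 Z) := by
        refine Prod.ext ?_ ?_
        · simp
        · exact hJ.map_injective (by simp)
      have h₂ : compMap (portLMap (p.split J) (𝟙 Z)) (𝟙 (nerve J P)) = 𝟙 _ := by
        have h₃ : portLMap (p.split J) (𝟙 Z) = 𝟙 _ := CategoryTheory.Functor.map_id _ _
        rw [h₃]
        exact comp.hom_ext fun _ _ => rfl
      rw [h₂, Category.comp_id] at h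
      rw [← Category.assoc, ← Functor.map_comp, h₁, Functor.map_comp, Category.assoc, h]
      rfl)
  -- The section of `r` that inserts the identity of `J Z`.
  let i : comp (portL (p.split J) Z) (nerve J P) ⟶ conv (p.split J) (nerve J P) (nerve J (J.obj Z)) :=
    plugR (p.split J) (𝟙 _) (𝟙 (J.obj Z) : (nerve J (J.obj Z)).obj (op Z))
  have h₁ : i ≫ r = 𝟙 _ := by
    ext A s
    induction s using comp.ind with
    | _ b t y =>
      change J.obj A.unop ⟶ p.obj (J.obj b) (J.obj Z) at t
      have h : hJ.preimage (𝟙 (J.obj Z)) = 𝟙 Z := hJ.map_injective (by simp)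
      have h' : t ≫ p.map (J.map (𝟙 b)) (J.map (hJ.preimage (𝟙 (J.obj Z)))) = t := by
        simp [h, p.map_id]
      exact congrArg (fun t => comp.mk (portL (p.split J) Z) (nerve J P) b t y) h'
  have h₂ : i ≫ p.kappa J P (J.obj Z) = p.kappaL J P Z := comp.hom_ext fun b y => rfl
  have h₃ : r ≫ p.kappaL J P Z = p.kappa J P (J.obj Z) := by
    ext A s
    induction s using comp.ind with
    | _ b t y =>
      obtain ⟨x, y⟩ := y
      change J.obj A.unop ⟶ p.obj (J.obj b.1) (J.obj b.2) at t
      change J.obj b.1 ⟶ P at x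
      change J.obj b.2 ⟶ (J.obj Z) at y
      change (t ≫ p.map (J.map (𝟙 b.1)) (J.map (hJ.preimage y))) ≫ p.map x (𝟙 _) = t ≫ p.map x y
      simp [← p.map_comp]
  -- Injectivity passes through the split monomorphism `i`, and surjectivity passes through `r`. The
  -- identity `r ≫ i = 𝟙` is not needed.
  refine ⟨fun a b hab => ?_, fun a => ?_⟩
  · have h := (hp P (J.obj Z) A).1 (a₁ := i.app A a) (a₂ := i.app A b)
      ((congrArg (fun k => k.app A a) h₂).trans
        (hab.trans (congrArg (fun k => k.app A b) h₂).symm))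
    exact (congrArg (fun k => k.app A a) h₁).symm.trans
      ((congrArg (r.app A) h).trans (congrArg (fun k => k.app A b) h₁))
  · obtain ⟨x, rfl⟩ := (hp P (J.obj Z) A).2 a
    exact ⟨r.app A x, congrArg (fun k => k.app A x) h₃⟩

theorem Convolutive.bijective_kappaR (hp : p.Convolutive J) (hJ : J.FullyFaithful) (X : K) (Q : E)
    (A : Kᵒᵖ) : Function.Bijective ((p.kappaR J X Q).app A) := by
  let r : conv (p.split J) (nerve J (J.obj X)) (nerve J Q) ⟶ comp (portR (p.split J) X) (nerve J Q) :=
    comp.desc (fun b y => (p.split J).map (hJ.preimage y.1 ×ₘ 𝟙 b.2) ≫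
        comp.ι (portR (p.split J) X) (nerve J Q) b.2 y.2) (by
      rintro b b' f ⟨x, y⟩
      change J.obj b'.1 ⟶ (J.obj X) at x
      change J.obj b'.2 ⟶ Q at y
      have h := map_ι_portR (p.split J) (nerve J Q) (𝟙 X) f.2 y
      have h₁ : f ≫ (hJ.preimage x ×ₘ 𝟙 b'.2) =
          (hJ.preimage (J.map f.1 ≫ x) ×ₘ 𝟙 b.2) ≫ (𝟙 X ×ₘ f.2) := by
        refine Prod.ext ?_ ?_
        · exact hJ.map_injective (by simp)
        · simp
      have h₂ : compMap (portRMap (p.split J) (𝟙 X)) (𝟙 (nerve J Q)) = 𝟙 _ := by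
        have h₃ : portRMap (p.split J) (𝟙 X) = 𝟙 _ := CategoryTheory.Functor.map_id _ _
        rw [h₃]
        exact comp.hom_ext fun _ _ => rfl
      rw [h₂, Category.comp_id] at h
      rw [← Category.assoc, ← Functor.map_comp, h₁, Functor.map_comp, Category.assoc, h]
      rfl)
  let i : comp (portR (p.split J) X) (nerve J Q) ⟶ conv (p.split J) (nerve J (J.obj X)) (nerve J Q) :=
    plugL (p.split J) (𝟙 (J.obj X) : (nerve J (J.obj X)).obj (op X)) (𝟙 _)
  have h₁ : i ≫ r = 𝟙 _ := by
    ext A s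
    induction s using comp.ind with
    | _ b t y =>
      change J.obj A.unop ⟶ p.obj (J.obj X) (J.obj b) at t
      have h : hJ.preimage (𝟙 (J.obj X)) = 𝟙 X := hJ.map_injective (by simp)
      have h' : t ≫ p.map (J.map (hJ.preimage (𝟙 (J.obj X)))) (J.map (𝟙 b)) = t := by
        simp [h, p.map_id]
      exact congrArg (fun t => comp.mk (portR (p.split J) X) (nerve J Q) b t y) h'
  have h₂ : i ≫ p.kappa J (J.obj X) Q = p.kappaR J X Q := comp.hom_ext fun b y => rfl
  have h₃ : r ≫ p.kappaR J X Q = p.kappa J (J.obj X) Q := by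
    ext A s
    induction s using comp.ind with
    | _ b t y =>
      obtain ⟨x, y⟩ := y
      change J.obj A.unop ⟶ p.obj (J.obj b.1) (J.obj b.2) at t
      change J.obj b.1 ⟶ (J.obj X) at x
      change J.obj b.2 ⟶ Q at y
      change (t ≫ p.map (J.map (hJ.preimage x)) (J.map (𝟙 b.2))) ≫ p.map (𝟙 _) y = t ≫ p.map x y
      simp [← p.map_comp]
  refine ⟨fun a b hab => ?_, fun a => ?_⟩
  · have h := (hp (J.obj X) Q A).1 (a₁ := i.app A a) (a₂ := i.app A b)
      ((congrArg (fun k => k.app A a) h₂).trans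
        (hab.trans (congrArg (fun k => k.app A b) h₂).symm))
    exact (congrArg (fun k => k.app A a) h₁).symm.trans
      ((congrArg (r.app A) h).trans (congrArg (fun k => k.app A b) h₁))
  · obtain ⟨x, rfl⟩ := (hp (J.obj X) Q A).2 a
    exact ⟨r.app A x, congrArg (fun k => k.app A x) h₃⟩

end TensorStr

end Produo

/-! ### Restriction of a monoidal structure along a fully faithful functor -/

namespace Produo

theorem nerveMap_sq {E : Type w} [Category.{u} E] {K : Type u} [SmallCategory K] (J : K ⥤ E)
    {P Q Q' R : E} {f : P ⟶ Q} {g : Q ⟶ R} {f' : P ⟶ Q'} {g' : Q' ⟶ R} (h : f ≫ g = f' ≫ g') :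
    nerveMap J f ≫ nerveMap J g = nerveMap J f' ≫ nerveMap J g' := by
  rw [← nerveMap_comp, h, nerveMap_comp]

/-- The restricted associator and unitors all have the shape comparison, nerve of a structural
isomorphism, inverse comparison. Their naturality is assembled here from that of the three pieces.
-/
theorem conj_natural {C : Type w} [Category.{v} C] {X₁ X₂ A₁ A₂ B₁ B₂ Y₁ Y₂ : C} {a₁ : X₁ ≅ A₁}
    {a₂ : X₂ ≅ A₂} {n₁ : A₁ ≅ B₁} {n₂ : A₂ ≅ B₂} {c₁ : Y₁ ≅ B₁} {c₂ : Y₂ ≅ B₂} {f : X₁ ⟶ X₂}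
    {g : Y₁ ⟶ Y₂} {f' : A₁ ⟶ A₂} {g' : B₁ ⟶ B₂} (hf : f ≫ a₂.hom = a₁.hom ≫ f')
    (hn : f' ≫ n₂.hom = n₁.hom ≫ g') (hg : g ≫ c₂.hom = c₁.hom ≫ g') :
    f ≫ (a₂ ≪≫ n₂ ≪≫ c₂.symm).hom = (a₁ ≪≫ n₁ ≪≫ c₁.symm).hom ≫ g := by
  rw [← cancel_mono c₂.hom]
  simp [hg, reassoc_of% hf, hn]

theorem conj_hom_comp {C : Type w} [Category.{v} C] {X A B Y Z : C} (a : X ≅ A)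
    (n : A ≅ B) (c : Y ≅ B) (k : B ⟶ Z) :
    (a ≪≫ n ≪≫ c.symm).hom ≫ c.hom ≫ k = a.hom ≫ n.hom ≫ k := by
  simp

namespace TensorStr

variable {E : Type w} [Category.{u} E] {K : Type u} [SmallCategory K] {p : TensorStr E}
  {J : K ⥤ E}

section

variable (hp : p.Convolutive J) (hJ : J.FullyFaithful)

/-- The comparison along the left port, as an isomorphism. -/
noncomputable def isoL (P : E) (Z : K) :
    comp (portL (p.split J) Z) (nerve J P) ≅ nerve J (p.obj P (J.obj Z)) :=
  isoOfBijective _ (hp.bijective_kappaL hJ P Z)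

/-- The comparison along the right port, as an isomorphism. -/
noncomputable def isoR (X : K) (Q : E) :
    comp (portR (p.split J) X) (nerve J Q) ≅ nerve J (p.obj (J.obj X) Q) :=
  isoOfBijective _ (hp.bijective_kappaR hJ X Q)

/-- Representable presheaves are nerves. -/
noncomputable def isoYoneda (X : K) : yoneda.obj X ≅ nerve J (J.obj X) :=
  isoOfBijective _ (nerveYoneda_bijective J hJ X)

/-- A monoidal structure restricts along a fully faithful functor computing tensors by
convolution. -/
noncomputable def promonoidalData : PromonoidalData K where
  tensor := p.split J
  unit := nerve J p.unit
  assoc X Y Z := isoL hp hJ (p.obj (J.obj X) (J.obj Y)) Z ≪≫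
    nerveIso J (p.assoc (J.obj X) (J.obj Y) (J.obj Z)) ≪≫
      (isoR hp hJ X (p.obj (J.obj Y) (J.obj Z))).symm
  assoc_naturality {X X' Y Y' Z Z'} f g h := by
    have h₃ := nerveMap_sq J (p.assoc_nat (J.map f) (J.map g) (J.map h))
    exact conj_natural (p.kappaL_natural J (p.map (J.map f) (J.map g)) h) h₃
      (p.kappaR_natural J f (p.map (J.map g) (J.map h)))
  leftUnitor X := isoL hp hJ p.unit X ≪≫ nerveIso J (p.lam (J.obj X)) ≪≫ (isoYoneda hJ X).symm
  leftUnitor_naturality {X X'} f := by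
    have h₁ := p.kappaL_natural J (𝟙 p.unit) f
    have h₃ := nerveMap_sq J (p.lam_nat (J.map f))
    rw [nerveMap_id] at h₁
    exact conj_natural h₁ h₃ (nerveYoneda_natural J f)
  rightUnitor X := isoR hp hJ X p.unit ≪≫ nerveIso J (p.rho (J.obj X)) ≪≫ (isoYoneda hJ X).symm
  rightUnitor_naturality {X X'} f := by
    have h₁ := p.kappaR_natural J f (𝟙 p.unit)
    have h₃ := nerveMap_sq J (p.rho_nat (J.map f))
    rw [nerveMap_id] at h₁
    exact conj_natural h₁ h₃ (nerveYoneda_natural J f)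

end

variable (p) in
/-- The morphism `G ⊗ H ⟶ E(J •; P ⊗ Q)` induced by `G ⟶ E(J •; P)` and `H ⟶ E(J •; Q)`. -/
def rep {G H : Kᵒᵖ ⥤ Type u} {P Q : E} (g : G ⟶ nerve J P) (h : H ⟶ nerve J Q) :
    conv (p.split J) G H ⟶ nerve J (p.obj P Q) :=
  convMap (p.split J) g h ≫ p.kappa J P Q

/-- Convolutivity inverts `kappa`, and `convMap` preserves isomorphisms. By iteration the comparison
for any nested expression in representables and units is invertible. -/
theorem isIso_rep (hp : p.Convolutive J) {G H : Kᵒᵖ ⥤ Type u} {P Q : E} {g : G ⟶ nerve J P}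
    {h : H ⟶ nerve J Q} (hg : IsIso g) (hh : IsIso h) : IsIso (p.rep g h) := by
  have h₁ : IsIso (p.kappa J P Q) :=
    (NatTrans.isIso_iff_isIso_app _).2 fun A => (isIso_iff_bijective _).2 (hp P Q A)
  have h₂ : IsIso (convMap (p.split J) g h) := ⟨convMap (p.split J) (inv g) (inv h), by
    rw [convMap_comp, IsIso.hom_inv_id, IsIso.hom_inv_id, convMap_id], by
    rw [convMap_comp, IsIso.inv_hom_id, IsIso.inv_hom_id, convMap_id]⟩
  exact IsIso.comp_isIso

theorem convMap_rep {G G' H H' : Kᵒᵖ ⥤ Type u} {P P' Q Q' : E} {g : G ⟶ nerve J P}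
    {g' : G' ⟶ nerve J P'} {h : H ⟶ nerve J Q} {h' : H' ⟶ nerve J Q'} {a : G ⟶ G'} {b : H ⟶ H'}
    {x : P ⟶ P'} {y : Q ⟶ Q'} (ha : a ≫ g' = g ≫ nerveMap J x) (hb : b ≫ h' = h ≫ nerveMap J y) :
    convMap (p.split J) a b ≫ p.rep g' h' = p.rep g h ≫ nerveMap J (p.map x y) := by
  have h₁ : convMap (p.split J) (nerveMap J x) (nerveMap J y) ≫ p.kappa J P' Q' =
      p.kappa J P Q ≫ nerveMap J (p.map x y) := by
    ext A s
    induction s using comp.ind with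
    | _ b t z =>
      obtain ⟨z, z'⟩ := z
      change J.obj A.unop ⟶ p.obj (J.obj b.1) (J.obj b.2) at t
      change J.obj b.1 ⟶ P at z
      change J.obj b.2 ⟶ Q at z'
      change t ≫ p.map (z ≫ x) (z' ≫ y) = (t ≫ p.map z z') ≫ p.map x y
      rw [p.map_comp, Category.assoc]
  rw [rep, rep, ← Category.assoc, convMap_comp, ha, hb, ← convMap_comp, Category.assoc, h₁,
    Category.assoc]

section

variable (hp : p.Convolutive J) (hJ : J.FullyFaithful)

theorem plugR_rep {X Y Z : K} {G₁ G₂ G₃ : Kᵒᵖ ⥤ Type u} {P Q R : E} (g₁ : G₁ ⟶ nerve J P)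
    (g₂ : G₂ ⟶ nerve J Q) (g₃ : G₃ ⟶ nerve J R) (x : G₁.obj (op X)) (y : G₂.obj (op Y))
    (z : G₃.obj (op Z)) :
    plugR (p.split J) (plug (p.split J) x y) z ≫ p.rep (p.rep g₁ g₂) g₃ =
      p.kappaL J (p.obj (J.obj X) (J.obj Y)) Z ≫
        nerveMap J (p.map (p.map (g₁.app _ x) (g₂.app _ y)) (g₃.app _ z)) := by
  ext A s
  induction s using comp.ind with
  | _ b t s =>
    change J.obj A.unop ⟶ p.obj (J.obj b) (J.obj Z) at t
    change J.obj b ⟶ p.obj (J.obj X) (J.obj Y) at s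
    have h (x : J.obj X ⟶ P) (y : J.obj Y ⟶ Q) (z : J.obj Z ⟶ R) :
        t ≫ p.map (s ≫ p.map x y) z = (t ≫ p.map s (𝟙 _)) ≫ p.map (p.map x y) z := by
      simp [← p.map_comp]
    exact h _ _ _

theorem plugL_rep {X Y Z : K} {G₁ G₂ G₃ : Kᵒᵖ ⥤ Type u} {P Q R : E} (g₁ : G₁ ⟶ nerve J P)
    (g₂ : G₂ ⟶ nerve J Q) (g₃ : G₃ ⟶ nerve J R) (x : G₁.obj (op X)) (y : G₂.obj (op Y))
    (z : G₃.obj (op Z)) :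
    plugL (p.split J) x (plug (p.split J) y z) ≫ p.rep g₁ (p.rep g₂ g₃) =
      p.kappaR J X (p.obj (J.obj Y) (J.obj Z)) ≫
        nerveMap J (p.map (g₁.app _ x) (p.map (g₂.app _ y) (g₃.app _ z))) := by
  ext A s
  induction s using comp.ind with
  | _ b t s =>
    change J.obj A.unop ⟶ p.obj (J.obj X) (J.obj b) at t
    change J.obj b ⟶ p.obj (J.obj Y) (J.obj Z) at s
    have h (x : J.obj X ⟶ P) (y : J.obj Y ⟶ Q) (z : J.obj Z ⟶ R) :
        t ≫ p.map x (s ≫ p.map y z) = (t ≫ p.map (𝟙 _) s) ≫ p.map x (p.map y z) := by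
      simp [← p.map_comp]
    exact h _ _ _

/-- On plugged elements the restricted associator is by construction a conjugate of `p.assoc` at `J
X`, `J Y`, `J Z`. Naturality of `p.assoc` along the three morphisms of `E` named by the plugged
elements extends this to `P`, `Q`, `R`. -/
theorem α_rep {G₁ G₂ G₃ : Kᵒᵖ ⥤ Type u} {P Q R : E} (g₁ : G₁ ⟶ nerve J P)
    (g₂ : G₂ ⟶ nerve J Q) (g₃ : G₃ ⟶ nerve J R) :
    (promonoidalData hp hJ).α G₁ G₂ G₃ ≫ p.rep g₁ (p.rep g₂ g₃) =
      p.rep (p.rep g₁ g₂) g₃ ≫ nerveMap J (p.assoc P Q R).hom := by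
  refine PromonoidalData.conv_conv_hom_ext fun X Y Z x y z => ?_
  have h₁ := (promonoidalData hp hJ).plugR_α x y z
  have h₂ := plugL_rep (p := p) g₁ g₂ g₃ x y z
  have h₃ := plugR_rep (p := p) g₁ g₂ g₃ x y z
  have h₄ := nerveMap_sq J (p.assoc_nat (P := J.obj X) (Q := J.obj Y) (R := J.obj Z)
    (g₁.app _ x) (g₂.app _ y) (g₃.app _ z))
  refine (sq_assoc h₁ _).trans (Eq.trans (congrArg _ h₂) ?_)
  refine Eq.trans ?_ (sq_assoc h₃ _).symm
  refine Eq.trans ?_ (congrArg _ h₄.symm)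
  exact conj_hom_comp _ _ _ _

theorem lam_rep {G : Kᵒᵖ ⥤ Type u} {P : E} (g : G ⟶ nerve J P) :
    (promonoidalData hp hJ).lam G ≫ g =
      p.rep (𝟙 (nerve J p.unit)) g ≫ nerveMap J (p.lam P).hom := by
  refine PromonoidalData.conv_unit_hom_ext _ fun X x => ?_
  have h₁ := (promonoidalData hp hJ).plugR_lam x
  have h₂ : plugR (p.split J) (𝟙 _) x ≫ p.rep (𝟙 (nerve J p.unit)) g =
      p.kappaL J p.unit X ≫ nerveMap J (p.map (P' := p.unit) (𝟙 p.unit) (g.app (op X) x)) := by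
    ext A s
    induction s using comp.ind with
    | _ b t s =>
      change J.obj A.unop ⟶ p.obj (J.obj b) (J.obj X) at t
      change J.obj b ⟶ p.unit at s
      have h (x : J.obj X ⟶ P) :
          t ≫ p.map s x = (t ≫ p.map s (𝟙 _)) ≫ p.map (𝟙 p.unit) x := by
        simp [← p.map_comp]
      exact h _
  have h₃ := nerveMap_sq J (p.lam_nat (P := J.obj X) (g.app _ x))
  refine (sq_assoc h₁ _).trans (Eq.trans ?_ ((sq_assoc h₂ _).trans (congrArg _ h₃)).symm)
  rw [yonedaEquiv_symm_nerve]
  exact conj_hom_comp _ _ _ _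

theorem rho_rep {G : Kᵒᵖ ⥤ Type u} {P : E} (g : G ⟶ nerve J P) :
    (promonoidalData hp hJ).rho G ≫ g =
      p.rep g (𝟙 (nerve J p.unit)) ≫ nerveMap J (p.rho P).hom := by
  refine PromonoidalData.conv_unit_hom_ext' _ fun X x => ?_
  have h₁ := (promonoidalData hp hJ).plugL_rho x
  have h₂ : plugL (p.split J) x (𝟙 _) ≫ p.rep g (𝟙 (nerve J p.unit)) =
      p.kappaR J X p.unit ≫ nerveMap J (p.map (Q' := p.unit) (g.app (op X) x) (𝟙 p.unit)) := by
    ext A s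
    induction s using comp.ind with
    | _ b t s =>
      change J.obj A.unop ⟶ p.obj (J.obj X) (J.obj b) at t
      change J.obj b ⟶ p.unit at s
      have h (x : J.obj X ⟶ P) :
          t ≫ p.map x s = (t ≫ p.map (𝟙 _) s) ≫ p.map x (𝟙 p.unit) := by
        simp [← p.map_comp]
      exact h _
  have h₃ := nerveMap_sq J (p.rho_nat (P := J.obj X) (g.app _ x))
  refine (sq_assoc h₁ _).trans (Eq.trans ?_ ((sq_assoc h₂ _).trans (congrArg _ h₃)).symm)
  rw [yonedaEquiv_symm_nerve]
  exact conj_hom_comp _ _ _ _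

end

end TensorStr

end Produo

/-! ### Transfer of coherence axioms, and restriction of a duoidal structure -/

namespace Produo

section Represents

variable {E : Type w} [Category.{u} E] {K : Type u} [SmallCategory K] {J : K ⥤ E}

/-- A morphism of presheaves is carried to the nerve of `x` by the given comparisons. -/
def Represents {G G' : Kᵒᵖ ⥤ Type u} {P P' : E} (g : G ⟶ nerve J P) (g' : G' ⟶ nerve J P')
    (f : G ⟶ G') (x : P ⟶ P') : Prop :=
  f ≫ g' = g ≫ nerveMap J x

variable {G G' G'' H H' : Kᵒᵖ ⥤ Type u} {P P' P'' Q Q' : E} {g : G ⟶ nerve J P}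
  {g' : G' ⟶ nerve J P'} {g'' : G'' ⟶ nerve J P''} {h : H ⟶ nerve J Q} {h' : H' ⟶ nerve J Q'}

theorem Represents.id (g : G ⟶ nerve J P) : Represents g g (𝟙 G) (𝟙 P) := by
  rw [Represents, nerveMap_id, Category.id_comp, Category.comp_id]

theorem Represents.comp {f : G ⟶ G'} {f' : G' ⟶ G''} {x : P ⟶ P'} {x' : P' ⟶ P''}
    (hf : Represents g g' f x) (hf' : Represents g' g'' f' x') :
    Represents g g'' (f ≫ f') (x ≫ x') := by
  rw [Represents] at *
  rw [Category.assoc, hf', nerveMap_comp, ← Category.assoc, hf, Category.assoc]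

/-- The comparison at the target is monic, so a presheaf map is determined by the morphism of `E`
that it represents. Each coherence axiom of the restricted structure is obtained in this way from
the same axiom in `E`. -/
theorem Represents.eq {f f' : G ⟶ G'} {x x' : P ⟶ P'} (hg : IsIso g')
    (hf : Represents g g' f x) (hf' : Represents g g' f' x') (hx : x = x') : f = f' := by
  subst hx
  exact (cancel_mono g').1 (hf.trans hf'.symm)

theorem Represents.nerveMap (x : P ⟶ P') :
    Represents (𝟙 (nerve J P)) (𝟙 (nerve J P')) (Produo.nerveMap J x) x := by
  rw [Represents, Category.id_comp, Category.comp_id]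

theorem Represents.conv {p : TensorStr E} {a : G ⟶ G'} {b : H ⟶ H'} {x : P ⟶ P'} {y : Q ⟶ Q'}
    (ha : Represents g g' a x) (hb : Represents h h' b y) :
    Represents (p.rep g h) (p.rep g' h') (convMap (p.split J) a b) (p.map x y) :=
  TensorStr.convMap_rep ha hb

theorem Represents.plug {p : TensorStr E} (g : G ⟶ nerve J P) (h : H ⟶ nerve J Q) {X Y : K}
    (x : G.obj (op X)) (y : H.obj (op Y)) :
    Represents (𝟙 (nerve J (p.obj (J.obj X) (J.obj Y)))) (p.rep g h) (plug (p.split J) x y)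
      (p.map (P := J.obj X) (Q := J.obj Y) (g.app _ x) (h.app _ y)) := by
  have hxy : Produo.plug (p.split J) x y ≫ p.rep g h = Produo.nerveMap J
      (p.map (P := J.obj X) (Q := J.obj Y) (g.app _ x) (h.app _ y)) := by
    ext A t
    rfl
  exact hxy.trans (Category.id_comp _).symm

theorem isIso_id_nerve (P : E) : IsIso (𝟙 (nerve J P)) := inferInstance

theorem isIso_nerveYoneda (hJ : J.FullyFaithful) (X : K) : IsIso (nerveYoneda J X) :=
  (NatTrans.isIso_iff_isIso_app _).2 fun A =>
    (isIso_iff_bijective _).2 (nerveYoneda_bijective J hJ X A)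

end Represents

namespace TensorStr

variable {E : Type w} [Category.{u} E] {K : Type u} [SmallCategory K] {p s : TensorStr E}
  {J : K ⥤ E} (hp : p.Convolutive J) (hs : s.Convolutive J) (hJ : J.FullyFaithful)

theorem represents_α {G₁ G₂ G₃ : Kᵒᵖ ⥤ Type u} {P Q R : E} (g₁ : G₁ ⟶ nerve J P)
    (g₂ : G₂ ⟶ nerve J Q) (g₃ : G₃ ⟶ nerve J R) :
    Represents (p.rep (p.rep g₁ g₂) g₃) (p.rep g₁ (p.rep g₂ g₃))
      ((promonoidalData hp hJ).α G₁ G₂ G₃) (p.assoc P Q R).hom :=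
  α_rep hp hJ g₁ g₂ g₃

theorem represents_lam {G : Kᵒᵖ ⥤ Type u} {P : E} (g : G ⟶ nerve J P) :
    Represents (p.rep (𝟙 (nerve J p.unit)) g) g ((promonoidalData hp hJ).lam G) (p.lam P).hom :=
  lam_rep hp hJ g

theorem represents_rho {G : Kᵒᵖ ⥤ Type u} {P : E} (g : G ⟶ nerve J P) :
    Represents (p.rep g (𝟙 (nerve J p.unit))) g ((promonoidalData hp hJ).rho G) (p.rho P).hom :=
  rho_rep hp hJ g

/-- The promonoidal category obtained by restricting a monoidal structure. -/
noncomputable def promonoidal : Promonoidal K where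
  toPromonoidalData := promonoidalData hp hJ
  pentagon A B C D := by
    have i := isIso_nerveYoneda hJ
    exact Represents.eq (isIso_rep hp (i A) (isIso_rep hp (i B) (isIso_rep hp (i C) (i D))))
      ((Represents.conv (represents_α hp hJ _ _ _) (Represents.id _)).comp
        ((represents_α hp hJ _ _ _).comp
          (Represents.conv (Represents.id _) (represents_α hp hJ _ _ _))))
      ((represents_α hp hJ _ _ _).comp (represents_α hp hJ _ _ _)) (p.pentagon _ _ _ _)
  triangle A B := by
    have i := isIso_nerveYoneda hJ
    exact Represents.eq (isIso_rep hp (i A) (i B))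
      ((represents_α hp hJ _ _ _).comp
        (Represents.conv (Represents.id _) (represents_lam hp hJ _)))
      (Represents.conv (represents_rho hp hJ _) (Represents.id _)) (p.triangle _ _)

end TensorStr

namespace Laxator

open TensorStr

variable {E : Type w} [Category.{u} E] {K : Type u} [SmallCategory K] {p s : TensorStr E}
  (L : Laxator p s) {J : K ⥤ E} (hp : p.Convolutive J) (hs : s.Convolutive J)
  (hJ : J.FullyFaithful)

/-- The restricted laxator. -/
noncomputable def restrict {G G' : Kᵒᵖ ⥤ Type u} {P P' : E} (g : G ⟶ nerve J P)
    (g' : G' ⟶ nerve J P') (hg : IsIso g') (x : P ⟶ P') : G ⟶ G' :=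
  g ≫ nerveMap J x ≫ inv g'

theorem represents_restrict {G G' : Kᵒᵖ ⥤ Type u} {P P' : E} (g : G ⟶ nerve J P)
    (g' : G' ⟶ nerve J P') (hg : IsIso g') (x : P ⟶ P') :
    Represents g g' (restrict g g' hg x) x := by
  simp [Represents, restrict]

/-- The data of a produoidal category obtained by restricting a duoidal structure. -/
noncomputable def produoidalData : ProduoidalData K where
  par := promonoidal hp hJ
  seq := promonoidal hs hJ
  ψ₂ X Y Z W := restrict (p.rep (𝟙 (nerve J (s.obj (J.obj X) (J.obj Y))))
      (𝟙 (nerve J (s.obj (J.obj Z) (J.obj W))))) (s.rep (𝟙 (nerve J (p.obj (J.obj X) (J.obj Z))))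
      (𝟙 (nerve J (p.obj (J.obj Y) (J.obj W))))) (isIso_rep hs (isIso_id_nerve _) (isIso_id_nerve _))
      (L.ψ (J.obj X) (J.obj Y) (J.obj Z) (J.obj W))
  ψ₂_naturality f g h k :=
    Represents.eq (isIso_rep hs (isIso_id_nerve (p.obj _ _)) (isIso_id_nerve (p.obj _ _)))
      ((Represents.conv (.nerveMap (s.map (J.map f) (J.map g)))
        (.nerveMap (s.map (J.map h) (J.map k)))).comp (represents_restrict _ _ _ _))
      ((represents_restrict _ _ _ _).comp (Represents.conv (.nerveMap (p.map (J.map f) (J.map h)))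
        (.nerveMap (p.map (J.map g) (J.map k)))))
      (L.ψ_nat _ _ _ _)
  ψ₀ := restrict (𝟙 (nerve J p.unit)) (s.rep (𝟙 (nerve J p.unit)) (𝟙 (nerve J p.unit)))
    (isIso_rep hs (isIso_id_nerve _) (isIso_id_nerve _)) L.ψ₀
  φ₂ := restrict (p.rep (𝟙 (nerve J s.unit)) (𝟙 (nerve J s.unit))) (𝟙 (nerve J s.unit))
    (isIso_id_nerve _) L.φ₂
  φ₀ := nerveMap J L.φ₀

/-- On representatives `ψ` is a plug, then the restricted `ψ₂`, then a tensor of two plugs. Each of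
these represents an evident morphism of `E`, and naturality of `L.ψ` moves the morphisms in the
ports from behind it to the front. -/
theorem represents_ψ {G₁ G₂ G₃ G₄ : Kᵒᵖ ⥤ Type u} {P Q R S : E} (g₁ : G₁ ⟶ nerve J P)
    (g₂ : G₂ ⟶ nerve J Q) (g₃ : G₃ ⟶ nerve J R) (g₄ : G₄ ⟶ nerve J S) :
    Represents (p.rep (s.rep g₁ g₂) (s.rep g₃ g₄)) (s.rep (p.rep g₁ g₃) (p.rep g₂ g₄))
      ((L.produoidalData hp hs hJ).ψ G₁ G₂ G₃ G₄) (L.ψ P Q R S) := by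
  ext A t
  induction t using comp.ind with
  | _ b t y =>
    obtain ⟨y, z⟩ := y
    induction y using comp.ind with
    | _ c q y =>
      induction z using comp.ind with
      | _ d r z =>
        change J.obj A.unop ⟶ p.obj (J.obj b.1) (J.obj b.2) at t
        change J.obj b.1 ⟶ s.obj (J.obj c.1) (J.obj c.2) at q
        change J.obj b.2 ⟶ s.obj (J.obj d.1) (J.obj d.2) at r
        obtain ⟨y₁, y₂⟩ := y
        obtain ⟨z₁, z₂⟩ := z
        have h₁ := Represents.plug (p := p) g₁ g₃ y₁ z₁
        have h₂ := Represents.plug (p := p) g₂ g₄ y₂ z₂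
        have h₃ := represents_restrict (p.rep (𝟙 (nerve J (s.obj (J.obj c.1) (J.obj c.2))))
          (𝟙 (nerve J (s.obj (J.obj d.1) (J.obj d.2)))))
          (s.rep (𝟙 (nerve J (p.obj (J.obj c.1) (J.obj d.1))))
          (𝟙 (nerve J (p.obj (J.obj c.2) (J.obj d.2))))) (isIso_rep hs (isIso_id_nerve _) (isIso_id_nerve _))
          (L.ψ (J.obj c.1) (J.obj c.2) (J.obj d.1) (J.obj d.2))
        have h₄ := Represents.plug (p := p) (𝟙 (nerve J (s.obj (J.obj c.1) (J.obj c.2))))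
          (𝟙 (nerve J (s.obj (J.obj d.1) (J.obj d.2)))) q r
        have h₅ := congrArg (fun k => k.app A t)
          ((h₄.comp (h₃.comp (Represents.conv (p := s) h₁ h₂))).trans (Category.id_comp _))
        refine Eq.trans h₅ ?_
        have key (y₁ : J.obj c.1 ⟶ P) (y₂ : J.obj c.2 ⟶ Q) (z₁ : J.obj d.1 ⟶ R)
            (z₂ : J.obj d.2 ⟶ S) :
            t ≫ p.map q r ≫ L.ψ _ _ _ _ ≫ s.map (p.map y₁ z₁) (p.map y₂ z₂) =
              (t ≫ p.map (q ≫ s.map y₁ y₂) (r ≫ s.map z₁ z₂)) ≫ L.ψ _ _ _ _ := by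
          rw [p.map_comp, ← L.ψ_nat, Category.assoc, Category.assoc]
        exact key _ _ _ _

/-- The produoidal category obtained by restricting a duoidal structure. -/
noncomputable def produoidal : Produoidal K where
  toProduoidalData := L.produoidalData hp hs hJ
  ψ_assoc_par A B C D E F := by
    have i := isIso_nerveYoneda hJ
    exact Represents.eq (isIso_rep hs (isIso_rep hp (i A) (isIso_rep hp (i C) (i E)))
        (isIso_rep hp (i B) (isIso_rep hp (i D) (i F))))
      ((Represents.conv (L.represents_ψ hp hs hJ _ _ _ _) (.id _)).comp
        ((L.represents_ψ hp hs hJ _ _ _ _).comp (Represents.conv (represents_α hp hJ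
          (nerveYoneda J A) (nerveYoneda J C) (nerveYoneda J E)) (represents_α hp hJ
            (nerveYoneda J B) (nerveYoneda J D) (nerveYoneda J F)))))
      ((represents_α hp hJ _ _ _).comp ((Represents.conv (.id _)
        (L.represents_ψ hp hs hJ _ _ _ _)).comp (L.represents_ψ hp hs hJ _ _ _ _)))
      (L.ψ_assoc_par _ _ _ _ _ _)
  ψ_assoc_seq A B C D E F := by
    have i := isIso_nerveYoneda hJ
    exact Represents.eq (isIso_rep hs (isIso_rep hp (i A) (i D))
        (isIso_rep hs (isIso_rep hp (i B) (i E)) (isIso_rep hp (i C) (i F))))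
      ((L.represents_ψ hp hs hJ _ _ _ _).comp ((Represents.conv
        (L.represents_ψ hp hs hJ _ _ _ _) (.id _)).comp (represents_α hs hJ _ _ _)))
      ((Represents.conv (represents_α hs hJ _ _ _) (represents_α hs hJ _ _ _)).comp
        ((L.represents_ψ hp hs hJ _ _ _ _).comp (Represents.conv (.id _)
        (L.represents_ψ hp hs hJ _ _ _ _))))
      (L.ψ_assoc_seq _ _ _ _ _ _)
  ψ_unit_left A B := by
    have i := isIso_nerveYoneda hJ
    exact Represents.eq (isIso_rep hs (i A) (i B))
      ((Represents.conv (represents_restrict _ _ _ _) (.id _)).comp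
        ((L.represents_ψ hp hs hJ _ _ _ _).comp
          (Represents.conv (represents_lam hp hJ _) (represents_lam hp hJ _))))
      (represents_lam hp hJ _) (L.ψ_unit_left _ _)
  ψ_unit_right A B := by
    have i := isIso_nerveYoneda hJ
    exact Represents.eq (isIso_rep hs (i A) (i B))
      ((Represents.conv (.id _) (represents_restrict _ _ _ _)).comp
        ((L.represents_ψ hp hs hJ _ _ _ _).comp
          (Represents.conv (represents_rho hp hJ _) (represents_rho hp hJ _))))
      (represents_rho hp hJ _) (L.ψ_unit_right _ _)
  φ_unit_left A B := by
    have i := isIso_nerveYoneda hJ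
    exact Represents.eq (isIso_rep hp (i A) (i B))
      ((L.represents_ψ hp hs hJ _ _ _ _).comp ((Represents.conv (represents_restrict _ _ _ _)
        (.id _)).comp (represents_lam hs hJ _)))
      (Represents.conv (represents_lam hs hJ _) (represents_lam hs hJ _)) (L.φ_unit_left _ _)
  φ_unit_right A B := by
    have i := isIso_nerveYoneda hJ
    exact Represents.eq (isIso_rep hp (i A) (i B))
      ((L.represents_ψ hp hs hJ _ _ _ _).comp ((Represents.conv (.id _)
        (represents_restrict _ _ _ _)).comp (represents_rho hs hJ _)))
      (Represents.conv (represents_rho hs hJ _) (represents_rho hs hJ _)) (L.φ_unit_right _ _)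
  φ₂_assoc :=
    Represents.eq (isIso_id_nerve s.unit)
      ((Represents.conv (represents_restrict _ _ _ _) (.id _)).comp (represents_restrict _ _ _ _))
      ((represents_α hp hJ _ _ _).comp ((Represents.conv (.id _)
        (represents_restrict _ _ _ _)).comp (represents_restrict _ _ _ _))) L.φ₂_assoc
  φ₂_unit_left :=
    Represents.eq (isIso_id_nerve s.unit)
      ((Represents.conv (.nerveMap _) (.id _)).comp (represents_restrict _ _ _ _))
      (represents_lam hp hJ _) L.φ₂_unit_left
  φ₂_unit_right :=
    Represents.eq (isIso_id_nerve s.unit)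
      ((Represents.conv (.id _) (.nerveMap _)).comp (represents_restrict _ _ _ _))
      (represents_rho hp hJ _) L.φ₂_unit_right
  ψ₀_coassoc := by
    have i := isIso_id_nerve (J := J) p.unit
    exact Represents.eq (isIso_rep hs i (isIso_rep hs i i))
      ((represents_restrict _ _ _ _).comp ((Represents.conv (represents_restrict _ _ _ _)
        (.id _)).comp (represents_α hs hJ _ _ _)))
      ((represents_restrict _ _ _ _).comp (Represents.conv (.id _)
        (represents_restrict _ _ _ _))) L.ψ₀_coassoc
  ψ₀_counit_left :=
    Represents.eq (isIso_id_nerve p.unit)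
      ((represents_restrict _ _ _ _).comp ((Represents.conv (.nerveMap _) (.id _)).comp
        (represents_lam hs hJ _))) (.id _) L.ψ₀_counit_left
  ψ₀_counit_right :=
    Represents.eq (isIso_id_nerve p.unit)
      ((represents_restrict _ _ _ _).comp ((Represents.conv (.id _) (.nerveMap _)).comp
        (represents_rho hs hJ _))) (.id _) L.ψ₀_counit_right

theorem produoidal_normal (hL : IsIso L.φ₀) : (L.produoidal hp hs hJ).Normal :=
  ⟨nerveMap J (inv L.φ₀),
    (nerveMap_comp J _ _).symm.trans (by rw [IsIso.hom_inv_id]; exact nerveMap_id J _),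
    (nerveMap_comp J _ _).symm.trans (by rw [IsIso.inv_hom_id]; exact nerveMap_id J _)⟩

end Laxator

end Produo

/-! ### The sequential unit `N` as a monoid with compatible comultiplication -/

namespace Produo

open MonoidalCategory

/-- The monoidal category given by a monoidal structure. -/
@[reducible]
def TensorStr.monoidal {E : Type w} [Category.{v} E] (p : TensorStr E) : MonoidalCategory E :=
  letI : MonoidalCategoryStruct E :=
    { tensorObj := p.obj
      whiskerLeft := fun X _ _ f => p.map (𝟙 X) f
      whiskerRight := fun f Y => p.map f (𝟙 Y)
      tensorHom := p.map
      tensorUnit := p.unit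
      associator := p.assoc
      leftUnitor := p.lam
      rightUnitor := p.rho }
  MonoidalCategory.ofTensorHom
    (id_tensorHom_id := p.map_id)
    (tensorHom_comp_tensorHom := fun f₁ f₂ g₁ g₂ => (p.map_comp f₁ g₁ f₂ g₂).symm)
    (associator_naturality := p.assoc_nat)
    (leftUnitor_naturality := p.lam_nat)
    (rightUnitor_naturality := p.rho_nat)
    (pentagon := p.pentagon)
    (triangle := p.triangle)

/-- The monoidal structure of a monoidal category. -/
def TensorStr.ofMonoidal (C : Type w) [Category.{v} C] [MonoidalCategory C] : TensorStr C where
  obj X Y := X ⊗ Y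
  map f g := f ⊗ₘ g
  unit := 𝟙_ C
  assoc := α_
  lam := λ_
  rho := ρ_
  map_id _ _ := id_tensorHom_id _ _
  map_comp _ _ _ _ := (tensorHom_comp_tensorHom _ _ _ _).symm
  assoc_nat := associator_naturality
  lam_nat f := by simp
  rho_nat f := by simp
  pentagon P Q R S := by simp
  triangle P Q := by simp

/-- Kelly's consequence of the pentagon and triangle. It lets the single map `delta` invert both
unitors at the unit. -/
theorem TensorStr.lam_unit {E : Type w} [Category.{v} E] (p : TensorStr E) :
    (p.lam p.unit).hom = (p.rho p.unit).hom :=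
  let _ := p.monoidal
  unitors_equal (C := E)

section Comultiplication

variable {E : Type w} [Category.{v} E]

/-- The comultiplication `N ⟶ N ◁ N` of the unit. -/
def TensorStr.delta (s : TensorStr E) : s.unit ⟶ s.obj s.unit s.unit := (s.lam s.unit).inv

theorem TensorStr.delta_lam (s : TensorStr E) : s.delta ≫ (s.lam s.unit).hom = 𝟙 _ := Iso.inv_hom_id _

theorem TensorStr.delta_rho (s : TensorStr E) : s.delta ≫ (s.rho s.unit).hom = 𝟙 _ := by
  rw [← s.lam_unit, s.delta_lam]

/-- The equation holds even without the leading `s.delta`: since `s.delta` inverts both unitors at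
the unit, what remains is the triangle equation with its unitors inverted. -/
theorem TensorStr.delta_coassoc (s : TensorStr E) : s.delta ≫ s.map (s.delta) (𝟙 _) ≫ (s.assoc _ _ _).hom =
    s.delta ≫ s.map (𝟙 _) (s.delta) := by
  have h := s.triangle s.unit s.unit
  rw [← s.lam_unit] at h
  have h₁ : s.map (s.delta) (𝟙 s.unit) ≫ s.map (s.lam s.unit).hom (𝟙 s.unit) = 𝟙 _ := by
    rw [← s.map_comp, s.delta_lam, Category.comp_id, s.map_id]
  have h₂ : s.map (𝟙 s.unit) (s.lam s.unit).hom ≫ s.map (𝟙 s.unit) (s.delta) = 𝟙 _ := by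
    rw [← s.map_comp, TensorStr.delta, Iso.hom_inv_id, Category.comp_id, s.map_id]
  rw [← h] at h₁
  have h₃ : s.map (s.delta) (𝟙 s.unit) ≫ (s.assoc s.unit s.unit s.unit).hom =
      s.map (𝟙 s.unit) (s.delta) := by
    have := congrArg (· ≫ s.map (𝟙 s.unit) (s.delta)) h₁
    simpa only [Category.assoc, h₂, Category.comp_id, Category.id_comp] using this
  rw [h₃]

end Comultiplication

namespace Laxator

variable {C : Type w} [Category.{v} C] [MonoidalCategory C] {s : TensorStr C}
  (L : Laxator (TensorStr.ofMonoidal C) s)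

/-- The laxator `ψ` in the notation of monoidal categories. -/
def swap (A A' B B' : C) : s.obj A A' ⊗ s.obj B B' ⟶ s.obj (A ⊗ B) (A' ⊗ B') := L.ψ A A' B B'

/-- The multiplication of the monoid `s.unit`. -/
def mul : s.unit ⊗ s.unit ⟶ s.unit := L.φ₂

/-- The unit of the monoid `s.unit`. -/
def one : 𝟙_ C ⟶ s.unit := L.φ₀

/-- The comultiplication of the comonoid `𝟙_ C`. -/
def dup : 𝟙_ C ⟶ s.obj (𝟙_ C) (𝟙_ C) := L.ψ₀

theorem swap_nat {P P' Q Q' R R' S S' : C} (f : P ⟶ P') (g : Q ⟶ Q') (h : R ⟶ R')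
    (k : S ⟶ S') : (s.map f g ⊗ₘ s.map h k) ≫ L.swap P' Q' R' S' =
      L.swap P Q R S ≫ s.map (f ⊗ₘ h) (g ⊗ₘ k) := L.ψ_nat f g h k

theorem swap_assoc_par (A A' B B' D D' : C) :
    L.swap A A' B B' ▷ s.obj D D' ≫ L.swap (A ⊗ B) (A' ⊗ B') D D' ≫
        s.map (α_ A B D).hom (α_ A' B' D').hom =
      (α_ _ _ _).hom ≫ s.obj A A' ◁ L.swap B B' D D' ≫ L.swap A A' (B ⊗ D) (B' ⊗ D') := by
  rw [← tensorHom_id, ← id_tensorHom]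
  exact L.ψ_assoc_par A A' B B' D D'

theorem swap_assoc_seq (A B D A' B' D' : C) :
    L.swap (s.obj A B) D (s.obj A' B') D' ≫ s.map (L.swap A B A' B') (𝟙 (D ⊗ D')) ≫
        (s.assoc (A ⊗ A') (B ⊗ B') (D ⊗ D')).hom =
      ((s.assoc A B D).hom ⊗ₘ (s.assoc A' B' D').hom) ≫
        L.swap A (s.obj B D) A' (s.obj B' D') ≫ s.map (𝟙 (A ⊗ A')) (L.swap B D B' D') :=
  L.ψ_assoc_seq A B D A' B' D'

theorem swap_lam (A B : C) : L.swap s.unit A s.unit B ≫ s.map L.mul (𝟙 (A ⊗ B)) ≫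
    (s.lam (A ⊗ B)).hom = (s.lam A).hom ⊗ₘ (s.lam B).hom := L.φ_unit_left A B

theorem swap_rho (A B : C) : L.swap A s.unit B s.unit ≫ s.map (𝟙 (A ⊗ B)) L.mul ≫
    (s.rho (A ⊗ B)).hom = (s.rho A).hom ⊗ₘ (s.rho B).hom := L.φ_unit_right A B

theorem mul_assoc : L.mul ▷ s.unit ≫ L.mul =
    (α_ s.unit s.unit s.unit).hom ≫ s.unit ◁ L.mul ≫ L.mul := by
  rw [← tensorHom_id, ← id_tensorHom]
  exact L.φ₂_assoc

theorem one_mul : L.one ▷ s.unit ≫ L.mul = (λ_ s.unit).hom := by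
  rw [← tensorHom_id]
  exact L.φ₂_unit_left

theorem mul_one : s.unit ◁ L.one ≫ L.mul = (ρ_ s.unit).hom := by
  rw [← id_tensorHom]
  exact L.φ₂_unit_right

theorem dup_counit : L.dup ≫ s.map L.one (𝟙 (𝟙_ C)) ≫ (s.lam (𝟙_ C)).hom = 𝟙 (𝟙_ C) :=
  L.ψ₀_counit_left

/-- The interchange of a pair of bilinear maps. -/
def inter {A A' B B' X X' : C} (a : A ⊗ B ⟶ X) (a' : A' ⊗ B' ⟶ X') :
    s.obj A A' ⊗ s.obj B B' ⟶ s.obj X X' :=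
  L.swap A A' B B' ≫ s.map a a'

theorem inter_comp {A A' B B' X X' Y Y' : C} (a : A ⊗ B ⟶ X) (a' : A' ⊗ B' ⟶ X') (c : X ⟶ Y)
    (c' : X' ⟶ Y') : L.inter a a' ≫ s.map c c' = L.inter (a ≫ c) (a' ≫ c') := by
  rw [inter, inter, s.map_comp, Category.assoc]

theorem tensor_inter {A₁ A₁' B₁ B₁' A A' B B' X X' : C} (f : A₁ ⟶ A) (f' : A₁' ⟶ A') (g : B₁ ⟶ B)
    (g' : B₁' ⟶ B') (a : A ⊗ B ⟶ X) (a' : A' ⊗ B' ⟶ X') :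
    (s.map f f' ⊗ₘ s.map g g') ≫ L.inter a a' = L.inter ((f ⊗ₘ g) ≫ a) ((f' ⊗ₘ g') ≫ a') := by
  rw [inter, inter, s.map_comp, ← Category.assoc, L.swap_nat, Category.assoc]

theorem whiskerRight_inter {A₁ A₁' A A' B B' X X' : C} (f : A₁ ⟶ A) (f' : A₁' ⟶ A')
    (a : A ⊗ B ⟶ X) (a' : A' ⊗ B' ⟶ X') :
    s.map f f' ▷ s.obj B B' ≫ L.inter a a' = L.inter (f ▷ B ≫ a) (f' ▷ B' ≫ a') := by
  have h := L.tensor_inter f f' (𝟙 B) (𝟙 B') a a'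
  rwa [s.map_id, tensorHom_id, tensorHom_id, tensorHom_id] at h

theorem whiskerLeft_inter {A A' B₁ B₁' B B' X X' : C} (g : B₁ ⟶ B)
    (g' : B₁' ⟶ B') (a : A ⊗ B ⟶ X) (a' : A' ⊗ B' ⟶ X') :
    s.obj A A' ◁ s.map g g' ≫ L.inter a a' = L.inter (A ◁ g ≫ a) (A' ◁ g' ≫ a') := by
  have h := L.tensor_inter (𝟙 A) (𝟙 A') g g' a a'
  rwa [s.map_id, id_tensorHom, id_tensorHom, id_tensorHom] at h

/-- Associativity of the interchange with respect to the parallel tensor. -/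
theorem inter_assoc {A A' B B' D D' X X' Y Y' Z Z' : C} {f : A ⊗ B ⟶ X} {g : X ⊗ D ⟶ Z}
    {h : B ⊗ D ⟶ Y} {k : A ⊗ Y ⟶ Z} {f' : A' ⊗ B' ⟶ X'} {g' : X' ⊗ D' ⟶ Z'}
    {h' : B' ⊗ D' ⟶ Y'} {k' : A' ⊗ Y' ⟶ Z'} (e : f ▷ D ≫ g = (α_ A B D).hom ≫ A ◁ h ≫ k)
    (e' : f' ▷ D' ≫ g' = (α_ A' B' D').hom ≫ A' ◁ h' ≫ k') :
    L.inter f f' ▷ s.obj D D' ≫ L.inter g g' =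
      (α_ _ _ _).hom ≫ s.obj A A' ◁ L.inter h h' ≫ L.inter k k' := by
  have hp := congrArg (· ≫ s.map (A ◁ h ≫ k) (A' ◁ h' ≫ k')) (L.swap_assoc_par A A' B B' D D')
  simp only [Category.assoc, ← s.map_comp, ← e, ← e'] at hp
  rw [inter, comp_whiskerRight, Category.assoc, L.whiskerRight_inter, inter, hp,
    inter, whiskerLeft_comp, Category.assoc, L.whiskerLeft_inter, inter]

/-- Associativity of the interchange with respect to the sequential tensor. -/
theorem inter_inter_assoc {A A' B B' D D' X Y Z : C} (a : A ⊗ A' ⟶ X) (b : B ⊗ B' ⟶ Y)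
    (d : D ⊗ D' ⟶ Z) :
    L.inter (L.inter a b) d ≫ (s.assoc X Y Z).hom =
      ((s.assoc A B D).hom ⊗ₘ (s.assoc A' B' D').hom) ≫ L.inter a (L.inter b d) := by
  have hp := congrArg (· ≫ s.map a (s.map b d)) (L.swap_assoc_seq A B D A' B' D')
  have h₁ : L.inter (L.inter a b) d = L.swap (s.obj A B) D (s.obj A' B') D' ≫
      s.map (L.swap A B A' B') (𝟙 (D ⊗ D')) ≫ s.map (s.map a b) d := by
    rw [← s.map_comp, Category.id_comp]; rfl
  have h₂ : L.inter a (L.inter b d) = L.swap A (s.obj B D) A' (s.obj B' D') ≫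
      s.map (𝟙 (A ⊗ A')) (L.swap B D B' D') ≫ s.map a (s.map b d) := by
    rw [← s.map_comp, Category.id_comp]; rfl
  simp only [Category.assoc] at hp
  rw [h₁, h₂, Category.assoc, Category.assoc, s.assoc_nat, hp]

theorem inter_lam {A B X : C} (a : A ⊗ B ⟶ X) :
    L.inter L.mul a ≫ (s.lam X).hom = ((s.lam A).hom ⊗ₘ (s.lam B).hom) ≫ a := by
  have h₁ : L.inter L.mul a = L.swap s.unit A s.unit B ≫ s.map L.mul (𝟙 (A ⊗ B)) ≫
      s.map (𝟙 s.unit) a := by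
    rw [← s.map_comp, Category.id_comp, Category.comp_id]; rfl
  rw [h₁, ← L.swap_lam]
  simp only [Category.assoc, s.lam_nat]

theorem inter_rho {A B X : C} (a : A ⊗ B ⟶ X) :
    L.inter a L.mul ≫ (s.rho X).hom = ((s.rho A).hom ⊗ₘ (s.rho B).hom) ≫ a := by
  have h₁ : L.inter a L.mul = L.swap A s.unit B s.unit ≫ s.map (𝟙 (A ⊗ B)) L.mul ≫
      s.map a (𝟙 s.unit) := by
    rw [← s.map_comp, Category.id_comp, Category.comp_id]; rfl
  rw [h₁, ← L.swap_rho]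
  simp only [Category.assoc, s.rho_nat]

theorem dup_inter (A B : C) :
    L.dup ▷ s.obj A B ≫ L.inter (λ_ A).hom (λ_ B).hom = (λ_ (s.obj A B)).hom := by
  rw [← tensorHom_id]
  exact L.ψ_unit_left A B

theorem inter_dup (A B : C) :
    s.obj A B ◁ L.dup ≫ L.inter (ρ_ A).hom (ρ_ B).hom = (ρ_ (s.obj A B)).hom := by
  rw [← id_tensorHom]
  exact L.ψ_unit_right A B

/-- Tested after the invertible unitor `N ◁ N ≅ N`, where `inter_lam` collapses the interchange of
two multiplications to one. This compatibility is what makes actions of `N` on `P ◁ Q` associative;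
`one_delta` makes them unital. -/
theorem delta_mul : (s.delta ⊗ₘ s.delta) ≫ L.inter L.mul L.mul = L.mul ≫ s.delta := by
  rw [← cancel_mono (s.lam s.unit).hom, Category.assoc, L.inter_lam, Category.assoc, s.delta_lam,
    Category.comp_id, ← Category.assoc, tensorHom_comp_tensorHom, s.delta_lam, id_tensorHom_id,
    Category.id_comp]

/-- After the unitor `N ◁ N ≅ N` this is the counit law of the comonoid `I`, followed by `L.one`. -/
theorem one_delta : L.one ≫ s.delta = L.dup ≫ s.map L.one L.one := by
  have h : s.map L.one L.one = s.map L.one (𝟙 _) ≫ s.map (𝟙 _) L.one := by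
    rw [← s.map_comp, Category.id_comp, Category.comp_id]
  have h' := congrArg (· ≫ L.one) L.dup_counit
  rw [← cancel_mono (s.lam s.unit).hom, Category.assoc, s.delta_lam, Category.comp_id, h,
    Category.assoc, Category.assoc, s.lam_nat]
  simpa using h'.symm

end Laxator

end Produo

/-! ### The relative tensor product of bimodules -/

namespace Produo

open MonoidalCategory Limits

/-- The monoidal structure of the endomorphisms of an object of a bicategory. -/
def TensorStr.ofEnd {B : Type w} [Bicategory.{v, u} B] (X : B) : TensorStr (X ⟶ X) :=
  TensorStr.ofMonoidal (X ⟶ X)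

section BimodTensor

variable {C : Type w} [Category.{v} C] [MonoidalCategory C] [HasCoequalizers C]
  [∀ X : C, PreservesColimitsOfSize.{0, 0} (tensorLeft X)]
  [∀ X : C, PreservesColimitsOfSize.{0, 0} (tensorRight X)]

/-- The monoidal structure of bimodules over a monoid. -/
noncomputable def bimodPar (R : Mon C) : TensorStr (Bimod R R) :=
  -- Endomorphisms of `R` in the bicategory of monoids and bimodules are the bimodules over `R`, so
  -- the axioms are those of an endomorphism monoidal category.
  letI T := @TensorStr.ofEnd (Mon C) Bimod.monBicategory R
  { obj := Bimod.tensorBimod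
    map := fun f g => Bimod.whiskerRight f _ ≫ Bimod.whiskerLeft _ g
    unit := Bimod.regular R
    assoc := Bimod.associatorBimod
    lam := Bimod.leftUnitorBimod
    rho := Bimod.rightUnitorBimod
    map_id := T.map_id
    map_comp := T.map_comp
    assoc_nat := T.assoc_nat
    lam_nat := T.lam_nat
    rho_nat := T.rho_nat
    pentagon := T.pentagon
    triangle := T.triangle }

variable {R : Mon C} (P Q S : Bimod R R)

/-- The universal balanced map of a tensor product of bimodules. -/
noncomputable def bimodπ : P.X ⊗ Q.X ⟶ ((bimodPar R).obj P Q).X :=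
  coequalizer.π (P.actRight ▷ Q.X) ((α_ _ _ _).hom ≫ (P.X ◁ Q.actLeft))

theorem bimodπ_condition : P.actRight ▷ Q.X ≫ bimodπ P Q =
    (α_ _ _ _).hom ≫ P.X ◁ Q.actLeft ≫ bimodπ P Q := by
  have := coequalizer.condition (P.actRight ▷ Q.X) ((α_ _ _ _).hom ≫ (P.X ◁ Q.actLeft))
  rw [Category.assoc] at this
  exact this

instance : Epi (bimodπ P Q) :=
  inferInstanceAs (Epi (coequalizer.π (P.actRight ▷ Q.X) ((α_ _ _ _).hom ≫ (P.X ◁ Q.actLeft))))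

/-- Tensoring preserves colimits, hence epimorphisms. Maps out of a relative tensor product further
tensored with `Z` can therefore be compared on representatives. -/
instance (Z : C) : Epi (bimodπ P Q ▷ Z) :=
  inferInstanceAs (Epi ((tensorRight Z).map (bimodπ P Q)))

instance (Z : C) : Epi (Z ◁ bimodπ P Q) :=
  inferInstanceAs (Epi ((tensorLeft Z).map (bimodπ P Q)))

variable {P Q S}

/-- The map out of a tensor product of bimodules induced by a balanced map. -/
noncomputable def bimodDesc {Z : C} (f : P.X ⊗ Q.X ⟶ Z) (hf : P.actRight ▷ Q.X ≫ f =
    (α_ _ _ _).hom ≫ P.X ◁ Q.actLeft ≫ f) : ((bimodPar R).obj P Q).X ⟶ Z :=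
  coequalizer.desc f (by rw [hf, Category.assoc])

theorem bimodπ_desc {Z : C} (f : P.X ⊗ Q.X ⟶ Z) (hf : P.actRight ▷ Q.X ≫ f =
    (α_ _ _ _).hom ≫ P.X ◁ Q.actLeft ≫ f) : bimodπ P Q ≫ bimodDesc f hf = f :=
  coequalizer.π_desc _ _

variable (P Q S)

theorem bimodπ_actLeft : R.X ◁ bimodπ P Q ≫ ((bimodPar R).obj P Q).actLeft =
    (α_ _ _ _).inv ≫ P.actLeft ▷ Q.X ≫ bimodπ P Q :=
  Bimod.TensorBimod.whiskerLeft_π_actLeft P Q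

theorem bimodπ_actRight : bimodπ P Q ▷ R.X ≫ ((bimodPar R).obj P Q).actRight =
    (α_ _ _ _).hom ≫ P.X ◁ Q.actRight ≫ bimodπ P Q :=
  Bimod.TensorBimod.π_tensor_id_actRight P Q

variable {P Q} in
theorem bimodπ_map {P' Q' : Bimod R R} (f : P ⟶ P') (g : Q ⟶ Q') :
    bimodπ P Q ≫ ((bimodPar R).map f g).hom = (f.hom ⊗ₘ g.hom) ≫ bimodπ P' Q' := by
  have h₁ : bimodπ P Q ≫ (Bimod.whiskerRight f Q).hom = f.hom ▷ Q.X ≫ bimodπ P' Q :=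
    (ι_colimMap _ _).trans rfl
  have h₂ : bimodπ P' Q ≫ (Bimod.whiskerLeft P' g).hom = P'.X ◁ g.hom ≫ bimodπ P' Q' :=
    (ι_colimMap _ _).trans rfl
  change bimodπ P Q ≫ (Bimod.whiskerRight f Q).hom ≫ (Bimod.whiskerLeft P' g).hom = _
  rw [MonoidalCategory.tensorHom_def, Category.assoc, ← h₂]
  exact sq_assoc h₁ _

theorem bimodπ_assoc : bimodπ P Q ▷ S.X ≫ bimodπ _ S ≫ ((bimodPar R).assoc P Q S).hom.hom =
    (α_ _ _ _).hom ≫ P.X ◁ bimodπ Q S ≫ bimodπ P _ := by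
  have h : bimodπ ((bimodPar R).obj P Q) S ≫ ((bimodPar R).assoc P Q S).hom.hom =
      Bimod.AssociatorBimod.homAux P Q S := coequalizer.π_desc _ _
  rw [h]
  exact π_tensor_id_preserves_coequalizer_inv_desc _ _ _ _

theorem bimodπ_lam : bimodπ (bimodPar R).unit P ≫ ((bimodPar R).lam P).hom.hom = P.actLeft :=
  coequalizer.π_desc _ _

theorem bimodπ_rho : bimodπ P (bimodPar R).unit ≫ ((bimodPar R).rho P).hom.hom = P.actRight :=
  coequalizer.π_desc _ _

end BimodTensor

end Produo

/-! ### The sequential tensor of bimodules -/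

namespace Produo

open MonoidalCategory Limits

theorem actRight_assoc {C : Type w} [Category.{v} C] [MonoidalCategory C] {R S : Mon C}
    (P : Bimod R S) : P.actRight ▷ S.X ≫ P.actRight =
      (α_ _ _ _).hom ≫ P.X ◁ MonObj.mul (X := S.X) ≫ P.actRight := by
  rw [P.right_assoc, Iso.hom_inv_id_assoc]

section WhiskerAssoc

variable {C : Type w} [Category.{v} C] [MonoidalCategory C] {N D X Y Z W : C}

/-- Only interchange is involved: acting twice through `δ` is acting twice by `D` after two copies
of `δ`. It is applied with `δ` the comultiplication `N ⟶ N ◁ N`. -/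
theorem tensor_whiskerRight_assoc (δ : N ⟶ D) (h : D ⊗ X ⟶ Y) (k : D ⊗ Y ⟶ Z) :
    (δ ⊗ₘ δ) ▷ X ≫ (α_ D D X).hom ≫ D ◁ h ≫ k =
      (α_ N N X).hom ≫ N ◁ (δ ▷ X ≫ h) ≫ δ ▷ Y ≫ k := by
  have h₁ := associator_naturality_assoc δ δ (𝟙 X) (D ◁ h ≫ k)
  rw [tensorHom_id, tensorHom_id] at h₁
  rw [h₁, MonoidalCategory.tensorHom_def']
  simp [whisker_exchange_assoc]

theorem whiskerLeft_tensor_assoc (δ : N ⟶ D) (h : X ⊗ D ⟶ Y) (k : Y ⊗ D ⟶ Z) :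
    X ◁ (δ ⊗ₘ δ) ≫ (α_ X D D).inv ≫ h ▷ D ≫ k =
      (α_ X N N).inv ≫ (X ◁ δ ≫ h) ▷ N ≫ Y ◁ δ ≫ k := by
  simp [MonoidalCategory.tensorHom_def, ← whisker_exchange_assoc]

theorem whisker_middle_assoc (δ : N ⟶ D) {l : D ⊗ X ⟶ Y} {r : Y ⊗ D ⟶ Z}
    {r' : X ⊗ D ⟶ W} {l' : D ⊗ W ⟶ Z} (h : l ▷ D ≫ r = (α_ D X D).hom ≫ D ◁ r' ≫ l') :
    (δ ▷ X ≫ l) ▷ N ≫ Y ◁ δ ≫ r = (α_ N X N).hom ≫ N ◁ (X ◁ δ ≫ r') ≫ δ ▷ W ≫ l' := by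
  have h₁ : δ ▷ X ▷ N ≫ (D ⊗ X) ◁ δ ≫ (α_ D X D).hom ≫ D ◁ r' ≫ l' =
      (α_ N X N).hom ≫ δ ▷ (X ⊗ N) ≫ D ◁ X ◁ δ ≫ D ◁ r' ≫ l' := by simp
  rw [comp_whiskerRight, Category.assoc, ← whisker_exchange_assoc, h, h₁]
  simp only [whisker_exchange_assoc, whiskerLeft_comp, Category.assoc]

theorem whiskerRight_tensor_counit (δ : N ⟶ D) (ε : D ⟶ N) (h : δ ≫ ε = 𝟙 N) (f : X ⟶ Y) :
    δ ▷ X ≫ (ε ⊗ₘ f) = N ◁ f := by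
  rw [MonoidalCategory.tensorHom_def, ← comp_whiskerRight_assoc, h, id_whiskerRight,
    Category.id_comp]

theorem whiskerLeft_tensor_counit (δ : N ⟶ D) (ε : D ⟶ N) (h : δ ≫ ε = 𝟙 N) (f : X ⟶ Y) :
    X ◁ δ ≫ (f ⊗ₘ ε) = f ▷ N := by
  rw [MonoidalCategory.tensorHom_def', ← whiskerLeft_comp_assoc, h, whiskerLeft_id,
    Category.id_comp]

end WhiskerAssoc

namespace Laxator

variable {C : Type w} [Category.{v} C] [MonoidalCategory C] {s : TensorStr C}
  (L : Laxator (TensorStr.ofMonoidal C) s)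

/-- The unit of the second monoidal structure is a monoid for the first. -/
def monoid : Mon C where
  X := s.unit
  mon :=
    { one := L.one
      mul := L.mul
      one_mul := L.one_mul
      mul_one := L.mul_one
      mul_assoc := L.mul_assoc }

/-- The comultiplication `N ⟶ N ◁ N` of the monoid `N`. -/
def comul : L.monoid.X ⟶ s.obj L.monoid.X L.monoid.X := s.delta

theorem comul_mul : (L.comul ⊗ₘ L.comul) ≫ L.inter (MonObj.mul (X := L.monoid.X))
    (MonObj.mul (X := L.monoid.X)) = MonObj.mul (X := L.monoid.X) ≫ L.comul := L.delta_mul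

theorem one_comul : MonObj.one (X := L.monoid.X) ≫ L.comul =
    L.dup ≫ s.map (MonObj.one (X := L.monoid.X)) (MonObj.one (X := L.monoid.X)) := L.one_delta

theorem comul_coassoc : L.comul ≫ s.map L.comul (𝟙 _) ≫ (s.assoc _ _ _).hom =
    L.comul ≫ s.map (𝟙 _) L.comul := s.delta_coassoc

/-- The pair of left actions `N ⊗ (A ◁ B) ⟶ X ◁ Y` obtained by duplicating `N`. -/
def interLeft {A B X Y : C} (a : L.monoid.X ⊗ A ⟶ X) (b : L.monoid.X ⊗ B ⟶ Y) :
    L.monoid.X ⊗ s.obj A B ⟶ s.obj X Y :=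
  L.comul ▷ s.obj A B ≫ L.inter a b

/-- The pair of right actions `(A ◁ B) ⊗ N ⟶ X ◁ Y` obtained by duplicating `N`. -/
def interRight {A B X Y : C} (a : A ⊗ L.monoid.X ⟶ X) (b : B ⊗ L.monoid.X ⟶ Y) :
    s.obj A B ⊗ L.monoid.X ⟶ s.obj X Y :=
  s.obj A B ◁ L.comul ≫ L.inter a b

theorem interLeft_comp {A B X Y X' Y' : C} (a : L.monoid.X ⊗ A ⟶ X) (b : L.monoid.X ⊗ B ⟶ Y)
    (f : X ⟶ X') (g : Y ⟶ Y') :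
    L.interLeft a b ≫ s.map f g = L.interLeft (a ≫ f) (b ≫ g) := by
  rw [interLeft, Category.assoc, inter_comp, interLeft]

theorem interRight_comp {A B X Y X' Y' : C} (a : A ⊗ L.monoid.X ⟶ X) (b : B ⊗ L.monoid.X ⟶ Y)
    (f : X ⟶ X') (g : Y ⟶ Y') :
    L.interRight a b ≫ s.map f g = L.interRight (a ≫ f) (b ≫ g) := by
  rw [interRight, Category.assoc, inter_comp, interRight]

theorem whiskerLeft_interLeft {A B A' B' X Y : C} (f : A ⟶ A') (g : B ⟶ B')
    (a : L.monoid.X ⊗ A' ⟶ X) (b : L.monoid.X ⊗ B' ⟶ Y) :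
    L.monoid.X ◁ s.map f g ≫ L.interLeft a b =
      L.interLeft (L.monoid.X ◁ f ≫ a) (L.monoid.X ◁ g ≫ b) := by
  rw [interLeft, whisker_exchange_assoc, whiskerLeft_inter, interLeft]

theorem whiskerRight_interRight {A B A' B' X Y : C} (f : A ⟶ A') (g : B ⟶ B')
    (a : A' ⊗ L.monoid.X ⟶ X) (b : B' ⊗ L.monoid.X ⟶ Y) :
    s.map f g ▷ L.monoid.X ≫ L.interRight a b =
      L.interRight (f ▷ L.monoid.X ≫ a) (g ▷ L.monoid.X ≫ b) := by
  rw [interRight, ← whisker_exchange_assoc, whiskerRight_inter, interRight]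

/-- The two nestings duplicate `N` by the two iterates of `comul`. Coassociativity identifies these,
and `inter_inter_assoc` handles the interchanges. -/
theorem interLeft_assoc {A B D X Y Z : C} (a : L.monoid.X ⊗ A ⟶ X) (b : L.monoid.X ⊗ B ⟶ Y)
    (d : L.monoid.X ⊗ D ⟶ Z) : L.interLeft (L.interLeft a b) d ≫ (s.assoc X Y Z).hom =
      L.monoid.X ◁ (s.assoc A B D).hom ≫ L.interLeft a (L.interLeft b d) := by
  have h : L.interLeft (L.interLeft a b) d =
      (L.comul ≫ s.map L.comul (𝟙 _)) ▷ _ ≫ L.inter (L.inter a b) d := by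
    rw [comp_whiskerRight_assoc, whiskerRight_inter, id_whiskerRight, Category.id_comp]; rfl
  have h' : L.interLeft a (L.interLeft b d) =
      (L.comul ≫ s.map (𝟙 _) L.comul) ▷ _ ≫ L.inter a (L.inter b d) := by
    rw [comp_whiskerRight_assoc, whiskerRight_inter, id_whiskerRight, Category.id_comp]; rfl
  rw [h, h', ← comul_coassoc, Category.assoc, inter_inter_assoc, MonoidalCategory.tensorHom_def]
  simp only [whisker_exchange_assoc, comp_whiskerRight, Category.assoc]

theorem interRight_assoc {A B D X Y Z : C} (a : A ⊗ L.monoid.X ⟶ X) (b : B ⊗ L.monoid.X ⟶ Y)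
    (d : D ⊗ L.monoid.X ⟶ Z) : L.interRight (L.interRight a b) d ≫ (s.assoc X Y Z).hom =
      (s.assoc A B D).hom ▷ L.monoid.X ≫ L.interRight a (L.interRight b d) := by
  have h : L.interRight (L.interRight a b) d =
      _ ◁ (L.comul ≫ s.map L.comul (𝟙 _)) ≫ L.inter (L.inter a b) d := by
    rw [whiskerLeft_comp_assoc, whiskerLeft_inter, whiskerLeft_id, Category.id_comp]; rfl
  have h' : L.interRight a (L.interRight b d) =
      _ ◁ (L.comul ≫ s.map (𝟙 _) L.comul) ≫ L.inter a (L.inter b d) := by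
    rw [whiskerLeft_comp_assoc, whiskerLeft_inter, whiskerLeft_id, Category.id_comp]; rfl
  rw [h, h', ← comul_coassoc, Category.assoc, inter_inter_assoc, MonoidalCategory.tensorHom_def']
  simp only [← whisker_exchange_assoc, whiskerLeft_comp, Category.assoc]

/-- By `inter_lam` the copy of `N` that meets the unit factor is erased by the unitor, and erasing
one of the two copies made by `comul` gives back `N`. -/
theorem interLeft_lam {B Y : C} (b : L.monoid.X ⊗ B ⟶ Y) :
    L.interLeft (MonObj.mul (X := L.monoid.X)) b ≫ (s.lam Y).hom =
      L.monoid.X ◁ (s.lam B).hom ≫ b :=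
  (Category.assoc _ _ _).trans ((congrArg (_ ≫ ·) (L.inter_lam b)).trans
    ((Category.assoc _ _ _).symm.trans
      (congrArg (· ≫ b) (whiskerRight_tensor_counit _ _ s.delta_lam _))))

theorem interLeft_rho {B Y : C} (b : L.monoid.X ⊗ B ⟶ Y) :
    L.interLeft b (MonObj.mul (X := L.monoid.X)) ≫ (s.rho Y).hom =
      L.monoid.X ◁ (s.rho B).hom ≫ b :=
  (Category.assoc _ _ _).trans ((congrArg (_ ≫ ·) (L.inter_rho b)).trans
    ((Category.assoc _ _ _).symm.trans
      (congrArg (· ≫ b) (whiskerRight_tensor_counit _ _ s.delta_rho _))))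

theorem interRight_lam {B Y : C} (b : B ⊗ L.monoid.X ⟶ Y) :
    L.interRight (MonObj.mul (X := L.monoid.X)) b ≫ (s.lam Y).hom =
      (s.lam B).hom ▷ L.monoid.X ≫ b :=
  (Category.assoc _ _ _).trans ((congrArg (_ ≫ ·) (L.inter_lam b)).trans
    ((Category.assoc _ _ _).symm.trans
      (congrArg (· ≫ b) (whiskerLeft_tensor_counit _ _ s.delta_lam _))))

theorem interRight_rho {B Y : C} (b : B ⊗ L.monoid.X ⟶ Y) :
    L.interRight b (MonObj.mul (X := L.monoid.X)) ≫ (s.rho Y).hom =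
      (s.rho B).hom ▷ L.monoid.X ≫ b :=
  (Category.assoc _ _ _).trans ((congrArg (_ ≫ ·) (L.inter_rho b)).trans
    ((Category.assoc _ _ _).symm.trans
      (congrArg (· ≫ b) (whiskerLeft_tensor_counit _ _ s.delta_rho _))))

/-- The sequential tensor of bimodules. -/
def seqObj (P Q : Bimod L.monoid L.monoid) : Bimod L.monoid L.monoid where
  X := s.obj P.X Q.X
  actLeft := L.interLeft P.actLeft Q.actLeft
  actRight := L.interRight P.actRight Q.actRight
  -- The unit laws combine `one_comul` with `dup_inter` and `inter_dup`. The associativity laws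
  -- combine `comul_mul` with `inter_assoc` for the laws of `P` and `Q`. Middle associativity uses
  -- no property of `comul`.
  one_actLeft := by
    rw [interLeft, ← comp_whiskerRight_assoc, one_comul, comp_whiskerRight_assoc,
      whiskerRight_inter, P.one_actLeft, Q.one_actLeft, dup_inter]
  actRight_one := by
    rw [interRight, ← whiskerLeft_comp_assoc, one_comul, whiskerLeft_comp_assoc,
      whiskerLeft_inter, P.actRight_one, Q.actRight_one, inter_dup]
  left_assoc := by
    rw [interLeft, ← comp_whiskerRight_assoc, ← comul_mul, comp_whiskerRight_assoc,
      L.inter_assoc P.left_assoc Q.left_assoc, tensor_whiskerRight_assoc]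
  right_assoc := by
    have h := L.inter_assoc (actRight_assoc P) (actRight_assoc Q)
    rw [interRight, ← whiskerLeft_comp_assoc, ← comul_mul, whiskerLeft_comp_assoc,
      ← whiskerLeft_tensor_assoc, h, Iso.inv_hom_id_assoc]
  middle_assoc := whisker_middle_assoc _ (L.inter_assoc P.middle_assoc Q.middle_assoc)

/-- The sequential tensor of morphisms of bimodules. -/
def seqMap {P P' Q Q' : Bimod L.monoid L.monoid} (f : P ⟶ P') (g : Q ⟶ Q') :
    L.seqObj P Q ⟶ L.seqObj P' Q' where
  hom := s.map f.hom g.hom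
  left_act_hom := (L.interLeft_comp _ _ _ _).trans
    ((congrArg₂ _ f.left_act_hom g.left_act_hom).trans (L.whiskerLeft_interLeft _ _ _ _).symm)
  right_act_hom := (L.interRight_comp _ _ _ _).trans
    ((congrArg₂ _ f.right_act_hom g.right_act_hom).trans (L.whiskerRight_interRight _ _ _ _).symm)

/-- The sequential monoidal structure of bimodules over the monoid `N`. -/
def bimodSeq : TensorStr (Bimod L.monoid L.monoid) where
  obj := L.seqObj
  map := L.seqMap
  unit := Bimod.regular L.monoid
  assoc P Q R := Bimod.isoOfIso (P := L.seqObj (L.seqObj P Q) R) (Q := L.seqObj P (L.seqObj Q R))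
    (s.assoc P.X Q.X R.X) (L.interLeft_assoc _ _ _) (L.interRight_assoc _ _ _)
  lam P := Bimod.isoOfIso (P := L.seqObj (Bimod.regular L.monoid) P)
    (s.lam P.X) (L.interLeft_lam _) (L.interRight_lam _)
  rho P := Bimod.isoOfIso (P := L.seqObj P (Bimod.regular L.monoid))
    (s.rho P.X) (L.interLeft_rho _) (L.interRight_rho _)
  -- The forgetful functor to `C` is faithful and carries this structure strictly to `s`, so every
  -- axiom is the corresponding axiom of `s`.
  map_id _ _ := Bimod.hom_ext _ _ (s.map_id _ _)
  map_comp _ _ _ _ := Bimod.hom_ext _ _ (s.map_comp _ _ _ _)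
  assoc_nat _ _ _ := Bimod.hom_ext _ _ (s.assoc_nat _ _ _)
  lam_nat _ := Bimod.hom_ext _ _ (s.lam_nat _)
  rho_nat _ := Bimod.hom_ext _ _ (s.rho_nat _)
  pentagon _ _ _ _ := Bimod.hom_ext _ _ (s.pentagon _ _ _ _)
  triangle _ _ := Bimod.hom_ext _ _ (s.triangle _ _)

end Laxator

end Produo

/-! ### The normal duoidal category of bimodules -/

namespace Produo

open MonoidalCategory Limits

theorem sq_assoc₃ {E : Type w} [Category.{v} E] {X Y Z Y' Z' W T : E} {f : X ⟶ Y} {g : Y ⟶ Z}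
    {h : Z ⟶ W} {f' : X ⟶ Y'} {g' : Y' ⟶ Z'} {h' : Z' ⟶ W} (e : f ≫ g ≫ h = f' ≫ g' ≫ h')
    (k : W ⟶ T) : f ≫ g ≫ h ≫ k = f' ≫ g' ≫ h' ≫ k := by
  simpa using congrArg (· ≫ k) e

/-- The triangle equation together with the equality of the unitors at the unit. It is the
associativity of `φ₂` when both units coincide. -/
theorem TensorStr.lam_assoc {E : Type w} [Category.{v} E] (p : TensorStr E) :
    p.map (p.lam p.unit).hom (𝟙 p.unit) ≫ (p.lam p.unit).hom =
      (p.assoc p.unit p.unit p.unit).hom ≫ p.map (𝟙 p.unit) (p.lam p.unit).hom ≫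
        (p.lam p.unit).hom := by
  rw [← Category.assoc (p.assoc _ _ _).hom, p.triangle, lam_unit]

namespace Laxator

variable {C : Type w} [Category.{v} C] [MonoidalCategory C] {s : TensorStr C}
  (L : Laxator (TensorStr.ofMonoidal C) s)

/-- This and the next two are `inter_assoc` with a copy of `N`, duplicated by `comul`, in the
middle, left or right factor. They make the laxator of bimodules balanced, left linear and right
linear respectively. -/
theorem interRight_inter {A A' D D' X X' Y Y' Z Z' : C} {f : A ⊗ L.monoid.X ⟶ X} {g : X ⊗ D ⟶ Z}
    {h : L.monoid.X ⊗ D ⟶ Y} {k : A ⊗ Y ⟶ Z} {f' : A' ⊗ L.monoid.X ⟶ X'} {g' : X' ⊗ D' ⟶ Z'}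
    {h' : L.monoid.X ⊗ D' ⟶ Y'} {k' : A' ⊗ Y' ⟶ Z'}
    (e : f ▷ D ≫ g = (α_ A _ D).hom ≫ A ◁ h ≫ k)
    (e' : f' ▷ D' ≫ g' = (α_ A' _ D').hom ≫ A' ◁ h' ≫ k') :
    L.interRight f f' ▷ s.obj D D' ≫ L.inter g g' =
      (α_ _ _ _).hom ≫ s.obj A A' ◁ L.interLeft h h' ≫ L.inter k k' := by
  rw [interRight, comp_whiskerRight_assoc, L.inter_assoc e e', interLeft, whiskerLeft_comp_assoc]
  simp

theorem interLeft_inter {B B' D D' X X' Y Y' Z Z' : C} {f : L.monoid.X ⊗ B ⟶ X} {g : X ⊗ D ⟶ Z}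
    {h : B ⊗ D ⟶ Y} {k : L.monoid.X ⊗ Y ⟶ Z} {f' : L.monoid.X ⊗ B' ⟶ X'} {g' : X' ⊗ D' ⟶ Z'}
    {h' : B' ⊗ D' ⟶ Y'} {k' : L.monoid.X ⊗ Y' ⟶ Z'}
    (e : f ▷ D ≫ g = (α_ _ B D).hom ≫ _ ◁ h ≫ k)
    (e' : f' ▷ D' ≫ g' = (α_ _ B' D').hom ≫ _ ◁ h' ≫ k') :
    L.interLeft f f' ▷ s.obj D D' ≫ L.inter g g' =
      (α_ _ _ _).hom ≫ L.monoid.X ◁ L.inter h h' ≫ L.interLeft k k' := by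
  rw [interLeft, comp_whiskerRight_assoc, L.inter_assoc e e', interLeft, whisker_exchange_assoc]
  simp

theorem inter_interRight {A A' B B' X X' Y Y' Z Z' : C} {f : A ⊗ B ⟶ X}
    {g : X ⊗ L.monoid.X ⟶ Z} {h : B ⊗ L.monoid.X ⟶ Y} {k : A ⊗ Y ⟶ Z} {f' : A' ⊗ B' ⟶ X'}
    {g' : X' ⊗ L.monoid.X ⟶ Z'} {h' : B' ⊗ L.monoid.X ⟶ Y'} {k' : A' ⊗ Y' ⟶ Z'}
    (e : f ▷ _ ≫ g = (α_ A B _).hom ≫ A ◁ h ≫ k)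
    (e' : f' ▷ _ ≫ g' = (α_ A' B' _).hom ≫ A' ◁ h' ≫ k') :
    L.inter f f' ▷ L.monoid.X ≫ L.interRight g g' =
      (α_ _ _ _).hom ≫ s.obj A A' ◁ L.interRight h h' ≫ L.inter k k' := by
  rw [interRight, interRight, ← whisker_exchange_assoc, L.inter_assoc e e', whiskerLeft_comp_assoc]
  simp

variable [HasCoequalizers C]
  [∀ X : C, PreservesColimitsOfSize.{0, 0} (tensorLeft X)]
  [∀ X : C, PreservesColimitsOfSize.{0, 0} (tensorRight X)]

variable (P Q R S : Bimod L.monoid L.monoid)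

/-- The universal balanced map for sequential tensors of bimodules. -/
noncomputable def seqπ : s.obj P.X Q.X ⊗ s.obj R.X S.X ⟶
    ((bimodPar L.monoid).obj (L.seqObj P Q) (L.seqObj R S)).X :=
  bimodπ (L.seqObj P Q) (L.seqObj R S)

instance : Epi (L.seqπ P Q R S) :=
  inferInstanceAs (Epi (bimodπ (L.seqObj P Q) (L.seqObj R S)))

instance (Z : C) : Epi (L.seqπ P Q R S ▷ Z) :=
  inferInstanceAs (Epi (bimodπ (L.seqObj P Q) (L.seqObj R S) ▷ Z))

instance (Z : C) : Epi (Z ◁ L.seqπ P Q R S) :=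
  inferInstanceAs (Epi (Z ◁ bimodπ (L.seqObj P Q) (L.seqObj R S)))

/-- The morphism underlying the laxator of bimodules. -/
noncomputable def psi : ((bimodPar L.monoid).obj (L.seqObj P Q) (L.seqObj R S)).X ⟶
    s.obj ((bimodPar L.monoid).obj P R).X ((bimodPar L.monoid).obj Q S).X :=
  bimodDesc (L.inter (bimodπ P R) (bimodπ Q S))
    (L.interRight_inter (bimodπ_condition P R) (bimodπ_condition Q S))

theorem seqπ_psi : L.seqπ P Q R S ≫ L.psi P Q R S = L.inter (bimodπ P R) (bimodπ Q S) :=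
  bimodπ_desc _ _

theorem seqπ_psi_assoc {Z : C} (k : _ ⟶ Z) : L.seqπ P Q R S ≫ L.psi P Q R S ≫ k =
    L.inter (bimodπ P R) (bimodπ Q S) ≫ k := by
  rw [← Category.assoc, seqπ_psi]

theorem seqπ_actLeft : L.monoid.X ◁ L.seqπ P Q R S ≫
    ((bimodPar L.monoid).obj (L.seqObj P Q) (L.seqObj R S)).actLeft =
      (α_ _ _ _).inv ≫ L.interLeft P.actLeft Q.actLeft ▷ s.obj R.X S.X ≫ L.seqπ P Q R S :=
  bimodπ_actLeft _ _

theorem seqπ_actRight : L.seqπ P Q R S ▷ L.monoid.X ≫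
    ((bimodPar L.monoid).obj (L.seqObj P Q) (L.seqObj R S)).actRight =
      (α_ _ _ _).hom ≫ s.obj P.X Q.X ◁ L.interRight R.actRight S.actRight ≫ L.seqπ P Q R S :=
  bimodπ_actRight _ _

theorem bimodπ_actLeft_hom {T : Mon C} (P Q : Bimod T T) :
    P.actLeft ▷ Q.X ≫ bimodπ P Q = (α_ _ _ _).hom ≫ T.X ◁ bimodπ P Q ≫
      ((bimodPar T).obj P Q).actLeft := by
  rw [bimodπ_actLeft, Iso.hom_inv_id_assoc]

/-- On representatives the laxator is an interchange of quotient maps, each of them left linear, so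
`interLeft_inter` applies. -/
theorem psi_actLeft : ((bimodPar L.monoid).obj (L.seqObj P Q) (L.seqObj R S)).actLeft ≫
    L.psi P Q R S = L.monoid.X ◁ L.psi P Q R S ≫ L.interLeft
      ((bimodPar L.monoid).obj P R).actLeft ((bimodPar L.monoid).obj Q S).actLeft := by
  rw [← cancel_epi (L.monoid.X ◁ L.seqπ P Q R S), ← Category.assoc, seqπ_actLeft,
    Category.assoc, Category.assoc, seqπ_psi,
    L.interLeft_inter (bimodπ_actLeft_hom P R) (bimodπ_actLeft_hom Q S),
    Iso.inv_hom_id_assoc, ← whiskerLeft_comp_assoc, seqπ_psi]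

theorem psi_actRight : ((bimodPar L.monoid).obj (L.seqObj P Q) (L.seqObj R S)).actRight ≫
    L.psi P Q R S = L.psi P Q R S ▷ L.monoid.X ≫ L.interRight
      ((bimodPar L.monoid).obj P R).actRight ((bimodPar L.monoid).obj Q S).actRight := by
  rw [← cancel_epi (L.seqπ P Q R S ▷ L.monoid.X), ← Category.assoc, seqπ_actRight,
    Category.assoc, Category.assoc, seqπ_psi,
    ← L.inter_interRight (bimodπ_actRight P R) (bimodπ_actRight Q S),
    ← comp_whiskerRight_assoc, seqπ_psi]

/-- The laxator of bimodules. -/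
noncomputable def psiHom : (bimodPar L.monoid).obj (L.seqObj P Q) (L.seqObj R S) ⟶
    L.seqObj ((bimodPar L.monoid).obj P R) ((bimodPar L.monoid).obj Q S) where
  hom := L.psi P Q R S
  left_act_hom := L.psi_actLeft P Q R S
  right_act_hom := L.psi_actRight P Q R S

variable {P Q R S} in
theorem psi_natural {P' Q' R' S' : Bimod L.monoid L.monoid} (f : P ⟶ P') (g : Q ⟶ Q')
    (h : R ⟶ R') (k : S ⟶ S') :
    ((bimodPar L.monoid).map (L.seqMap f g) (L.seqMap h k)).hom ≫ L.psi P' Q' R' S' =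
      L.psi P Q R S ≫ s.map ((bimodPar L.monoid).map f h).hom
        ((bimodPar L.monoid).map g k).hom := by
  have h₁ : L.seqπ P Q R S ≫ ((bimodPar L.monoid).map (L.seqMap f g) (L.seqMap h k)).hom =
      (s.map f.hom g.hom ⊗ₘ s.map h.hom k.hom) ≫ L.seqπ P' Q' R' S' := bimodπ_map _ _
  rw [← cancel_epi (L.seqπ P Q R S), seqπ_psi_assoc, inter_comp, bimodπ_map, bimodπ_map,
    ← tensor_inter, ← seqπ_psi]
  exact sq_assoc h₁ _

/-- The threefold relative tensor product is reached by two successive epimorphisms. Before them the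
equation is `inter_assoc` for the quotient maps, whose associativity is `bimodπ_assoc`. -/
theorem psi_assoc_par (a b c d e f : Bimod L.monoid L.monoid) :
    ((bimodPar L.monoid).map (L.psiHom a b c d) (𝟙 (L.seqObj e f))).hom ≫
        L.psi ((bimodPar L.monoid).obj a c) ((bimodPar L.monoid).obj b d) e f ≫
          s.map ((bimodPar L.monoid).assoc a c e).hom.hom
            ((bimodPar L.monoid).assoc b d f).hom.hom =
      ((bimodPar L.monoid).assoc (L.seqObj a b) (L.seqObj c d) (L.seqObj e f)).hom.hom ≫
        ((bimodPar L.monoid).map (𝟙 (L.seqObj a b)) (L.psiHom c d e f)).hom ≫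
          L.psi a b ((bimodPar L.monoid).obj c e) ((bimodPar L.monoid).obj d f) := by
  have h₁ : bimodπ ((bimodPar L.monoid).obj (L.seqObj a b) (L.seqObj c d)) (L.seqObj e f) ≫
      ((bimodPar L.monoid).map (L.psiHom a b c d) (𝟙 (L.seqObj e f))).hom =
        L.psi a b c d ▷ s.obj e.X f.X ≫
          L.seqπ ((bimodPar L.monoid).obj a c) ((bimodPar L.monoid).obj b d) e f :=
    (bimodπ_map _ _).trans (congrArg (· ≫ L.seqπ _ _ _ _) (tensorHom_id _ _))
  have h₂ : L.seqπ a b c d ▷ s.obj e.X f.X ≫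
      bimodπ ((bimodPar L.monoid).obj (L.seqObj a b) (L.seqObj c d)) (L.seqObj e f) ≫
        ((bimodPar L.monoid).assoc (L.seqObj a b) (L.seqObj c d) (L.seqObj e f)).hom.hom =
      (α_ _ _ _).hom ≫ s.obj a.X b.X ◁ L.seqπ c d e f ≫
        bimodπ (L.seqObj a b) ((bimodPar L.monoid).obj (L.seqObj c d) (L.seqObj e f)) :=
    bimodπ_assoc (L.seqObj a b) (L.seqObj c d) (L.seqObj e f)
  have h₃ : bimodπ (L.seqObj a b) ((bimodPar L.monoid).obj (L.seqObj c d) (L.seqObj e f)) ≫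
      ((bimodPar L.monoid).map (𝟙 (L.seqObj a b)) (L.psiHom c d e f)).hom =
        s.obj a.X b.X ◁ L.psi c d e f ≫
          L.seqπ a b ((bimodPar L.monoid).obj c e) ((bimodPar L.monoid).obj d f) :=
    (bimodπ_map _ _).trans (congrArg (· ≫ L.seqπ _ _ _ _) (id_tensorHom _ _))
  refine (cancel_epi (bimodπ ((bimodPar L.monoid).obj (L.seqObj a b) (L.seqObj c d))
    (L.seqObj e f))).1 ((cancel_epi (L.seqπ a b c d ▷ s.obj e.X f.X)).1 ?_)
  refine (congrArg (_ ≫ ·) (sq_assoc h₁ _)).trans (Eq.trans ?_ ((sq_assoc₃ h₂ _).trans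
    (congrArg (fun k => _ ≫ _ ≫ k) (sq_assoc h₃ _))).symm)
  have key : L.seqπ a b c d ▷ s.obj e.X f.X ≫ L.psi a b c d ▷ s.obj e.X f.X ≫
      L.seqπ ((bimodPar L.monoid).obj a c) ((bimodPar L.monoid).obj b d) e f ≫
        L.psi ((bimodPar L.monoid).obj a c) ((bimodPar L.monoid).obj b d) e f ≫
          s.map ((bimodPar L.monoid).assoc a c e).hom.hom
            ((bimodPar L.monoid).assoc b d f).hom.hom =
      (α_ _ _ _).hom ≫ s.obj a.X b.X ◁ L.seqπ c d e f ≫ s.obj a.X b.X ◁ L.psi c d e f ≫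
        L.seqπ a b ((bimodPar L.monoid).obj c e) ((bimodPar L.monoid).obj d f) ≫
          L.psi a b ((bimodPar L.monoid).obj c e) ((bimodPar L.monoid).obj d f) := by
    rw [seqπ_psi_assoc, seqπ_psi, inter_comp, ← comp_whiskerRight_assoc, seqπ_psi,
      ← whiskerLeft_comp_assoc, seqπ_psi]
    exact L.inter_assoc (bimodπ_assoc a c e) (bimodπ_assoc b d f)
  exact key

theorem psi_assoc_seq (a b c d e f : Bimod L.monoid L.monoid) :
    L.psi (L.seqObj a b) c (L.seqObj d e) f ≫
        s.map (L.psi a b d e) (𝟙 ((bimodPar L.monoid).obj c f).X) ≫ (s.assoc _ _ _).hom =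
      ((bimodPar L.monoid).map (L.bimodSeq.assoc a b c).hom (L.bimodSeq.assoc d e f).hom).hom ≫
        L.psi a (L.seqObj b c) d (L.seqObj e f) ≫
          s.map (𝟙 ((bimodPar L.monoid).obj a d).X) (L.psi b c e f) := by
  have h₁ : L.seqπ (L.seqObj a b) c (L.seqObj d e) f ≫
      ((bimodPar L.monoid).map (L.bimodSeq.assoc a b c).hom (L.bimodSeq.assoc d e f).hom).hom =
        ((s.assoc a.X b.X c.X).hom ⊗ₘ (s.assoc d.X e.X f.X).hom) ≫
          L.seqπ a (L.seqObj b c) d (L.seqObj e f) := bimodπ_map _ _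
  have h₂ : L.seqπ (L.seqObj a b) c (L.seqObj d e) f ≫
      L.psi (L.seqObj a b) c (L.seqObj d e) f =
        L.inter (L.seqπ a b d e) (bimodπ c f) := L.seqπ_psi _ _ _ _
  have h₃ : L.seqπ a (L.seqObj b c) d (L.seqObj e f) ≫
      L.psi a (L.seqObj b c) d (L.seqObj e f) =
        L.inter (bimodπ a d) (L.seqπ b c e f) := L.seqπ_psi _ _ _ _
  refine (cancel_epi (L.seqπ (L.seqObj a b) c (L.seqObj d e) f)).1 ?_
  refine Eq.trans ?_ (sq_assoc h₁ _).symm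
  refine (Category.assoc _ _ _).symm.trans ((congrArg (· ≫ _) h₂).trans (Eq.trans ?_
    (congrArg (_ ≫ ·) ((Category.assoc _ _ _).symm.trans (congrArg (· ≫ _) h₃)).symm)))
  have key : L.inter (L.seqπ a b d e) (bimodπ c f) ≫
      s.map (L.psi a b d e) (𝟙 ((bimodPar L.monoid).obj c f).X) ≫ (s.assoc _ _ _).hom =
    ((s.assoc a.X b.X c.X).hom ⊗ₘ (s.assoc d.X e.X f.X).hom) ≫
      L.inter (bimodπ a d) (L.seqπ b c e f) ≫
        s.map (𝟙 ((bimodPar L.monoid).obj a d).X) (L.psi b c e f) := by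
    rw [← Category.assoc, inter_comp, inter_comp, seqπ_psi, seqπ_psi, Category.comp_id,
      Category.comp_id, inter_inter_assoc]
  exact key

/-- On representatives the unitor of the relative tensor product is the left action, and the action
on `a ◁ b` is by definition `comul` followed by the interchange of the actions on `a` and `b`. -/
theorem psi_unit_left (a b : Bimod L.monoid L.monoid) :
    ((bimodPar L.monoid).map (L.bimodSeq.lam L.bimodSeq.unit).inv (𝟙 (L.seqObj a b))).hom ≫
        L.psi (bimodPar L.monoid).unit (bimodPar L.monoid).unit a b ≫
          s.map ((bimodPar L.monoid).lam a).hom.hom ((bimodPar L.monoid).lam b).hom.hom =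
      ((bimodPar L.monoid).lam (L.seqObj a b)).hom.hom := by
  have h₁ : bimodπ (bimodPar L.monoid).unit (L.seqObj a b) ≫
      ((bimodPar L.monoid).map (L.bimodSeq.lam L.bimodSeq.unit).inv (𝟙 (L.seqObj a b))).hom =
        L.comul ▷ s.obj a.X b.X ≫
          L.seqπ (bimodPar L.monoid).unit (bimodPar L.monoid).unit a b :=
    (bimodπ_map _ _).trans (congrArg (· ≫ L.seqπ _ _ _ _) (tensorHom_id _ _))
  refine (cancel_epi (bimodπ (bimodPar L.monoid).unit (L.seqObj a b))).1 ?_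
  refine (sq_assoc h₁ _).trans (Eq.trans ?_ (bimodπ_lam (L.seqObj a b)).symm)
  exact congrArg (L.comul ▷ _ ≫ ·) ((L.seqπ_psi_assoc _ _ _ _ _).trans
    ((L.inter_comp _ _ _ _).trans (congrArg₂ L.inter (bimodπ_lam a) (bimodπ_lam b))))

theorem psi_unit_right (a b : Bimod L.monoid L.monoid) :
    ((bimodPar L.monoid).map (𝟙 (L.seqObj a b)) (L.bimodSeq.lam L.bimodSeq.unit).inv).hom ≫
        L.psi a b (bimodPar L.monoid).unit (bimodPar L.monoid).unit ≫
          s.map ((bimodPar L.monoid).rho a).hom.hom ((bimodPar L.monoid).rho b).hom.hom =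
      ((bimodPar L.monoid).rho (L.seqObj a b)).hom.hom := by
  have h₁ : bimodπ (L.seqObj a b) (bimodPar L.monoid).unit ≫
      ((bimodPar L.monoid).map (𝟙 (L.seqObj a b)) (L.bimodSeq.lam L.bimodSeq.unit).inv).hom =
        s.obj a.X b.X ◁ L.comul ≫
          L.seqπ a b (bimodPar L.monoid).unit (bimodPar L.monoid).unit :=
    (bimodπ_map _ _).trans (congrArg (· ≫ L.seqπ _ _ _ _) (id_tensorHom _ _))
  refine (cancel_epi (bimodπ (L.seqObj a b) (bimodPar L.monoid).unit)).1 ?_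
  refine (sq_assoc h₁ _).trans (Eq.trans ?_ (bimodπ_rho (L.seqObj a b)).symm)
  exact congrArg (_ ◁ L.comul ≫ ·) ((L.seqπ_psi_assoc _ _ _ _ _).trans
    ((L.inter_comp _ _ _ _).trans (congrArg₂ L.inter (bimodπ_rho a) (bimodπ_rho b))))

/-- On representatives the unitor at the regular bimodule is the multiplication of `N`, so the claim
reduces to `inter_lam`. -/
theorem psi_lam (a b : Bimod L.monoid L.monoid) :
    L.psi L.bimodSeq.unit a L.bimodSeq.unit b ≫
        s.map ((bimodPar L.monoid).lam (bimodPar L.monoid).unit).hom.hom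
          (𝟙 ((bimodPar L.monoid).obj a b).X) ≫ (s.lam _).hom =
      ((bimodPar L.monoid).map (L.bimodSeq.lam a).hom (L.bimodSeq.lam b).hom).hom := by
  refine (cancel_epi (L.seqπ L.bimodSeq.unit a L.bimodSeq.unit b)).1 ?_
  have h : bimodπ L.bimodSeq.unit L.bimodSeq.unit ≫
      ((bimodPar L.monoid).lam (bimodPar L.monoid).unit).hom.hom = L.mul := bimodπ_lam _
  refine ((Category.assoc _ _ _).symm.trans (congrArg (· ≫ _) (L.seqπ_psi _ _ _ _))).trans ?_
  refine ((Category.assoc _ _ _).symm.trans (congrArg (· ≫ _) (L.inter_comp _ _ _ _))).trans ?_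
  refine (congrArg (· ≫ _) (congrArg₂ L.inter h (Category.comp_id _))).trans ?_
  exact (L.inter_lam _).trans (bimodπ_map (L.bimodSeq.lam a).hom (L.bimodSeq.lam b).hom).symm

theorem psi_rho (a b : Bimod L.monoid L.monoid) :
    L.psi a L.bimodSeq.unit b L.bimodSeq.unit ≫
        s.map (𝟙 ((bimodPar L.monoid).obj a b).X)
          ((bimodPar L.monoid).lam (bimodPar L.monoid).unit).hom.hom ≫ (s.rho _).hom =
      ((bimodPar L.monoid).map (L.bimodSeq.rho a).hom (L.bimodSeq.rho b).hom).hom := by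
  refine (cancel_epi (L.seqπ a L.bimodSeq.unit b L.bimodSeq.unit)).1 ?_
  have h : bimodπ L.bimodSeq.unit L.bimodSeq.unit ≫
      ((bimodPar L.monoid).lam (bimodPar L.monoid).unit).hom.hom = L.mul := bimodπ_lam _
  refine ((Category.assoc _ _ _).symm.trans (congrArg (· ≫ _) (L.seqπ_psi _ _ _ _))).trans ?_
  refine ((Category.assoc _ _ _).symm.trans (congrArg (· ≫ _) (L.inter_comp _ _ _ _))).trans ?_
  refine (congrArg (· ≫ _) (congrArg₂ L.inter (Category.comp_id _) h)).trans ?_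
  exact (L.inter_rho _).trans (bimodπ_map (L.bimodSeq.rho a).hom (L.bimodSeq.rho b).hom).symm

/-- The duoidal structure of bimodules over the monoid `N`, with common unit `N`. -/
noncomputable def bimod : Laxator (bimodPar L.monoid) L.bimodSeq where
  ψ P Q R S := L.psiHom P Q R S
  ψ₀ := (L.bimodSeq.lam L.bimodSeq.unit).inv
  φ₂ := ((bimodPar L.monoid).lam (bimodPar L.monoid).unit).hom
  -- Both tensors have the regular bimodule as unit. Choosing `φ₀` to be the identity gives
  -- normality, and the unit and counit laws then force `φ₂` and `ψ₀` to be a unitor and its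
  -- inverse.
  φ₀ := 𝟙 (Bimod.regular L.monoid)
  ψ_nat _ _ _ _ := Bimod.hom_ext _ _ (L.psi_natural _ _ _ _)
  ψ_assoc_par _ _ _ _ _ _ := Bimod.hom_ext _ _ (L.psi_assoc_par _ _ _ _ _ _)
  ψ_assoc_seq _ _ _ _ _ _ := Bimod.hom_ext _ _ (L.psi_assoc_seq _ _ _ _ _ _)
  ψ_unit_left _ _ := Bimod.hom_ext _ _ (L.psi_unit_left _ _)
  ψ_unit_right _ _ := Bimod.hom_ext _ _ (L.psi_unit_right _ _)
  φ_unit_left _ _ := Bimod.hom_ext _ _ (L.psi_lam _ _)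
  φ_unit_right _ _ := Bimod.hom_ext _ _ (L.psi_rho _ _)
  φ₂_assoc := (bimodPar L.monoid).lam_assoc
  φ₂_unit_left := (congrArg (· ≫ _) ((bimodPar L.monoid).map_id _ _)).trans (Category.id_comp _)
  φ₂_unit_right := (congrArg (· ≫ _) ((bimodPar L.monoid).map_id _ _)).trans
    ((Category.id_comp _).trans (bimodPar L.monoid).lam_unit)
  ψ₀_coassoc := L.bimodSeq.delta_coassoc
  ψ₀_counit_left := (congrArg (fun k => _ ≫ k ≫ _) (L.bimodSeq.map_id _ _)).trans
    ((congrArg (_ ≫ ·) (Category.id_comp _)).trans L.bimodSeq.delta_lam)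
  ψ₀_counit_right := (congrArg (fun k => _ ≫ k ≫ _) (L.bimodSeq.map_id _ _)).trans
    ((congrArg (_ ≫ ·) (Category.id_comp _)).trans L.bimodSeq.delta_rho)

end Laxator

end Produo

/-! ### Free bimodules and their universal property -/

namespace Produo

open MonoidalCategory Limits MonObj

section FreeBimod

variable {C : Type w} [Category.{v} C] [MonoidalCategory C] (R : Mon C)

/-- Multiplication of adjacent copies of a monoid on the left of an object. -/
def mulLeft (B : C) : R.X ⊗ (R.X ⊗ B) ⟶ R.X ⊗ B := (α_ R.X R.X B).inv ≫ μ ▷ B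

/-- Multiplication of adjacent copies of a monoid on the right of an object. -/
def mulRight (B : C) : (B ⊗ R.X) ⊗ R.X ⟶ B ⊗ R.X := (α_ B R.X R.X).hom ≫ B ◁ μ

theorem mulLeft_natural {B B' : C} (f : B ⟶ B') :
    R.X ◁ R.X ◁ f ≫ mulLeft R B' = mulLeft R B ≫ R.X ◁ f := by
  rw [mulLeft, mulLeft, Category.assoc, ← whisker_exchange, associator_inv_naturality_right_assoc]

theorem mulRight_natural {B B' : C} (f : B ⟶ B') :
    f ▷ R.X ▷ R.X ≫ mulRight R B' = mulRight R B ≫ f ▷ R.X := by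
  rw [mulRight, mulRight, Category.assoc, whisker_exchange, associator_naturality_left_assoc]

theorem mulLeft_mulLeft (B : C) :
    R.X ◁ mulLeft R B ≫ mulLeft R B = mulLeft R (R.X ⊗ B) ≫ mulLeft R B := by
  have h : (R.X ◁ μ ≫ μ) ▷ B = ((α_ R.X R.X R.X).inv ≫ μ ▷ R.X ≫ μ) ▷ B := by
    rw [mul_assoc, Iso.inv_hom_id_assoc]
  have h' : R.X ◁ mulLeft R B ≫ mulLeft R B =
      R.X ◁ (α_ R.X R.X B).inv ≫ (α_ R.X (R.X ⊗ R.X) B).inv ≫ (R.X ◁ μ ≫ μ) ▷ B := by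
    simp [mulLeft]
  rw [h', h, mulLeft, mulLeft]
  monoidal

theorem mulRight_mulRight (B : C) :
    mulRight R B ▷ R.X ≫ mulRight R B = mulRight R (B ⊗ R.X) ≫ mulRight R B := by
  have h : B ◁ (μ ▷ R.X ≫ μ) = B ◁ ((α_ R.X R.X R.X).hom ≫ R.X ◁ μ ≫ μ) := by
    rw [mul_assoc]
  have h' : mulRight R B ▷ R.X ≫ mulRight R B =
      (α_ B R.X R.X).hom ▷ R.X ≫ (α_ B (R.X ⊗ R.X) R.X).hom ≫ B ◁ (μ ▷ R.X ≫ μ) := by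
    simp only [mulRight, comp_whiskerRight, whisker_assoc, whiskerLeft_comp, Category.assoc,
      Iso.inv_hom_id_assoc]
  rw [h', h, mulRight, mulRight]
  monoidal

/-- The free bimodule over a monoid on an object. -/
def freeBimod (B : C) : Bimod R R where
  X := R.X ⊗ (B ⊗ R.X)
  actLeft := mulLeft R _
  actRight := (α_ _ _ _).hom ≫ R.X ◁ mulRight R B
  one_actLeft := by
    rw [mulLeft, associator_inv_naturality_left_assoc, ← comp_whiskerRight, one_mul]
    simp
  actRight_one := by
    have h : R.X ◁ B ◁ (R.X ◁ η ≫ μ) = R.X ◁ B ◁ (ρ_ _).hom := by rw [mul_one]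
    simp only [whiskerLeft_comp] at h
    simp [mulRight, h]
  left_assoc := by
    rw [mulLeft_mulLeft]
    simp [mulLeft]
  right_assoc := by
    have h : R.X ◁ (mulRight R B ▷ R.X ≫ mulRight R B) =
        R.X ◁ (mulRight R (B ⊗ R.X) ≫ mulRight R B) := by rw [mulRight_mulRight]
    have h' : (α_ R.X (B ⊗ R.X) R.X).hom ▷ R.X ≫ (R.X ◁ mulRight R B) ▷ R.X ≫
      (α_ R.X (B ⊗ R.X) R.X).hom ≫ R.X ◁ mulRight R B = (α_ R.X (B ⊗ R.X) R.X).hom ▷ R.X ≫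
        (α_ _ _ _).hom ≫ R.X ◁ (mulRight R B ▷ R.X ≫ mulRight R B) := by simp
    rw [comp_whiskerRight, Category.assoc, h', h]
    simp [mulRight]
  middle_assoc := by
    rw [whiskerLeft_comp, Category.assoc, mulLeft_natural]
    simp [mulLeft]

variable {R}

/-- The combined action `N ⊗ (P ⊗ N) ⟶ P` of a bimodule. -/
def tact (P : Bimod R R) : R.X ⊗ (P.X ⊗ R.X) ⟶ P.X := R.X ◁ P.actRight ≫ P.actLeft

theorem tact_hom {P Q : Bimod R R} (f : P ⟶ Q) :
    R.X ◁ f.hom ▷ R.X ≫ tact Q = tact P ≫ f.hom := by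
  rw [tact, tact, Category.assoc, f.left_act_hom, ← whiskerLeft_comp_assoc,
    ← whiskerLeft_comp_assoc, f.right_act_hom]

theorem mulLeft_actLeft (P : Bimod R R) :
    mulLeft R P.X ≫ P.actLeft = R.X ◁ P.actLeft ≫ P.actLeft := by
  rw [mulLeft, Category.assoc, P.left_assoc, Iso.inv_hom_id_assoc]

theorem mulRight_actRight (P : Bimod R R) :
    mulRight R P.X ≫ P.actRight = P.actRight ▷ R.X ≫ P.actRight := by
  rw [mulRight, Category.assoc, P.right_assoc, Iso.hom_inv_id_assoc]

/-- The bimodule morphism out of a free bimodule induced by a morphism. -/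
def freeLift {B : C} {P : Bimod R R} (g : B ⟶ P.X) : freeBimod R B ⟶ P where
  hom := R.X ◁ g ▷ R.X ≫ tact P
  left_act_hom := by
    change mulLeft R _ ≫ R.X ◁ g ▷ R.X ≫ R.X ◁ P.actRight ≫ P.actLeft =
      R.X ◁ (R.X ◁ g ▷ R.X ≫ R.X ◁ P.actRight ≫ P.actLeft) ≫ P.actLeft
    rw [← whiskerLeft_comp_assoc, ← Category.assoc, ← mulLeft_natural, Category.assoc,
      mulLeft_actLeft]
    simp
  right_act_hom := by
    change ((α_ _ _ _).hom ≫ R.X ◁ mulRight R B) ≫ R.X ◁ g ▷ R.X ≫ R.X ◁ P.actRight ≫ P.actLeft =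
      (R.X ◁ g ▷ R.X ≫ R.X ◁ P.actRight ≫ P.actLeft) ▷ R.X ≫ P.actRight
    have h : R.X ◁ mulRight R B ≫ R.X ◁ g ▷ R.X ≫ R.X ◁ P.actRight =
        R.X ◁ (g ▷ R.X ▷ R.X ≫ P.actRight ▷ R.X ≫ P.actRight) := by
      rw [← mulRight_actRight, ← whiskerLeft_comp, ← whiskerLeft_comp, ← Category.assoc,
        ← mulRight_natural, Category.assoc]
    have h' := congrArg ((α_ _ _ _).hom ≫ · ≫ P.actLeft) h
    simp only [Category.assoc] at h' ⊢
    rw [h']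
    simp [P.middle_assoc]

/-- The unit of the free bimodule. -/
def freeUnit (B : C) : B ⟶ R.X ⊗ (B ⊗ R.X) :=
  (ρ_ B).inv ≫ (λ_ (B ⊗ 𝟙_ C)).inv ≫ (η ⊗ₘ (B ◁ η))

theorem freeUnit_natural {B B' : C} (g : B ⟶ B') :
    g ≫ freeUnit (R := R) B' = freeUnit B ≫ R.X ◁ g ▷ R.X := by
  rw [freeUnit, freeUnit, rightUnitor_inv_naturality_assoc, leftUnitor_inv_naturality_assoc,
    MonoidalCategory.tensorHom_def', MonoidalCategory.tensorHom_def']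
  simp only [Category.assoc, ← whisker_exchange, ← whiskerLeft_comp_assoc]

theorem freeUnit_tact (P : Bimod R R) : freeUnit (R := R) P.X ≫ tact P = 𝟙 P.X := by
  have h : freeUnit (R := R) P.X ≫ tact P = (ρ_ P.X).inv ≫ (λ_ (P.X ⊗ 𝟙_ C)).inv ≫
      𝟙_ C ◁ (P.X ◁ η ≫ P.actRight) ≫ η ▷ P.X ≫ P.actLeft := by
    rw [freeUnit, tact, MonoidalCategory.tensorHom_def']
    simp only [Category.assoc, whiskerLeft_comp, whisker_exchange_assoc]
  rw [h, P.actRight_one, P.one_actLeft]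
  monoidal

theorem freeUnit_lift {B : C} {P : Bimod R R} (g : B ⟶ P.X) :
    freeUnit B ≫ (freeLift g).hom = g := by
  refine (Category.assoc _ _ _).symm.trans ((congrArg (· ≫ tact P)
    (freeUnit_natural g)).symm.trans ?_)
  rw [Category.assoc, freeUnit_tact, Category.comp_id]

/-- Puts the two-sided action on a free bimodule in the form of `merge`, so that the promonad
multiplication can be recognized as a bimodule action. -/
theorem tact_free (B : C) : tact (freeBimod R B) =
    R.X ◁ (α_ R.X (B ⊗ R.X) R.X).hom ≫ mulLeft R ((B ⊗ R.X) ⊗ R.X) ≫ R.X ◁ mulRight R B := by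
  change R.X ◁ ((α_ _ _ _).hom ≫ R.X ◁ mulRight R B) ≫ mulLeft R _ = _
  rw [whiskerLeft_comp, Category.assoc, mulLeft_natural]

theorem one_mulRight (B : C) : (B ◁ η) ▷ R.X ≫ mulRight R B =
    (α_ B (𝟙_ C) R.X).hom ≫ B ◁ (λ_ R.X).hom := by
  rw [← one_mul, mulRight, whiskerLeft_comp]
  simp only [whisker_assoc, Category.assoc, Iso.inv_hom_id_assoc]

theorem one_mulLeft (B : C) : R.X ◁ η ▷ B ≫ mulLeft R B =
    (α_ R.X (𝟙_ C) B).inv ≫ (ρ_ R.X).hom ▷ B := by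
  rw [← mul_one, mulLeft, comp_whiskerRight]
  simp only [whisker_assoc, Category.assoc, Iso.inv_hom_id_assoc]

/-- A triangle identity of the free-forgetful adjunction: the two inserted units are cancelled
against the outer copies of the monoid by its right and left unit laws. -/
theorem freeUnit_mul (B : C) :
    R.X ◁ freeUnit (R := R) B ▷ R.X ≫ R.X ◁ (α_ R.X (B ⊗ R.X) R.X).hom ≫
      mulLeft R ((B ⊗ R.X) ⊗ R.X) ≫ R.X ◁ mulRight R B = 𝟙 (R.X ⊗ (B ⊗ R.X)) := by
  have h₁ : R.X ◁ (R.X ◁ (B ◁ η[R.X])) ▷ R.X ≫ R.X ◁ (α_ R.X (B ⊗ R.X) R.X).hom ≫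
      mulLeft R ((B ⊗ R.X) ⊗ R.X) ≫ R.X ◁ mulRight R B = R.X ◁ (α_ R.X (B ⊗ 𝟙_ C) R.X).hom ≫
        mulLeft R ((B ⊗ 𝟙_ C) ⊗ R.X) ≫ R.X ◁ ((α_ B (𝟙_ C) R.X).hom ≫ B ◁ (λ_ R.X).hom) := by
    rw [← one_mulRight, ← mulLeft_natural, ← mulLeft_natural, ← whiskerLeft_comp_assoc,
      associator_naturality_middle]
    simp only [whiskerLeft_comp, Category.assoc]
  have h₂ : R.X ◁ (η[R.X] ▷ (B ⊗ 𝟙_ C)) ▷ R.X ≫ R.X ◁ (α_ R.X (B ⊗ 𝟙_ C) R.X).hom ≫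
      mulLeft R ((B ⊗ 𝟙_ C) ⊗ R.X) = R.X ◁ (α_ (𝟙_ C) (B ⊗ 𝟙_ C) R.X).hom ≫
        (α_ R.X (𝟙_ C) _).inv ≫ (ρ_ R.X).hom ▷ _ := by
    rw [← one_mulLeft, ← whiskerLeft_comp_assoc, associator_naturality_left,
      whiskerLeft_comp_assoc]
  rw [freeUnit, MonoidalCategory.tensorHom_def]
  simp only [whiskerLeft_comp, comp_whiskerRight, Category.assoc] at h₁ ⊢
  rw [h₁, sq_assoc₃ h₂]
  monoidal

theorem freeUnit_tact_free (B : C) :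
    R.X ◁ freeUnit B ▷ R.X ≫ tact (freeBimod R B) = 𝟙 (R.X ⊗ (B ⊗ R.X)) :=
  (congrArg (_ ≫ ·) (tact_free B)).trans (freeUnit_mul B)

/-- Linearity of `f` pulls it out of the action, leaving the triangle identity on the free bimodule.
With `freeUnit_lift` this is the universal property of `freeBimod R B`. -/
theorem freeLift_unit {B : C} {P : Bimod R R} (f : freeBimod R B ⟶ P) :
    freeLift (freeUnit B ≫ f.hom) = f := by
  refine Bimod.hom_ext _ _ ?_
  have h : R.X ◁ (freeUnit B ≫ f.hom) ▷ R.X = R.X ◁ freeUnit B ▷ R.X ≫ R.X ◁ f.hom ▷ R.X :=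
    (congrArg (R.X ◁ ·) (comp_whiskerRight _ _ _)).trans (whiskerLeft_comp _ _ _)
  refine (congrArg (· ≫ tact P) h).trans ((Category.assoc _ _ _).trans
    ((congrArg (_ ≫ ·) (tact_hom f)).trans ((Category.assoc _ _ _).symm.trans ?_)))
  exact (congrArg (· ≫ f.hom) (freeUnit_tact_free B)).trans (Category.id_comp _)

end FreeBimod

end Produo

/-! ### A split coequalizer for tensoring with a free bimodule -/

namespace Produo

open MonoidalCategory Limits MonObj

section FreeTensor

variable {C : Type w} [Category.{v} C] [MonoidalCategory C] {R : Mon C}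

/-- The map `(N ⊗ (B ⊗ N)) ⊗ Q ⟶ N ⊗ (B ⊗ Q)` induced by an action of `N`. -/
def absorb (B : C) {Q : C} (l : R.X ⊗ Q ⟶ Q) : (R.X ⊗ (B ⊗ R.X)) ⊗ Q ⟶ R.X ⊗ (B ⊗ Q) :=
  (α_ _ _ _).hom ≫ R.X ◁ ((α_ _ _ _).hom ≫ B ◁ l)

theorem absorb_mulLeft (B : C) {Q : C} (l : R.X ⊗ Q ⟶ Q) :
    mulLeft R (B ⊗ R.X) ▷ Q ≫ absorb B l = (α_ _ _ _).hom ≫ R.X ◁ absorb B l ≫ mulLeft R _ := by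
  have h : R.X ◁ absorb B l ≫ mulLeft R (B ⊗ Q) = R.X ◁ (α_ R.X (B ⊗ R.X) Q).hom ≫
      R.X ◁ R.X ◁ ((α_ B R.X Q).hom ≫ B ◁ l) ≫ mulLeft R (B ⊗ Q) := by
    rw [absorb, whiskerLeft_comp, Category.assoc]
  rw [h, mulLeft_natural, absorb, mulLeft, mulLeft]
  monoidal

theorem absorb_linear (B : C) {Q Q' : C} {l : R.X ⊗ Q ⟶ Q} {l' : R.X ⊗ Q' ⟶ Q'} (f : Q ⟶ Q')
    (hf : l ≫ f = R.X ◁ f ≫ l') :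
    (R.X ⊗ (B ⊗ R.X)) ◁ f ≫ absorb B l' = absorb B l ≫ R.X ◁ B ◁ f := by
  have h : absorb B l ≫ R.X ◁ B ◁ f = (α_ _ _ _).hom ≫ R.X ◁ ((α_ _ _ _).hom ≫ B ◁ (l ≫ f)) := by
    rw [absorb]
    monoidal
  rw [h, hf, absorb]
  monoidal

/-- Multiplying the middle copy of the monoid into the free factor and then acting is the same as
acting twice, by associativity of `l`. -/
theorem absorb_balanced (B : C) {Q : C} (l : R.X ⊗ Q ⟶ Q)
    (hl : μ ▷ Q ≫ l = (α_ R.X R.X Q).hom ≫ R.X ◁ l ≫ l) :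
    ((α_ _ _ _).hom ≫ R.X ◁ mulRight R B) ▷ Q ≫ absorb B l =
      (α_ _ _ _).hom ≫ (R.X ⊗ (B ⊗ R.X)) ◁ l ≫ absorb B l := by
  have h : ((α_ _ _ _).hom ≫ R.X ◁ mulRight R B) ▷ Q ≫ absorb B l =
      (α_ _ _ _).hom ▷ Q ≫ (α_ _ _ _).hom ≫ R.X ◁ ((α_ _ _ _).hom ▷ Q ≫ (α_ _ _ _).hom ≫
        B ◁ (μ ▷ Q ≫ l)) := by
    rw [absorb, mulRight]
    monoidal
  rw [h, hl, absorb]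
  monoidal

/-- The free extension of `q` produces new copies of the monoid on both sides. The left one is
multiplied outwards by `absorb_mulLeft`; the right one is passed on to `Q` by `absorb_balanced`. -/
theorem absorb_natural {B B' Q : C} (q : B ⟶ R.X ⊗ (B' ⊗ R.X)) (l : R.X ⊗ Q ⟶ Q)
    (hl : μ ▷ Q ≫ l = (α_ R.X R.X Q).hom ≫ R.X ◁ l ≫ l) :
    (R.X ◁ q ▷ R.X ≫ R.X ◁ ((α_ _ _ _).hom ≫ R.X ◁ mulRight R B') ≫ mulLeft R _) ▷ Q ≫
        absorb B' l =
      absorb B l ≫ R.X ◁ (q ▷ Q ≫ absorb B' l) ≫ mulLeft R _ := by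
  have h : (R.X ◁ q ▷ R.X ≫ R.X ◁ ((α_ _ _ _).hom ≫ R.X ◁ mulRight R B') ≫ mulLeft R _) ▷ Q ≫
      absorb B' l = (α_ _ _ _).hom ≫ R.X ◁ (q ▷ R.X ▷ Q ≫
        ((α_ _ _ _).hom ≫ R.X ◁ mulRight R B') ▷ Q ≫ absorb B' l) ≫ mulLeft R _ := by
    rw [comp_whiskerRight, comp_whiskerRight, Category.assoc, Category.assoc, absorb_mulLeft]
    monoidal
  rw [h, absorb_balanced _ _ hl, associator_naturality_left_assoc, ← whisker_exchange_assoc]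
  simp [absorb]

/-- Insertion of a unit between two factors. -/
def insertUnit (B Q : C) : R.X ⊗ (B ⊗ Q) ⟶ (R.X ⊗ (B ⊗ R.X)) ⊗ Q :=
  R.X ◁ (B ◁ ((λ_ Q).inv ≫ η ▷ Q) ≫ (α_ _ _ _).inv) ≫ (α_ _ _ _).inv

theorem insertUnit_absorb (B : C) {Q : C} (l : R.X ⊗ Q ⟶ Q) (hl : η ▷ Q ≫ l = (λ_ Q).hom) :
    insertUnit B Q ≫ absorb B l = 𝟙 _ := by
  have h : insertUnit B Q ≫ absorb B l = R.X ◁ B ◁ ((λ_ Q).inv ≫ η ▷ Q ≫ l) := by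
    rw [insertUnit, absorb]
    monoidal
  rw [h, hl, Iso.inv_hom_id, whiskerLeft_id, whiskerLeft_id]

/-- The second half of a splitting. The map `insertUnit B R.X ▷ Q` gives the identity when followed
by the right action on the free factor (`insertUnit_mulRight`), and gives `absorb B l ≫ insertUnit B
Q` when followed by `l`. With `insertUnit_absorb` and `absorb_balanced`, this makes `absorb B l` a
split coequalizer of the two middle actions for any unital, associative `l`. -/
theorem absorb_insertUnit (B : C) {Q : C} (l : R.X ⊗ Q ⟶ Q) :
    absorb B l ≫ insertUnit B Q =
      insertUnit B R.X ▷ Q ≫ (α_ _ _ _).hom ≫ (R.X ⊗ (B ⊗ R.X)) ◁ l := by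
  have h : absorb B l ≫ insertUnit B Q = (α_ _ _ _).hom ≫ R.X ◁ (α_ _ _ _).hom ≫
      R.X ◁ B ◁ ((λ_ _).inv ≫ 𝟙_ C ◁ l ≫ η ▷ Q) ≫ R.X ◁ (α_ _ _ _).inv ≫ (α_ _ _ _).inv := by
    rw [← leftUnitor_inv_naturality_assoc, absorb, insertUnit]
    monoidal
  rw [h, whisker_exchange, insertUnit]
  monoidal

/-- The balanced map `(N ⊗ (B ⊗ N)) ⊗ (N ⊗ (D ⊗ N)) ⟶ N ⊗ ((B ⊗ (N ⊗ D)) ⊗ N)`. -/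
def fuse (B D : C) : (R.X ⊗ (B ⊗ R.X)) ⊗ (R.X ⊗ (D ⊗ R.X)) ⟶ R.X ⊗ ((B ⊗ (R.X ⊗ D)) ⊗ R.X) :=
  absorb B (mulLeft R (D ⊗ R.X)) ≫ R.X ◁ (B ◁ (α_ _ _ _).inv ≫ (α_ _ _ _).inv)

theorem fuse_mulRight (B D : C) :
    fuse B D ▷ R.X ≫ (α_ _ _ _).hom ≫ R.X ◁ mulRight R (B ⊗ (R.X ⊗ D)) =
      (α_ _ _ _).hom ≫ (R.X ⊗ (B ⊗ R.X)) ◁ ((α_ _ _ _).hom ≫ R.X ◁ mulRight R D) ≫ fuse B D := by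
  have h : (R.X ⊗ (B ⊗ R.X)) ◁ ((α_ _ _ _).hom ≫ R.X ◁ mulRight R D) ≫ fuse B D =
      (R.X ⊗ (B ⊗ R.X)) ◁ (α_ _ _ _).hom ≫ (α_ _ _ _).hom ≫ R.X ◁ ((α_ _ _ _).hom ≫
        B ◁ (R.X ◁ R.X ◁ mulRight R D ≫ mulLeft R (D ⊗ R.X))) ≫
          R.X ◁ (B ◁ (α_ _ _ _).inv ≫ (α_ _ _ _).inv) := by
    rw [fuse, absorb]
    monoidal
  rw [h, mulLeft_natural, fuse, absorb, mulLeft, mulLeft, mulRight, mulRight]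
  monoidal

theorem fuse_mulLeft (B D : C) : mulLeft R (B ⊗ R.X) ▷ _ ≫ fuse B D =
    (α_ _ _ _).hom ≫ R.X ◁ fuse B D ≫ mulLeft R _ := by
  have h := mulLeft_natural R (B ◁ (α_ R.X D R.X).inv ≫ (α_ B (R.X ⊗ D) R.X).inv)
  rw [fuse, ← Category.assoc, absorb_mulLeft, Category.assoc, Category.assoc, ← h]
  simp only [whiskerLeft_comp, Category.assoc]

/-- Transports the free extension of `q` in the left factor across `fuse`. The right side has the
form of `normParMapLeft`. -/
theorem fuse_left {B B' : C} (D : C) (q : B ⟶ R.X ⊗ (B' ⊗ R.X)) :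
    (R.X ◁ q ▷ R.X ≫ R.X ◁ ((α_ _ _ _).hom ≫ R.X ◁ mulRight R B') ≫ mulLeft R _) ▷ _ ≫
        fuse B' D =
      fuse B D ≫ R.X ◁ (q ▷ (R.X ⊗ D) ≫ (α_ R.X (B' ⊗ R.X) (R.X ⊗ D)).hom ≫
        R.X ◁ ((α_ B' R.X (R.X ⊗ D)).hom ≫ B' ◁ mulLeft R D)) ▷ R.X ≫
          R.X ◁ (α_ R.X (B' ⊗ (R.X ⊗ D)) R.X).hom ≫ mulLeft R ((B' ⊗ (R.X ⊗ D)) ⊗ R.X) := by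
  have hl : μ ▷ (R.X ⊗ (D ⊗ R.X)) ≫ mulLeft R (D ⊗ R.X) = (α_ R.X R.X _).hom ≫
      R.X ◁ mulLeft R (D ⊗ R.X) ≫ mulLeft R (D ⊗ R.X) := by
    rw [mulLeft_mulLeft]
    simp [mulLeft]
  have h := absorb_natural q _ hl
  rw [fuse, ← Category.assoc, h, Category.assoc, Category.assoc, ← mulLeft_natural, fuse,
    Category.assoc]
  congr 1
  rw [absorb]
  simp only [← Category.assoc]
  congr 1
  rw [mulLeft, mulLeft]
  monoidal

/-- The free extension of `q` is left linear, so `absorb_linear` carries it past `absorb`. The right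
side has the form of `normParMapRight`. -/
theorem fuse_right (B : C) {D D' : C} (q : D ⟶ R.X ⊗ (D' ⊗ R.X)) :
    (R.X ⊗ (B ⊗ R.X)) ◁ (R.X ◁ q ▷ R.X ≫ R.X ◁ ((α_ _ _ _).hom ≫ R.X ◁ mulRight R D') ≫
        mulLeft R _) ≫ fuse B D' =
      fuse B D ≫ R.X ◁ (B ◁ (R.X ◁ q ≫ mulLeft R (D' ⊗ R.X) ≫ (α_ R.X D' R.X).inv) ≫
        (α_ B (R.X ⊗ D') R.X).inv) ▷ R.X ≫ R.X ◁ mulRight R (B ⊗ (R.X ⊗ D')) := by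
  have hf : mulLeft R (D ⊗ R.X) ≫ (R.X ◁ q ▷ R.X ≫ R.X ◁ ((α_ _ _ _).hom ≫
      R.X ◁ mulRight R D') ≫ mulLeft R _) = R.X ◁ (R.X ◁ q ▷ R.X ≫ R.X ◁ ((α_ _ _ _).hom ≫
        R.X ◁ mulRight R D') ≫ mulLeft R _) ≫ mulLeft R (D' ⊗ R.X) :=
    (freeLift (P := freeBimod R D') q).left_act_hom
  have h := absorb_linear B _ hf
  have h' : R.X ◁ (R.X ◁ mulRight R D') ≫ mulLeft R (D' ⊗ R.X) = _ := mulLeft_natural _ _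
  rw [fuse, sq_assoc h, fuse, whiskerLeft_comp R.X (α_ _ _ _).hom, Category.assoc, h',
    Category.assoc]
  congr 1
  rw [mulLeft, mulLeft, mulRight, mulRight]
  monoidal

end FreeTensor

end Produo

/-! ### The tensor product of two free bimodules is free -/

namespace Produo

open MonoidalCategory Limits MonObj

section FreeFuse

variable {C : Type w} [Category.{v} C] [MonoidalCategory C] {R : Mon C}

/-- The left action of a Kleisli morphism on `N ⊗ B ⊗ N ⊗ D ⊗ N`. -/
def freeParLeft {B B' : C} (D : C) (q : B ⟶ R.X ⊗ (B' ⊗ R.X)) :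
    R.X ⊗ ((B ⊗ (R.X ⊗ D)) ⊗ R.X) ⟶ R.X ⊗ ((B' ⊗ (R.X ⊗ D)) ⊗ R.X) :=
  R.X ◁ (q ▷ (R.X ⊗ D) ≫ (α_ R.X (B' ⊗ R.X) (R.X ⊗ D)).hom ≫
    R.X ◁ ((α_ B' R.X (R.X ⊗ D)).hom ≫ B' ◁ mulLeft R D)) ▷ R.X ≫
      R.X ◁ (α_ R.X (B' ⊗ (R.X ⊗ D)) R.X).hom ≫ mulLeft R ((B' ⊗ (R.X ⊗ D)) ⊗ R.X)

/-- The right action of a Kleisli morphism on `N ⊗ B ⊗ N ⊗ D ⊗ N`. -/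
def freeParRight (B : C) {D D' : C} (q : D ⟶ R.X ⊗ (D' ⊗ R.X)) :
    R.X ⊗ ((B ⊗ (R.X ⊗ D)) ⊗ R.X) ⟶ R.X ⊗ ((B ⊗ (R.X ⊗ D')) ⊗ R.X) :=
  R.X ◁ (B ◁ (R.X ◁ q ≫ mulLeft R (D' ⊗ R.X) ≫ (α_ R.X D' R.X).inv) ≫
    (α_ B (R.X ⊗ D') R.X).inv) ▷ R.X ≫ R.X ◁ mulRight R (B ⊗ (R.X ⊗ D'))

theorem fuse_map {B B' D D' : C} (q : B ⟶ R.X ⊗ (B' ⊗ R.X)) (r : D ⟶ R.X ⊗ (D' ⊗ R.X)) :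
    ((freeLift (P := freeBimod R B') q).hom ⊗ₘ (freeLift (P := freeBimod R D') r).hom) ≫
      fuse B' D' = fuse B D ≫ freeParLeft D q ≫ freeParRight B' r := by
  have h₁ : (freeLift (P := freeBimod R B') q).hom ▷ (R.X ⊗ (D ⊗ R.X)) ≫ fuse B' D =
      fuse B D ≫ freeParLeft D q := fuse_left D q
  have h₂ : (R.X ⊗ (B' ⊗ R.X)) ◁ (freeLift (P := freeBimod R D') r).hom ≫ fuse B' D' =
      fuse B' D ≫ freeParRight B' r := fuse_right B' r
  refine (congrArg (· ≫ _) (MonoidalCategory.tensorHom_def _ _)).trans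
    ((Category.assoc _ _ _).trans ((congrArg (_ ≫ ·) h₂).trans (sq_assoc h₁ _)))

theorem insertUnit_mulRight (B : C) :
    insertUnit B R.X ≫ (α_ _ _ _).hom ≫ R.X ◁ mulRight R B = 𝟙 (R.X ⊗ (B ⊗ R.X)) := by
  have h := insertUnit_absorb (R := R) B μ (one_mul R.X)
  rw [← h, absorb, mulRight]

/-- The underlying morphism of the inverse of `freeFuse`, before passing to the quotient. -/
def fuseInv (B D : C) :
    R.X ⊗ ((B ⊗ (R.X ⊗ D)) ⊗ R.X) ⟶ (R.X ⊗ (B ⊗ R.X)) ⊗ (R.X ⊗ (D ⊗ R.X)) :=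
  R.X ◁ ((α_ _ _ _).hom ≫ B ◁ (α_ _ _ _).hom) ≫ insertUnit B (R.X ⊗ (D ⊗ R.X))

theorem fuseInv_fuse (B D : C) : fuseInv (R := R) B D ≫ fuse B D = 𝟙 _ := by
  have hl : η ▷ (R.X ⊗ (D ⊗ R.X)) ≫ mulLeft R (D ⊗ R.X) = (λ_ _).hom :=
    (freeBimod R D).one_actLeft
  have h := insertUnit_absorb B _ hl
  rw [fuseInv, fuse, Category.assoc, ← Category.assoc (insertUnit _ _), h, Category.id_comp,
    ← whiskerLeft_comp]
  simp

theorem fuse_fuseInv (B D : C) : fuse (R := R) B D ≫ fuseInv B D =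
    insertUnit B R.X ▷ _ ≫ (α_ _ _ _).hom ≫ (R.X ⊗ (B ⊗ R.X)) ◁ mulLeft R (D ⊗ R.X) := by
  have h : R.X ◁ (B ◁ (α_ R.X D R.X).inv ≫ (α_ B (R.X ⊗ D) R.X).inv) ≫
      R.X ◁ ((α_ _ _ _).hom ≫ B ◁ (α_ _ _ _).hom) = 𝟙 _ := by
    simp [← whiskerLeft_comp]
  rw [← absorb_insertUnit, fuse, fuseInv, Category.assoc, ← Category.assoc (R.X ◁ _), h,
    Category.id_comp]

variable [HasCoequalizers C]
  [∀ X : C, PreservesColimitsOfSize.{0, 0} (tensorLeft X)]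
  [∀ X : C, PreservesColimitsOfSize.{0, 0} (tensorRight X)]

variable (R) in
/-- The universal balanced map for a tensor of free bimodules. -/
noncomputable def freeπ (B D : C) : (R.X ⊗ (B ⊗ R.X)) ⊗ (R.X ⊗ (D ⊗ R.X)) ⟶
    ((bimodPar R).obj (freeBimod R B) (freeBimod R D)).X :=
  bimodπ (freeBimod R B) (freeBimod R D)

instance (B D : C) : Epi (freeπ R B D) :=
  inferInstanceAs (Epi (bimodπ (freeBimod R B) (freeBimod R D)))

instance (B D Z : C) : Epi (freeπ R B D ▷ Z) :=
  inferInstanceAs (Epi (bimodπ (freeBimod R B) (freeBimod R D) ▷ Z))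

instance (B D Z : C) : Epi (Z ◁ freeπ R B D) :=
  inferInstanceAs (Epi (Z ◁ bimodπ (freeBimod R B) (freeBimod R D)))

theorem freeπ_condition (B D : C) :
    ((α_ _ _ _).hom ≫ R.X ◁ mulRight R B) ▷ (R.X ⊗ (D ⊗ R.X)) ≫ freeπ R B D =
      (α_ _ _ _).hom ≫ (R.X ⊗ (B ⊗ R.X)) ◁ mulLeft R (D ⊗ R.X) ≫ freeπ R B D :=
  bimodπ_condition (freeBimod R B) (freeBimod R D)

/-- The underlying morphism of `freeFuse`. -/
noncomputable def fuseDesc (B D : C) : ((bimodPar R).obj (freeBimod R B) (freeBimod R D)).X ⟶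
    R.X ⊗ ((B ⊗ (R.X ⊗ D)) ⊗ R.X) :=
  bimodDesc (P := freeBimod R B) (Q := freeBimod R D) (fuse B D) (by
    have h := absorb_balanced B _ (freeBimod R D).left_assoc
    exact (sq_assoc h _).trans (congrArg (_ ≫ ·) (Category.assoc _ _ _)))

theorem freeπ_fuseDesc (B D : C) : freeπ R B D ≫ fuseDesc B D = fuse B D :=
  bimodπ_desc (P := freeBimod R B) (Q := freeBimod R D) _ _

variable (R) in
/-- The tensor of free bimodules is free. -/
noncomputable def freeFuse (B D : C) : (bimodPar R).obj (freeBimod R B) (freeBimod R D) ≅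
    freeBimod R (B ⊗ (R.X ⊗ D)) :=
  Bimod.isoOfIso
    { hom := fuseDesc B D
      inv := fuseInv B D ≫ freeπ R B D
      hom_inv_id := by
        -- On representatives the composite inserts a unit in the middle and lets the new copy of
        -- the monoid act on the right factor. In the quotient it may act on the left factor
        -- instead, where it multiplies away.
        have h : fuseDesc B D ≫ fuseInv B D ≫ freeπ R B D = 𝟙 _ := by
          rw [← cancel_epi (freeπ R B D), ← Category.assoc, freeπ_fuseDesc, ← Category.assoc,
            fuse_fuseInv, Category.assoc, Category.assoc, ← freeπ_condition,
            ← comp_whiskerRight_assoc, insertUnit_mulRight, id_whiskerRight, Category.id_comp,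
            Category.comp_id]
        exact h
      inv_hom_id := by
        have h : (fuseInv B D ≫ freeπ R B D) ≫ fuseDesc B D = 𝟙 _ := by
          rw [Category.assoc, freeπ_fuseDesc, fuseInv_fuse]
        exact h }
    (by
      have h₁ : R.X ◁ freeπ R B D ≫
          ((bimodPar R).obj (freeBimod R B) (freeBimod R D)).actLeft =
            (α_ _ _ _).inv ≫ mulLeft R (B ⊗ R.X) ▷ _ ≫ freeπ R B D := bimodπ_actLeft _ _
      have h : ((bimodPar R).obj (freeBimod R B) (freeBimod R D)).actLeft ≫ fuseDesc B D =
          R.X ◁ fuseDesc B D ≫ mulLeft R _ := by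
        rw [← cancel_epi (R.X ◁ freeπ R B D), ← Category.assoc, h₁, Category.assoc,
          Category.assoc, freeπ_fuseDesc, fuse_mulLeft, Iso.inv_hom_id_assoc,
          ← whiskerLeft_comp_assoc, freeπ_fuseDesc]
      exact h)
    (by
      have h₁ : freeπ R B D ▷ R.X ≫
          ((bimodPar R).obj (freeBimod R B) (freeBimod R D)).actRight =
            (α_ _ _ _).hom ≫ (R.X ⊗ (B ⊗ R.X)) ◁ ((α_ _ _ _).hom ≫ R.X ◁ mulRight R D) ≫
              freeπ R B D := bimodπ_actRight _ _
      have h : ((bimodPar R).obj (freeBimod R B) (freeBimod R D)).actRight ≫ fuseDesc B D =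
          fuseDesc B D ▷ R.X ≫ (α_ _ _ _).hom ≫ R.X ◁ mulRight R _ := by
        rw [← cancel_epi (freeπ R B D ▷ R.X), ← Category.assoc, h₁, Category.assoc,
          Category.assoc, freeπ_fuseDesc, ← fuse_mulRight,
          ← comp_whiskerRight_assoc, freeπ_fuseDesc]
      exact h)

theorem freeFuse_map {B B' D D' : C} (q : B ⟶ R.X ⊗ (B' ⊗ R.X)) (r : D ⟶ R.X ⊗ (D' ⊗ R.X)) :
    ((bimodPar R).map (freeLift (P := freeBimod R B') q)
      (freeLift (P := freeBimod R D') r)).hom ≫ fuseDesc B' D' =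
        fuseDesc B D ≫ freeParLeft D q ≫ freeParRight B' r := by
  have h : freeπ R B D ≫ ((bimodPar R).map (freeLift (P := freeBimod R B') q)
      (freeLift (P := freeBimod R D') r)).hom =
        ((freeLift (P := freeBimod R B') q).hom ⊗ₘ (freeLift (P := freeBimod R D') r).hom) ≫
          freeπ R B' D' := bimodπ_map _ _
  refine (cancel_epi (freeπ R B D)).1 ((sq_assoc h _).trans
    ((congrArg (_ ≫ ·) (freeπ_fuseDesc B' D')).trans ((fuse_map q r).trans ?_)))
  rw [← freeπ_fuseDesc, Category.assoc]

end FreeFuse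

end Produo

/-! ### Day convolution preserves colimits in each variable -/

namespace Produo

open MonoidalCategory Limits

section Density

variable {V : Type u} [SmallCategory V] {E : Type w} [Category.{u} E]

/-- The transpose of a morphism out of the value of a functor on presheaves. -/
def transpose (F : (Vᵒᵖ ⥤ Type u) ⥤ E) {Q : Vᵒᵖ ⥤ Type u} {R : E} (k : F.obj Q ⟶ R) :
    Q ⟶ (yoneda ⋙ F).op ⋙ yoneda.obj R where
  app Y := ↾ (fun q => F.map ((yonedaEquiv (X := Y.unop)).symm q) ≫ k)
  naturality Y Y' f := by
    refine ConcreteCategory.hom_ext _ _ fun q => ?_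
    change F.map ((yonedaEquiv (X := Y'.unop)).symm (Q.map f q)) ≫ k =
      F.map (yoneda.map f.unop) ≫ F.map ((yonedaEquiv (X := Y.unop)).symm q) ≫ k
    rw [← Category.assoc, ← F.map_comp, yonedaEquiv_symm_naturality_left]
    rfl

/-- A functor on presheaves whose values are determined by representables is a left adjoint. -/
theorem isLeftAdjoint_of_dense (F : (Vᵒᵖ ⥤ Type u) ⥤ E)
    (h : ∀ (Q : Vᵒᵖ ⥤ Type u) (R : E) (g : ∀ Y : V, Q.obj (op Y) → (F.obj (yoneda.obj Y) ⟶ R)),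
      (∀ {Y Y' : V} (f : Y ⟶ Y') (q : Q.obj (op Y')),
        F.map (yoneda.map f) ≫ g Y' q = g Y (Q.map f.op q)) →
      ∃! k : F.obj Q ⟶ R, ∀ Y q, F.map (yonedaEquiv.symm q) ≫ k = g Y q) :
    F.IsLeftAdjoint := by
  -- The hypothesis says that a natural family indexed by the elements of `Q` comes from a unique
  -- morphism. This is bijectivity of the transposition, so the right adjoint sends `R` to `Y ↦ (F
  -- (yoneda Y) ⟶ R)`.
  have he (Q : Vᵒᵖ ⥤ Type u) (R : E) :
      Function.Bijective (transpose F (Q := Q) (R := R)) := by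
    refine (Function.bijective_iff_existsUnique _).2 fun g => ?_
    obtain ⟨k, hk, hk'⟩ := h Q R (fun Y q => g.app (op Y) q) (by
      intro Y Y' f q
      exact (NatTrans.naturality_apply g f.op q).symm)
    refine ⟨k, ?_, fun k' hk₁ => hk' k' fun Y q => ?_⟩
    · ext Y q
      exact hk Y.unop q
    · subst hk₁
      rfl
  exact (Adjunction.adjunctionOfEquivRight (F := F)
    (fun Q R => Equiv.ofBijective (transpose F) (he Q R)) (by
      intro Q' Q R f k
      ext Y q
      change F.map ((yonedaEquiv (X := Y.unop)).symm q) ≫ F.map f ≫ k =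
        F.map ((yonedaEquiv (X := Y.unop)).symm (f.app Y q)) ≫ k
      rw [← Category.assoc, ← F.map_comp]
      congr 2
      exact yonedaEquiv_symm_naturality_right _ _ _)).isLeftAdjoint

end Density

section Day

variable {V : Type u} [SmallCategory V]

/-- The category of presheaves, with the monoidal structure given by Day convolution. -/
def DayPsh (_ : Promonoidal V) : Type (u + 1) := Vᵒᵖ ⥤ Type u

variable (M : Promonoidal V)

instance : Category.{u} (DayPsh M) := inferInstanceAs (Category.{u} (Vᵒᵖ ⥤ Type u))

instance : MonoidalCategory (DayPsh M) := M.day.monoidal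

instance : HasCoequalizers (DayPsh M) := inferInstanceAs (HasCoequalizers (Vᵒᵖ ⥤ Type u))

/-- Tensoring with a presheaf on the left. -/
def tensL (P : Vᵒᵖ ⥤ Type u) : (Vᵒᵖ ⥤ Type u) ⥤ (Vᵒᵖ ⥤ Type u) where
  obj Q := M.tens P Q
  map f := M.tensMap (𝟙 P) f
  map_id _ := convMap_id _ _ _
  map_comp f g := (convMap_comp M.tensor (𝟙 P) (𝟙 P) f g).symm

/-- Tensoring with a presheaf on the right. -/
def tensR (P : Vᵒᵖ ⥤ Type u) : (Vᵒᵖ ⥤ Type u) ⥤ (Vᵒᵖ ⥤ Type u) where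
  obj Q := M.tens Q P
  map f := M.tensMap f (𝟙 P)
  map_id _ := convMap_id _ _ _
  map_comp f g := (convMap_comp M.tensor f g (𝟙 P) (𝟙 P)).symm

theorem plug_eq_yoneda_left (T : Profunctor.{u} (V × V) V) {P Q : Vᵒᵖ ⥤ Type u} {X Y : V}
    (p : P.obj (op X)) (q : Q.obj (op Y)) :
    plug T (P := yoneda.obj X) (𝟙 X) q ≫ convMap T (yonedaEquiv.symm p) (𝟙 Q) = plug T p q := by
  rw [plug_convMap]
  congr 1
  exact map_id_op P X p

theorem plug_eq_yoneda_right (T : Profunctor.{u} (V × V) V) {P Q : Vᵒᵖ ⥤ Type u} {X Y : V}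
    (p : P.obj (op X)) (q : Q.obj (op Y)) :
    plug T (Q := yoneda.obj Y) p (𝟙 Y) ≫ convMap T (𝟙 P) (yonedaEquiv.symm q) = plug T p q := by
  rw [plug_convMap]
  congr 1
  exact map_id_op Q Y q

theorem map_plug_right (T : Profunctor.{u} (V × V) V) {P : Vᵒᵖ ⥤ Type u} {X X' Y Y' : V}
    (f : X ⟶ X') (g : Y ⟶ Y') (p : P.obj (op X')) :
    T.map (f ×ₘ g) ≫ plug T (Q := yoneda.obj Y') p (𝟙 Y') =
      plug T (Q := yoneda.obj Y) (P.map f.op p) (𝟙 Y) ≫ convMap T (𝟙 P) (yoneda.map g) := by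
  rw [plug_dinatural, plug_convMap]
  exact congrArg (plug T (P.map f.op p)) ((Category.comp_id g).trans (Category.id_comp g).symm)

theorem map_plug_left (T : Profunctor.{u} (V × V) V) {P : Vᵒᵖ ⥤ Type u} {X X' Y Y' : V}
    (f : X ⟶ X') (g : Y ⟶ Y') (p : P.obj (op Y')) :
    T.map (f ×ₘ g) ≫ plug T (P := yoneda.obj X') (𝟙 X') p =
      plug T (P := yoneda.obj X) (𝟙 X) (P.map g.op p) ≫ convMap T (yoneda.map f) (𝟙 P) := by
  rw [plug_dinatural, plug_convMap]
  exact congrArg (plug T · (P.map g.op p)) ((Category.comp_id f).trans (Category.id_comp f).symm)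

/-- The class of `(t, p, q)` is the image of the class of `(t, p, 𝟙)` under the map of
representables into `Q` classified by `q`. Compatible maps out of `P ⊗ yoneda Y` therefore glue in
exactly one way. The preservation of coequalizers required for relative tensor products follows. -/
theorem isLeftAdjoint_tensL (P : Vᵒᵖ ⥤ Type u) : (tensL M P).IsLeftAdjoint := by
  refine isLeftAdjoint_of_dense _ fun Q R g hg => ?_
  refine ⟨comp.desc (fun b y => plug M.tensor (Q := yoneda.obj b.2) y.1 (𝟙 b.2) ≫ g b.2 y.2)
    fun {b b'} f y => ?_, fun Y q => ?_, fun k hk => ?_⟩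
  · have h := congrArg (· ≫ g b'.2 y.2) (map_plug_right M.tensor f.1 f.2 (Prod.fst y))
    refine (Category.assoc _ _ _).symm.trans (h.trans ((Category.assoc _ _ _).trans ?_))
    exact congrArg (_ ≫ ·) (hg f.2 y.2)
  · refine PromonoidalData.conv_hom_ext fun X Z p z => ?_
    change plug M.tensor (Q := yoneda.obj Z) p (𝟙 Z) ≫ g Z (Q.map z.op q) = _
    refine (congrArg (_ ≫ ·) (hg z q).symm).trans ((Category.assoc _ _ _).symm.trans ?_)
    refine congrArg (· ≫ g Y q) ((plug_convMap _ _ _ _ _).trans ?_)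
    exact congrArg (plug M.tensor p) (Category.id_comp z)
  · refine PromonoidalData.conv_hom_ext fun X Y p q => ?_
    change _ = plug M.tensor (Q := yoneda.obj Y) p (𝟙 Y) ≫ g Y q
    exact (congrArg (· ≫ k) (plug_eq_yoneda_right M.tensor p q).symm).trans
      ((Category.assoc _ _ _).trans (congrArg (_ ≫ ·) (hk Y q)))

theorem isLeftAdjoint_tensR (P : Vᵒᵖ ⥤ Type u) : (tensR M P).IsLeftAdjoint := by
  refine isLeftAdjoint_of_dense _ fun Q R g hg => ?_
  refine ⟨comp.desc (fun b y => plug M.tensor (P := yoneda.obj b.1) (𝟙 b.1) y.2 ≫ g b.1 y.1)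
    fun {b b'} f y => ?_, fun Y q => ?_, fun k hk => ?_⟩
  · have h := congrArg (· ≫ g b'.1 y.1) (map_plug_left M.tensor f.1 f.2 (Prod.snd y))
    refine (Category.assoc _ _ _).symm.trans (h.trans ((Category.assoc _ _ _).trans ?_))
    exact congrArg (_ ≫ ·) (hg f.1 y.1)
  · refine PromonoidalData.conv_hom_ext fun Z X z p => ?_
    change plug M.tensor (P := yoneda.obj Z) (𝟙 Z) p ≫ g Z (Q.map z.op q) = _
    refine (congrArg (_ ≫ ·) (hg z q).symm).trans ((Category.assoc _ _ _).symm.trans ?_)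
    refine congrArg (· ≫ g Y q) ((plug_convMap _ _ _ _ _).trans ?_)
    exact congrArg (plug M.tensor · p) (Category.id_comp z)
  · refine PromonoidalData.conv_hom_ext fun Y X q p => ?_
    change _ = plug M.tensor (P := yoneda.obj Y) (𝟙 Y) p ≫ g Y q
    exact (congrArg (· ≫ k) (plug_eq_yoneda_left M.tensor q p).symm).trans
      ((Category.assoc _ _ _).trans (congrArg (_ ≫ ·) (hk Y q)))

instance (X : DayPsh M) : PreservesColimitsOfSize.{0, 0} (tensorLeft X) := by
  have := isLeftAdjoint_tensL M X
  exact (Adjunction.ofIsLeftAdjoint (tensL M X)).leftAdjoint_preservesColimits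

instance (X : DayPsh M) : PreservesColimitsOfSize.{0, 0} (tensorRight X) := by
  have := isLeftAdjoint_tensR M X
  exact (Adjunction.ofIsLeftAdjoint (tensR M X)).leftAdjoint_preservesColimits

end Day

end Produo

/-! ### Bimodules over `N` in presheaves -/

namespace Produo

open MonoidalCategory Limits

/-- Separates the action on `P ◁ Q` into distributing the outer copies of `N` and then acting in
each factor. The first part is `distrib`, so for free `P` and `Q` the whole is `mergeSeq`. -/
theorem Laxator.tact_seqObj {C : Type w} [Category.{v} C] [MonoidalCategory C] {s : TensorStr C}
    (L : Laxator (TensorStr.ofMonoidal C) s) (P Q : Bimod L.monoid L.monoid) :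
    tact (L.seqObj P Q) = ((L.comul ⊗ₘ (s.obj P.X Q.X ◁ L.comul ≫
      L.swap P.X Q.X L.monoid.X L.monoid.X)) ≫ L.swap _ _ _ _) ≫ s.map (tact P) (tact Q) := by
  have h : tact (L.seqObj P Q) = L.monoid.X ◁ (s.obj P.X Q.X ◁ L.comul ≫
      L.swap P.X Q.X L.monoid.X L.monoid.X) ≫ L.monoid.X ◁ s.map P.actRight Q.actRight ≫
        L.interLeft P.actLeft Q.actLeft := by
    rw [← whiskerLeft_comp_assoc, Category.assoc]
    rfl
  rw [h, L.whiskerLeft_interLeft, MonoidalCategory.tensorHom_def', Category.assoc, Category.assoc]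
  rfl

namespace Produoidal

variable {V : Type u} [SmallCategory V] (D : Produoidal V)

/-- The sequential monoidal structure on presheaves. -/
def seqDay : TensorStr (DayPsh D.par) := D.seq.day

/-- The duoidal structure on presheaves. -/
def psh : Laxator (TensorStr.ofMonoidal (DayPsh D.par)) D.seqDay := D.dayLaxator

/-- The category of bimodules over the monoid `N`. -/
abbrev NBimod : Type (u + 1) := Bimod D.psh.monoid D.psh.monoid

/-- The bimodule of sections `V(•; N ⊗ B ⊗ N)`. -/
def freeOn (B : V) : D.NBimod := freeBimod D.psh.monoid (C := DayPsh D.par) (yoneda.obj B)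

/-- The underlying presheaf of a bimodule. -/
def sections (P : D.NBimod) : Vᵒᵖ ⥤ Type u := P.X

/-- The action of a bimodule, as a morphism of presheaves. -/
def action (P : D.NBimod) : D.free (D.sections P) ⟶ D.sections P := tact P

/-- Underlying presheaf morphism. -/
def sectionsMap {P Q : D.NBimod} (f : P ⟶ Q) : D.sections P ⟶ D.sections Q := f.hom

theorem action_free (P : Vᵒᵖ ⥤ Type u) :
    D.action (freeBimod D.psh.monoid (C := DayPsh D.par) P) = D.merge P :=
  (tact_free (R := D.psh.monoid) (C := DayPsh D.par) P)

theorem action_seq (P Q : Vᵒᵖ ⥤ Type u) :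
    D.action (D.psh.seqObj (freeBimod D.psh.monoid (C := DayPsh D.par) P)
      (freeBimod D.psh.monoid (C := DayPsh D.par) Q)) = D.mergeSeq P Q := by
  refine (D.psh.tact_seqObj _ _).trans ?_
  exact congrArg₂ (fun f g => D.distrib (D.free P) (D.free Q) ≫ D.seq.tensMap f g)
    (D.action_free P) (D.action_free Q)

end Produoidal

end Produo

/-! ### The normalization promonad and its Kleisli category -/

namespace Produo

open MonoidalCategory Limits

namespace Produoidal

variable {V : Type u} [SmallCategory V] (D : Produoidal V)

/-- The bimodule morphism out of a free bimodule extending a morphism of presheaves. -/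
def extend {P : D.NBimod} {A : V} (g : yoneda.obj A ⟶ D.sections P) : D.freeOn A ⟶ P :=
  freeLift (C := DayPsh D.par) (B := yoneda.obj A) g

theorem normIncl_extend {P : D.NBimod} {A : V} (g : yoneda.obj A ⟶ D.sections P) :
    D.normIncl (yoneda.obj A) ≫ D.sectionsMap (D.extend g) = g :=
  freeUnit_lift (C := DayPsh D.par) (R := D.psh.monoid) (B := yoneda.obj A) (P := P) g

theorem extend_normIncl {P : D.NBimod} {A : V} (f : D.freeOn A ⟶ P) :
    D.extend (D.normIncl (yoneda.obj A) ≫ D.sectionsMap f) = f :=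
  freeLift_unit (C := DayPsh D.par) (R := D.psh.monoid) (B := yoneda.obj A) (P := P) f

/-- The bimodule morphism out of a free bimodule classified by an element. -/
def lift {P : D.NBimod} {A : V} (x : (D.sections P).obj (op A)) : D.freeOn A ⟶ P :=
  D.extend (yonedaEquiv.symm x)

/-- The element classifying a bimodule morphism out of a free bimodule. -/
def ev {P : D.NBimod} {A : V} (f : D.freeOn A ⟶ P) : (D.sections P).obj (op A) :=
  yonedaEquiv (D.normIncl (yoneda.obj A) ≫ D.sectionsMap f)

theorem normIncl_lift {P : D.NBimod} {A : V} (x : (D.sections P).obj (op A)) :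
    D.normIncl (yoneda.obj A) ≫ D.sectionsMap (D.lift x) = yonedaEquiv.symm x :=
  D.normIncl_extend _

theorem ev_lift {P : D.NBimod} {A : V} (x : (D.sections P).obj (op A)) : D.ev (D.lift x) = x := by
  rw [ev, normIncl_lift, Equiv.apply_symm_apply]

theorem lift_ev {P : D.NBimod} {A : V} (f : D.freeOn A ⟶ P) : D.lift (D.ev f) = f := by
  rw [lift, ev, Equiv.symm_apply_apply, extend_normIncl]

theorem ev_comp {P Q : D.NBimod} {A : V} (f : D.freeOn A ⟶ P) (g : P ⟶ Q) :
    D.ev (f ≫ g) = (D.sectionsMap g).app (op A) (D.ev f) := rfl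

/-- Bimodule morphisms out of a free bimodule are the elements of the underlying presheaf. -/
def evEquiv (P : D.NBimod) (A : V) : (D.freeOn A ⟶ P) ≃ (D.sections P).obj (op A) where
  toFun := D.ev
  invFun := D.lift
  left_inv := D.lift_ev
  right_inv := D.ev_lift

/-- A morphism out of a free bimodule is known from its value at the generator. The composite sends
the generator first to `p` and then to the image of `p` under the linear extension of `x`, which is
how `actOn` is defined. -/
theorem lift_comp {P : D.NBimod} {A' A : V} (p : (D.norm.obj A).obj (op A'))
    (x : (D.sections P).obj (op A)) :
    D.lift (P := D.freeOn A) p ≫ D.lift x = D.lift (D.actOn (D.action P) p x) := by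
  refine (D.evEquiv P A').injective ?_
  refine (D.ev_comp _ (D.lift x)).trans
    ((congrArg ((D.sectionsMap (D.lift x)).app (op A')) (D.ev_lift (P := D.freeOn A) p)).trans ?_)
  exact (D.ev_lift (D.actOn (D.action P) p x)).symm

theorem lift_map {P Q : D.NBimod} {A : V} (x : (D.sections P).obj (op A)) (f : P ⟶ Q) :
    D.lift ((D.sectionsMap f).app (op A) x) = D.lift x ≫ f := by
  refine (D.evEquiv Q A).injective ?_
  refine (D.ev_lift _).trans ?_
  exact ((D.ev_comp _ _).trans (congrArg _ (D.ev_lift x))).symm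

theorem actOn_incl {P : D.NBimod} {A' A : V} (f : A' ⟶ A) (x : (D.sections P).obj (op A)) :
    D.actOn (D.action P) ((D.normIncl (yoneda.obj A)).app (op A') f) x =
      (D.sections P).map f.op x :=
  congrArg (fun k : yoneda.obj A ⟶ D.sections P => k.app (op A') f) (D.normIncl_lift x)

theorem normIncl_natural {P Q : Vᵒᵖ ⥤ Type u} (f : P ⟶ Q) :
    f ≫ D.normIncl Q = D.normIncl P ≫ D.freeMap f :=
  freeUnit_natural (R := D.psh.monoid) (C := DayPsh D.par) f

theorem freeMap_comp {P Q R : Vᵒᵖ ⥤ Type u} (f : P ⟶ Q) (g : Q ⟶ R) :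
    D.freeMap (f ≫ g) = D.freeMap f ≫ D.freeMap g := by
  rw [ProduoidalData.freeMap, ProduoidalData.freeMap, ProduoidalData.freeMap, convMap_comp,
    convMap_comp]
  rfl

theorem freeMap_normIncl_merge (P : Vᵒᵖ ⥤ Type u) :
    D.freeMap (D.normIncl P) ≫ D.merge P = 𝟙 (D.free P) :=
  freeUnit_mul (R := D.psh.monoid) (C := DayPsh D.par) P

/-- Naturality of `normIncl` isolates the case of an identity, which is the triangle identity
`freeMap_normIncl_merge`. -/
theorem actOn_merge_incl {X Y Z : V} (p : (D.norm.obj Y).obj (op X)) (f : Y ⟶ Z) :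
    D.actOn (D.merge (yoneda.obj Z)) p ((D.normIncl (yoneda.obj Z)).app (op Y) f) =
      (D.norm.map f).app (op X) p := by
  have h : yonedaEquiv.symm ((D.normIncl (yoneda.obj Z)).app (op Y) f) =
      yoneda.map f ≫ D.normIncl (yoneda.obj Z) := by
    rw [Equiv.symm_apply_eq]
    exact congrArg _ (Category.id_comp f).symm
  have h' : D.freeMap (yoneda.map f ≫ D.normIncl (yoneda.obj Z)) ≫ D.merge (yoneda.obj Z) =
      D.norm.map f := by
    rw [freeMap_comp, Category.assoc, freeMap_normIncl_merge, Category.comp_id]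
    rfl
  rw [ProduoidalData.actOn, h, h']
  rfl

theorem actOn_merge_of_incl {X Y Z : V} (f : X ⟶ Y) (p : (D.norm.obj Z).obj (op Y)) :
    D.actOn (D.merge (yoneda.obj Z)) ((D.normIncl (yoneda.obj Y)).app (op X) f) p =
      (D.norm.obj Z).map f.op p := by
  rw [← action_free]
  exact D.actOn_incl (P := D.freeOn Z) f p

/-- The multiplication of the normalization promonad. -/
def star {X Y Z : V} (p : (D.norm.obj Y).obj (op X)) (q : (D.norm.obj Z).obj (op Y)) :
    (D.norm.obj Z).obj (op X) :=
  D.actOn (D.merge (yoneda.obj Z)) p q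

/-- The inclusion of morphisms into the normalization promonad. -/
def pure {X Y : V} (f : X ⟶ Y) : (D.norm.obj Y).obj (op X) :=
  (D.normIncl (yoneda.obj Y)).app (op X) f

/-- The multiplication of the promonad is composition of bimodule morphisms between free bimodules.
Associativity of `star` and functoriality of `freeFunctor` both rest on this. -/
theorem lift_star {X Y Z : V} (p : (D.norm.obj Y).obj (op X)) (q : (D.norm.obj Z).obj (op Y)) :
    D.lift (P := D.freeOn Z) (D.star p q) = 
      D.lift (P := D.freeOn Y) p ≫ D.lift (P := D.freeOn Z) q :=
  (congrArg (fun a => D.lift (P := D.freeOn Z) (D.actOn a p q)) (D.action_free _).symm).trans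
    (D.lift_comp (P := D.freeOn Z) p q).symm

theorem star_assoc {X Y Z W : V} (p : (D.norm.obj Y).obj (op X))
    (q : (D.norm.obj Z).obj (op Y)) (r : (D.norm.obj W).obj (op Z)) :
    D.star (D.star p q) r = D.star p (D.star q r) := by
  refine (D.evEquiv (D.freeOn W) X).symm.injective ?_
  refine (D.lift_star _ _).trans (Eq.trans ?_ (D.lift_star _ _).symm)
  exact (congrArg (· ≫ _) (D.lift_star p q)).trans
    ((Category.assoc _ _ _).trans (congrArg (_ ≫ ·) (D.lift_star q r).symm))

theorem star_pure {X Y Z : V} (p : (D.norm.obj Y).obj (op X)) (f : Y ⟶ Z) :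
    D.star p (D.pure f) = (D.norm.map f).app (op X) p :=
  D.actOn_merge_incl p f

theorem pure_star {X Y Z : V} (f : X ⟶ Y) (p : (D.norm.obj Z).obj (op Y)) :
    D.star (D.pure f) p = (D.norm.obj Z).map f.op p :=
  D.actOn_merge_of_incl f p

/-- The normalization promonad. -/
def promonad : Promonad D.norm where
  incl :=
    { app := fun B => D.normIncl (yoneda.obj B)
      naturality := fun _ _ f => D.normIncl_natural (yoneda.map f) }
  mul p q := D.star p q
  -- Morphisms of `V` act through multiplication by their images under `pure`, so the naturality and
  -- dinaturality laws are instances of associativity.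
  mul_natural_left f p q := by rw [← pure_star, ← pure_star, star_assoc]
  mul_natural_right p q g := by rw [← star_pure, ← star_pure, star_assoc]
  incl_mul f p := D.pure_star f p
  mul_incl p f := D.star_pure p f
  mul_dinatural p f q := by rw [← pure_star, ← star_pure, star_assoc]
  mul_assoc p q r := D.star_assoc p q r

/-- The comparison of the Kleisli category with the category of bimodules. -/
def freeFunctor : Kleisli D.promonad ⥤ D.NBimod where
  obj X := D.freeOn X.of
  map {X Y} q := D.lift (P := D.freeOn Y.of) q
  map_id X := by
    refine Eq.trans ?_ (D.lift_ev (𝟙 (D.freeOn X.of)))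
    exact congrArg (D.lift (P := D.freeOn X.of)) rfl
  map_comp p q := D.lift_star p q

/-- Kleisli morphisms are the bimodule morphisms between free bimodules. -/
def freeFunctorFullyFaithful : D.freeFunctor.FullyFaithful where
  preimage f := D.ev f
  map_preimage f := D.lift_ev f
  preimage_map {_ Y} q := D.ev_lift (P := D.freeOn Y.of) q

end Produoidal

end Produo

/-! ### Presented tensors of bimodules are convolutive -/

namespace Produo

open MonoidalCategory Limits

theorem yoneda_app_comp {V : Type u} [SmallCategory V] {P : Vᵒᵖ ⥤ Type u} {X Y Z : V}
    (η : yoneda.obj Z ⟶ P) (f : X ⟶ Y) (g : Y ⟶ Z) :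
    η.app (op X) (f ≫ g) = P.map f.op (η.app (op Y) g) :=
  NatTrans.naturality_apply η f.op g

namespace Produoidal

variable {V : Type u} [SmallCategory V] (D : Produoidal V)

/-- The generator of a free bimodule. -/
def gen (X : V) : (D.sections (D.freeOn X)).obj (op X) := D.pure (𝟙 X)

theorem lift_gen {P : D.NBimod} {X : V} (p : (D.sections P).obj (op X)) :
    (D.sectionsMap (D.lift p)).app (op X) (D.gen X) = p := D.ev_lift p

theorem lift_presheaf_map {P : D.NBimod} {X X' : V} (f : X ⟶ X') (p : (D.sections P).obj (op X')) :
    D.lift ((D.sections P).map f.op p) = D.lift (P := D.freeOn X') (D.pure f) ≫ D.lift p :=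
  (congrArg D.lift (D.actOn_incl f p).symm).trans (D.lift_comp _ p).symm

theorem pure_comp {X Y Z : V} (f : X ⟶ Y) (g : Y ⟶ Z) :
    D.pure (f ≫ g) = (D.norm.obj Z).map f.op (D.pure g) :=
  yoneda_app_comp (P := D.norm.obj Z) (D.normIncl (yoneda.obj Z)) f g

theorem map_gen {X X' : V} (f : X ⟶ X') :
    (D.sections (D.freeOn X')).map f.op (D.gen X') = D.pure f :=
  (D.pure_comp f (𝟙 X')).symm.trans (congrArg D.pure (Category.comp_id f))

/-- The inclusion of the base into the Kleisli category. -/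
def kleisliIncl : V ⥤ Kleisli D.promonad where
  obj X := ⟨X⟩
  map f := D.pure f
  map_id _ := rfl
  map_comp f g := (D.pure_comp f g).trans (D.pure_star f (D.pure g)).symm

/-- A presentation of a monoidal structure on bimodules by a profunctor on the base. -/
structure Presentation (T : TensorStr D.NBimod) where
  /-- The presenting profunctor. -/
  W : Profunctor.{u} (V × V) V
  /-- The quotient map. -/
  σ (P Q : D.NBimod) : conv W (D.sections P) (D.sections Q) ⟶ D.sections (T.obj P Q)
  σ_natural {P P' Q Q' : D.NBimod} (f : P ⟶ P') (g : Q ⟶ Q') :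
    convMap W (D.sectionsMap f) (D.sectionsMap g) ≫ σ P' Q' = σ P Q ≫ D.sectionsMap (T.map f g)
  surjective (P Q : D.NBimod) (A : V) : Function.Surjective ((σ P Q).app (op A))
  /-- A map respects `σ` when it does so on free bimodules. -/
  desc {P Q : D.NBimod} {G : Vᵒᵖ ⥤ Type u} (θ : conv W (D.sections P) (D.sections Q) ⟶ G)
    (hθ : ∀ {X Y A : V} (p : (D.sections P).obj (op X)) (q : (D.sections Q).obj (op Y))
      (z z' : (conv W (D.sections (D.freeOn X)) (D.sections (D.freeOn Y))).obj (op A)),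
      (σ _ _).app (op A) z = (σ _ _).app (op A) z' →
      (convMap W (D.sectionsMap (D.lift p)) (D.sectionsMap (D.lift q)) ≫ θ).app (op A) z =
        (convMap W (D.sectionsMap (D.lift p)) (D.sectionsMap (D.lift q)) ≫ θ).app (op A) z')
    {A : V} (z z' : (conv W (D.sections P) (D.sections Q)).obj (op A)) :
    (σ P Q).app (op A) z = (σ P Q).app (op A) z' → θ.app (op A) z = θ.app (op A) z'

namespace Presentation

variable {D} {T : TensorStr D.NBimod} (S : D.Presentation T) {P Q : D.NBimod}

/-- The class of `(t, x, y)` in the convolution of nerves. -/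
def cls {A X Y : V} (t : D.freeOn A ⟶ T.obj (D.freeOn X) (D.freeOn Y))
    (x : D.freeOn X ⟶ P) (y : D.freeOn Y ⟶ Q) :
    (conv (T.split D.freeFunctor) (nerve D.freeFunctor P) (nerve D.freeFunctor Q)).obj
      (op (D.kleisliIncl.obj A)) :=
  comp.mk (T.split D.freeFunctor) (ext (nerve D.freeFunctor P) (nerve D.freeFunctor Q))
    (D.kleisliIncl.obj X, D.kleisliIncl.obj Y) t (x, y)

/-- Every bimodule morphism between free bimodules on representables is a Kleisli morphism, so the
dinaturality relation of the coend applies to it. -/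
theorem cls_slide {A X Y X' Y' : V} (t : D.freeOn A ⟶ T.obj (D.freeOn X) (D.freeOn Y))
    (a : D.freeOn X ⟶ D.freeOn X') (b : D.freeOn Y ⟶ D.freeOn Y')
    (x : D.freeOn X' ⟶ P) (y : D.freeOn Y' ⟶ Q) :
    cls (t ≫ T.map a b) x y = cls t (a ≫ x) (b ≫ y) := by
  obtain ⟨a, rfl⟩ := (D.evEquiv (D.freeOn X') X).symm.surjective a
  obtain ⟨b, rfl⟩ := (D.evEquiv (D.freeOn Y') Y).symm.surjective b
  exact comp.sound (T.split D.freeFunctor)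
    (ext (nerve D.freeFunctor P) (nerve D.freeFunctor Q)) (A := op (D.kleisliIncl.obj A))
    (b := (D.kleisliIncl.obj X, D.kleisliIncl.obj Y))
    (b' := (D.kleisliIncl.obj X', D.kleisliIncl.obj Y')) (a, b) t (x, y)

/-- The class of a generating element. -/
def elt {A X Y : V} (t : (S.W.obj (X, Y)).obj (op A)) (p : (D.sections P).obj (op X))
    (q : (D.sections Q).obj (op Y)) : (D.sections (T.obj P Q)).obj (op A) :=
  (S.σ P Q).app (op A) (comp.mk S.W (ext (D.sections P) (D.sections Q)) (X, Y) t (p, q))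

theorem map_elt {P' Q' : D.NBimod} {A X Y : V} (t : (S.W.obj (X, Y)).obj (op A))
    (p : (D.sections P).obj (op X)) (q : (D.sections Q).obj (op Y)) (f : P ⟶ P') (g : Q ⟶ Q') :
    (D.sectionsMap (T.map f g)).app (op A) (S.elt t p q) =
      S.elt t ((D.sectionsMap f).app _ p) ((D.sectionsMap g).app _ q) :=
  congrArg (fun k : conv S.W (D.sections P) (D.sections Q) ⟶ _ => k.app (op A)
    (comp.mk S.W (ext (D.sections P) (D.sections Q)) (X, Y) t (p, q))) (S.σ_natural f g).symm

/-- The elements `p` and `q` are the images of generators under `D.lift p` and `D.lift q`, and `S.σ`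
is natural. -/
theorem lift_elt {A X Y : V} (t : (S.W.obj (X, Y)).obj (op A)) (p : (D.sections P).obj (op X))
    (q : (D.sections Q).obj (op Y)) :
    D.lift (S.elt t p q) = D.lift (S.elt t (D.gen X) (D.gen Y)) ≫ T.map (D.lift p) (D.lift q) := by
  rw [← D.lift_map, map_elt, lift_gen, lift_gen]

/-- The inverse of the comparison map, before passing to the quotient. -/
def unkappa (P Q : D.NBimod) : conv S.W (D.sections P) (D.sections Q) ⟶ D.kleisliIncl.op ⋙
    conv (T.split D.freeFunctor) (nerve D.freeFunctor P) (nerve D.freeFunctor Q) :=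
  comp.desc (fun b y =>
    { app := fun A => ↾ (fun t => cls (D.lift (S.elt (X := b.1) (Y := b.2) (A := A.unop) t
        (D.gen b.1) (D.gen b.2))) (D.lift (P := P) y.1) (D.lift (P := Q) y.2))
      naturality := by
        intro A A' f
        refine ConcreteCategory.hom_ext _ _ fun t => ?_
        have h : S.elt (X := b.1) (Y := b.2) (A := A'.unop) ((S.W.obj b).map f t)
            (D.gen b.1) (D.gen b.2) = (D.sections (T.obj _ _)).map f.unop.op
              (S.elt (X := b.1) (Y := b.2) (A := A.unop) t (D.gen b.1) (D.gen b.2)) :=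
          NatTrans.naturality_apply (S.σ (D.freeOn b.1) (D.freeOn b.2)) f
            (comp.mk S.W (ext (D.sections (D.freeOn b.1)) (D.sections (D.freeOn b.2))) b t
              (D.gen b.1, D.gen b.2))
        have h' := D.lift_presheaf_map f.unop
          (S.elt (X := b.1) (Y := b.2) (A := A.unop) t (D.gen b.1) (D.gen b.2))
        exact congrArg (fun k => cls k (D.lift (P := P) y.1) (D.lift (P := Q) y.2))
          ((congrArg D.lift h).trans h') })
    (by
      intro b b' f y
      ext A t
      have h : S.elt (X := b'.1) (Y := b'.2) (A := A.unop) ((S.W.map f).app A t)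
          (D.gen b'.1) (D.gen b'.2) = S.elt (X := b.1) (Y := b.2) (P := D.freeOn b'.1)
            (Q := D.freeOn b'.2) (A := A.unop) t (D.pure f.1) (D.pure f.2) := by
        rw [← map_gen, ← map_gen]
        exact congrArg ((S.σ (D.freeOn b'.1) (D.freeOn b'.2)).app A) (comp.sound S.W
          (ext (D.sections (D.freeOn b'.1)) (D.sections (D.freeOn b'.2))) f t
            (D.gen b'.1, D.gen b'.2))
      refine (congrArg (fun k => cls (D.lift k) (D.lift (P := P) y.1) (D.lift (P := Q) y.2))
        h).trans ?_
      refine (congrArg (fun k => cls k (D.lift (P := P) y.1) (D.lift (P := Q) y.2))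
        (S.lift_elt (P := D.freeOn b'.1) (Q := D.freeOn b'.2) t _ _)).trans ?_
      refine (cls_slide _ _ _ _ _).trans ?_
      exact congrArg₂ (cls _) (D.lift_presheaf_map (P := P) f.1 y.1).symm
        (D.lift_presheaf_map (P := Q) f.2 y.2).symm)

/-- For arguments coming from free bimodules, `unkappa` sees `z` only through its class under `S.σ`.
This is the hypothesis that `S.desc` asks for. -/
theorem unkappa_free {A X Y : V} (p : (D.sections P).obj (op X)) (q : (D.sections Q).obj (op Y))
    (z : (conv S.W (D.sections (D.freeOn X)) (D.sections (D.freeOn Y))).obj (op A)) :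
    (convMap S.W (D.sectionsMap (D.lift p)) (D.sectionsMap (D.lift q)) ≫
      S.unkappa P Q).app (op A) z = cls (D.lift ((S.σ _ _).app (op A) z)) (D.lift p) (D.lift q) := by
  induction z using comp.ind with
  | _ b t y =>
    refine Eq.trans ?_ (congrArg (cls · _ _) (S.lift_elt (P := D.freeOn X) (Q := D.freeOn Y)
      t y.1 y.2)).symm
    refine Eq.trans ?_ (cls_slide _ _ _ _ _).symm
    exact congrArg₂ (cls _) (D.lift_map (P := D.freeOn X) y.1 (D.lift p))
      (D.lift_map (P := D.freeOn Y) y.2 (D.lift q))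

/-- The map `unkappa` respects the quotient `S.σ`, and every class in the convolution of nerves is
`unkappa` of some `z` whose image under `S.σ` is the element classified by the comparison `kappa`.
Equal images under `kappa` thus come from equal classes. Surjectivity of `kappa` follows from that
of `S.σ` and `lift_elt`. -/
theorem convolutive (S : D.Presentation T) : T.Convolutive D.freeFunctor := by
  intro P Q A
  obtain ⟨⟨A⟩⟩ := A
  have hθ {z z' : (conv S.W (D.sections P) (D.sections Q)).obj (op A)}
      (h : (S.σ P Q).app (op A) z = (S.σ P Q).app (op A) z') :
      (S.unkappa P Q).app (op A) z = (S.unkappa P Q).app (op A) z' := by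
    refine S.desc (S.unkappa P Q) (fun p q z z' h => ?_) z z' h
    rw [unkappa_free, unkappa_free, h]
  have hs (s : (conv (T.split D.freeFunctor) (nerve D.freeFunctor P)
      (nerve D.freeFunctor Q)).obj (op (D.kleisliIncl.obj A))) :
      ∃ z, (S.unkappa P Q).app (op A) z = s ∧
        (S.σ P Q).app (op A) z = D.ev ((T.kappa D.freeFunctor P Q).app _ s) := by
    induction s using comp.ind with
    | _ b t y =>
      obtain ⟨⟨X⟩, ⟨Y⟩⟩ := b
      obtain ⟨p, hp⟩ := (D.evEquiv P X).symm.surjective y.1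
      obtain ⟨q, hq⟩ := (D.evEquiv Q Y).symm.surjective y.2
      have hy : y = (D.lift p, D.lift q) := Prod.ext hp.symm hq.symm
      subst hy
      -- The split `t` is itself an element of a tensor of two free bimodules, so it has a
      -- representative `z`, which is then pushed forward along `p` and `q`.
      obtain ⟨z, hz⟩ := S.surjective _ _ A (D.ev (P := T.obj (D.freeOn X) (D.freeOn Y)) t)
      refine ⟨_, (S.unkappa_free p q z).trans ?_, ?_⟩
      · exact congrArg (cls · _ _) ((congrArg D.lift hz).trans
          (D.lift_ev (P := T.obj (D.freeOn X) (D.freeOn Y)) t))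
      · refine (congrArg (fun k : conv S.W (D.sections (D.freeOn X)) (D.sections (D.freeOn Y)) ⟶ _ =>
          k.app (op A) z) (S.σ_natural (D.lift p) (D.lift q))).trans ?_
        exact congrArg ((D.sectionsMap (T.map (D.lift p) (D.lift q))).app (op A)) hz
  refine ⟨fun s s' h => ?_, fun f => ?_⟩
  · obtain ⟨z, hz, hz'⟩ := hs s
    obtain ⟨w, hw, hw'⟩ := hs s'
    rw [← hz, ← hw]
    exact hθ (hz'.trans ((congrArg D.ev h).trans hw'.symm))
  · obtain ⟨z, hz⟩ := S.surjective P Q A (D.ev (P := T.obj P Q) f)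
    refine ⟨(S.unkappa P Q).app (op A) z, ?_⟩
    refine Eq.trans ?_ (D.lift_ev (P := T.obj P Q) f)
    rw [← hz]
    induction z using comp.ind with
    | _ b t y => exact (S.lift_elt (P := P) (Q := Q) t y.1 y.2).symm

end Presentation

end Produoidal

end Produo

/-! ### Presentations of the two tensors of bimodules -/

namespace Produo

open MonoidalCategory Limits

section

variable {C : Type w} [Category.{v} C] [MonoidalCategory C] {R : Mon C} {P P' Q Q' : Bimod R R}

theorem tensor_actRight (f : P ⟶ P') (g : Q ⟶ Q') :
    (f.hom ▷ R.X ⊗ₘ g.hom) ≫ P'.actRight ▷ Q'.X = P.actRight ▷ Q.X ≫ (f.hom ⊗ₘ g.hom) := by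
  rw [MonoidalCategory.tensorHom_def', MonoidalCategory.tensorHom_def', Category.assoc,
    ← comp_whiskerRight, ← f.right_act_hom, comp_whiskerRight, whisker_exchange_assoc]

theorem tensor_actLeft (f : P ⟶ P') (g : Q ⟶ Q') :
    (f.hom ▷ R.X ⊗ₘ g.hom) ≫ (α_ _ _ _).hom ≫ P'.X ◁ Q'.actLeft =
      (α_ _ _ _).hom ≫ P.X ◁ Q.actLeft ≫ (f.hom ⊗ₘ g.hom) := by
  have h : (f.hom ▷ R.X ⊗ₘ g.hom) ≫ (α_ _ _ _).hom =
      (α_ _ _ _).hom ≫ (f.hom ⊗ₘ (R.X ◁ g.hom)) := by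
    rw [← tensorHom_id, ← id_tensorHom, associator_naturality]
  rw [sq_assoc h, MonoidalCategory.tensorHom_def, MonoidalCategory.tensorHom_def,
    Category.assoc, ← whiskerLeft_comp, ← g.left_act_hom, whiskerLeft_comp,
    whisker_exchange_assoc]

end

namespace Produoidal

variable {V : Type u} [SmallCategory V] (D : Produoidal V)

/-- The sequential tensor of bimodules is presented by the sequential splits. -/
def seqPresentation : D.Presentation D.psh.bimodSeq where
  W := D.seq.tensor
  -- The sequential tensor of bimodules has the Day convolution of the underlying presheaves as its
  -- underlying presheaf, so there is nothing to quotient.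
  σ P Q := 𝟙 (conv D.seq.tensor (D.sections P) (D.sections Q))
  σ_natural _ _ := (Category.comp_id _).trans (Category.id_comp _).symm
  surjective _ _ _ x := ⟨x, rfl⟩
  desc _ _ _ _ _ h := congrArg _ h

/-- The quotient map of the tensor product of bimodules. -/
noncomputable def quot (P Q : D.NBimod) : D.par.tens (D.sections P) (D.sections Q) ⟶
    D.sections ((bimodPar D.psh.monoid).obj P Q) :=
  bimodπ P Q

/-- A coequalizer projection is epic, and epimorphisms of presheaves are pointwise surjective. -/
theorem quot_surjective (P Q : D.NBimod) (A : V) :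
    Function.Surjective ((D.quot P Q).app (op A)) := by
  have h : Epi (D.quot P Q) := inferInstanceAs (Epi (bimodπ P Q))
  have h' := (NatTrans.epi_iff_epi_app (D.quot P Q)).1 h (op A)
  exact (epi_iff_surjective _).1 h'

/-- The right action of `N` in the middle of a product of bimodules. -/
def actMidLeft (P Q : D.NBimod) : D.par.tens (D.par.tens (D.sections P) D.n) (D.sections Q) ⟶
    D.par.tens (D.sections P) (D.sections Q) :=
  P.actRight ▷ Q.X

/-- The left action of `N` in the middle of a product of bimodules. -/
def actMidRight (P Q : D.NBimod) : D.par.tens (D.par.tens (D.sections P) D.n) (D.sections Q) ⟶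
    D.par.tens (D.sections P) (D.sections Q) :=
  (α_ P.X D.psh.monoid.X Q.X).hom ≫ P.X ◁ Q.actLeft

variable {D} in
theorem actMidLeft_natural {P P' Q Q' : D.NBimod} (f : P ⟶ P') (g : Q ⟶ Q') :
    D.par.tensMap (D.par.tensMap (D.sectionsMap f) (𝟙 D.n)) (D.sectionsMap g) ≫
      D.actMidLeft P' Q' = D.actMidLeft P Q ≫ D.par.tensMap (D.sectionsMap f) (D.sectionsMap g) :=
  tensor_actRight f g

variable {D} in
theorem actMidRight_natural {P P' Q Q' : D.NBimod} (f : P ⟶ P') (g : Q ⟶ Q') :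
    D.par.tensMap (D.par.tensMap (D.sectionsMap f) (𝟙 D.n)) (D.sectionsMap g) ≫
      D.actMidRight P' Q' =
        D.actMidRight P Q ≫ D.par.tensMap (D.sectionsMap f) (D.sectionsMap g) :=
  (tensor_actLeft f g).trans (Category.assoc _ _ _).symm

theorem actMid_quot (P Q : D.NBimod) :
    D.actMidLeft P Q ≫ D.quot P Q = D.actMidRight P Q ≫ D.quot P Q :=
  (bimodπ_condition P Q).trans (Category.assoc _ _ _).symm

theorem quot_factor {P Q : D.NBimod} {G : Vᵒᵖ ⥤ Type u}
    (θ : D.par.tens (D.sections P) (D.sections Q) ⟶ G)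
    (h : D.actMidLeft P Q ≫ θ = D.actMidRight P Q ≫ θ) : ∃ k, D.quot P Q ≫ k = θ :=
  ⟨bimodDesc (C := DayPsh D.par) (P := P) (Q := Q) (Z := G) θ (h.trans (Category.assoc _ _ _)),
    bimodπ_desc (C := DayPsh D.par) (P := P) (Q := Q) (Z := G) θ (h.trans (Category.assoc _ _ _))⟩

theorem plugR_lift {P Q : D.NBimod} {X Y Z : V} (p : (D.sections P).obj (op X))
    (n : D.n.obj (op Z)) (q : (D.sections Q).obj (op Y)) :
    plugR D.par.tensor (plug D.par.tensor (D.gen X) n) (D.gen Y) ≫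
        D.par.tensMap (D.par.tensMap (D.sectionsMap (D.lift p)) (𝟙 D.n)) (D.sectionsMap (D.lift q)) =
      plugR D.par.tensor (plug D.par.tensor p n) q := by
  rw [PromonoidalData.plugR_convMap, plug_convMap, lift_gen, lift_gen]
  rfl

/-- The tensor product of bimodules is presented by the parallel splits. -/
noncomputable def parPresentation : D.Presentation (bimodPar D.psh.monoid) where
  W := D.par.tensor
  σ P Q := D.quot P Q
  σ_natural f g := (bimodπ_map f g).symm
  surjective := D.quot_surjective
  desc {P Q G} θ hθ A z z' h := by
    obtain ⟨k, rfl⟩ : ∃ k, D.quot P Q ≫ k = θ := by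
      refine D.quot_factor θ ?_
      refine PromonoidalData.conv_conv_hom_ext fun X Z Y p n q => ?_
      -- To factor through the coequalizer, `θ` must identify the two middle actions of `N`. An
      -- element built from `p`, `n`, `q` is the image of one built from two generators and `n`. On
      -- the tensor of the free bimodules the quotient already identifies the two actions, so `hθ`
      -- applies.
      rw [← plugR_lift, Category.assoc, Category.assoc, ← Category.assoc (D.par.tensMap _ _),
        ← Category.assoc (D.par.tensMap _ _), actMidLeft_natural, actMidRight_natural]
      ext B z
      refine hθ p q _ _ ?_
      exact congrArg (fun k : D.par.tens (D.par.tens _ D.n) _ ⟶ _ => k.app B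
        ((plugR D.par.tensor (plug D.par.tensor (D.gen X) n) (D.gen Y)).app B z))
        (D.actMid_quot (D.freeOn X) (D.freeOn Y))
    exact congrArg (k.app (op A)) h

end Produoidal

end Produo

/-! ### The normalization, its splits and its units -/

namespace Produo

open MonoidalCategory Limits

namespace Produoidal

variable {V : Type u} [SmallCategory V] (D : Produoidal V)

/-- Precomposition with a Kleisli morphism becomes the bimodule action on classified elements. The
naturality in `A` of every identification of splits and units is an instance, with the action
computed by `merge`, `mergeSeq` or `mergeUnit`. -/
theorem ev_lift_comp {P : D.NBimod} {A' A : V} (p : (D.norm.obj A).obj (op A'))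
    (f : D.freeOn A ⟶ P) :
    D.ev (D.lift (P := D.freeOn A) p ≫ f) = D.actOn (D.action P) p (D.ev f) := by
  obtain ⟨x, rfl⟩ := (D.evEquiv P A).symm.surjective f
  refine (congrArg D.ev (D.lift_comp p x)).trans ((D.ev_lift _).trans ?_)
  exact congrArg (D.actOn (D.action P) p) (D.ev_lift x).symm

theorem sectionsMap_lift {B B' : V} (q : (D.norm.obj B').obj (op B)) :
    D.sectionsMap (D.lift (P := D.freeOn B') q) = D.freeMap (D.hat q) ≫ D.merge (yoneda.obj B') :=
  congrArg (D.freeMap (D.hat q) ≫ ·) (D.action_free _)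

/-- The normalization of a produoidal category. -/
noncomputable def normalization : Produoidal (Kleisli D.promonad) :=
  D.psh.bimod.produoidal D.parPresentation.convolutive D.seqPresentation.convolutive
    D.freeFunctorFullyFaithful

theorem normalization_normal : D.normalization.Normal :=
  Laxator.produoidal_normal _ _ _ _ (inferInstanceAs (IsIso (𝟙 (Bimod.regular D.psh.monoid))))

/-- Sequential splits of the normalization. -/
def seqSplit (A B C : V) : (D.normalization.seq.tensor.obj (⟨B⟩, ⟨C⟩)).obj (op ⟨A⟩) ≃
    (D.normSeq B C).obj (op A) :=
  D.evEquiv (D.psh.seqObj (D.freeOn B) (D.freeOn C)) A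

theorem seqSplit_map {A' A B C : V} (p : (⟨A'⟩ : Kleisli D.promonad) ⟶ ⟨A⟩)
    (x : (D.normalization.seq.tensor.obj (⟨B⟩, ⟨C⟩)).obj (op ⟨A⟩)) :
    D.seqSplit A' B C ((D.normalization.seq.tensor.obj (⟨B⟩, ⟨C⟩)).map p.op x) =
      D.actOn (D.mergeSeq _ _) p (D.seqSplit A B C x) :=
  (D.ev_lift_comp (P := D.psh.seqObj (D.freeOn B) (D.freeOn C)) p x).trans
    (congrArg (fun a => D.actOn a p (D.seqSplit A B C x)) (D.action_seq _ _))

theorem seqSplit_natural {A B B' C C' : V} (q : (⟨B⟩ : Kleisli D.promonad) ⟶ ⟨B'⟩)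
    (r : (⟨C⟩ : Kleisli D.promonad) ⟶ ⟨C'⟩)
    (x : (D.normalization.seq.tensor.obj (⟨B⟩, ⟨C⟩)).obj (op ⟨A⟩)) :
    D.seqSplit A B' C' ((D.normalization.seq.tensor.map (q ×ₘ r)).app (op ⟨A⟩) x) =
      (D.normSeqMap q r).app (op A) (D.seqSplit A B C x) := by
  have h : D.sectionsMap (D.psh.seqMap (D.lift (P := D.freeOn B') q)
      (D.lift (P := D.freeOn C') r)) = D.normSeqMap q r :=
    congrArg₂ D.seq.tensMap (D.sectionsMap_lift q) (D.sectionsMap_lift r)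
  exact congrArg (fun k : D.normSeq B C ⟶ D.normSeq B' C' => k.app (op A) (D.seqSplit A B C x)) h

/-- The free bimodule on `V(•; B ⊗ N ⊗ C)`. -/
def freePar (B C : V) : D.NBimod :=
  freeBimod D.psh.monoid (C := DayPsh D.par)
    (D.par.tens (yoneda.obj B) (D.par.tens D.n (yoneda.obj C)))

/-- The tensor product of free bimodules is free. -/
noncomputable def fuseIso (B C : V) :
    (bimodPar D.psh.monoid).obj (D.freeOn B) (D.freeOn C) ≅ D.freePar B C :=
  freeFuse (C := DayPsh D.par) D.psh.monoid (yoneda.obj B) (yoneda.obj C)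

/-- Naturality of the isomorphism between a tensor of free bimodules and a free bimodule, read on
presheaves; it gives the covariance of the parallel splits. -/
theorem map_fuseIso {B B' C C' : V} (q : (D.norm.obj B').obj (op B))
    (r : (D.norm.obj C').obj (op C)) :
    D.sectionsMap ((bimodPar D.psh.monoid).map (D.lift (P := D.freeOn B') q)
        (D.lift (P := D.freeOn C') r)) ≫ D.sectionsMap (D.fuseIso B' C').hom =
      D.sectionsMap (D.fuseIso B C).hom ≫ D.normParMap q r :=
  freeFuse_map (C := DayPsh D.par) (R := D.psh.monoid) (B := yoneda.obj B) (B' := yoneda.obj B')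
    (D := yoneda.obj C) (D' := yoneda.obj C') (D.hat q) (D.hat r)

/-- Parallel splits of the normalization. -/
noncomputable def parSplit (A B C : V) :
    (D.normalization.par.tensor.obj (⟨B⟩, ⟨C⟩)).obj (op ⟨A⟩) ≃ (D.normPar B C).obj (op A) :=
  ((D.fuseIso B C).homToEquiv (Z := D.freeOn A)).trans (D.evEquiv (D.freePar B C) A)

theorem parSplit_map {A' A B C : V} (p : (⟨A'⟩ : Kleisli D.promonad) ⟶ ⟨A⟩)
    (x : (D.normalization.par.tensor.obj (⟨B⟩, ⟨C⟩)).obj (op ⟨A⟩)) :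
    D.parSplit A' B C ((D.normalization.par.tensor.obj (⟨B⟩, ⟨C⟩)).map p.op x) =
      D.actOn (D.merge _) p (D.parSplit A B C x) :=
  (congrArg D.ev (Category.assoc (D.lift (P := D.freeOn A) p) x (D.fuseIso B C).hom)).trans
    ((D.ev_lift_comp (P := D.freePar B C) p _).trans
      (congrArg (fun a => D.actOn a p (D.parSplit A B C x)) (D.action_free _)))

theorem parSplit_natural {A B B' C C' : V} (q : (⟨B⟩ : Kleisli D.promonad) ⟶ ⟨B'⟩)
    (r : (⟨C⟩ : Kleisli D.promonad) ⟶ ⟨C'⟩)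
    (x : (D.normalization.par.tensor.obj (⟨B⟩, ⟨C⟩)).obj (op ⟨A⟩)) :
    D.parSplit A B' C' ((D.normalization.par.tensor.map (q ×ₘ r)).app (op ⟨A⟩) x) =
      (D.normParMap q r).app (op A) (D.parSplit A B C x) :=
  congrArg (fun k : D.sections ((bimodPar D.psh.monoid).obj (D.freeOn B) (D.freeOn C)) ⟶
    D.normPar B' C' => k.app (op A) (D.ev x)) (D.map_fuseIso q r)

/-- Units of the normalization. -/
def unitEquiv (A : V) :
    (D.freeOn A ⟶ Bimod.regular D.psh.monoid) ≃ D.n.obj (op A) :=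
  D.evEquiv (Bimod.regular D.psh.monoid) A

theorem unitEquiv_map {A' A : V} (p : (D.norm.obj A).obj (op A'))
    (x : D.freeOn A ⟶ Bimod.regular D.psh.monoid) :
    D.unitEquiv A' (D.lift (P := D.freeOn A) p ≫ x) = D.actOn D.mergeUnit p (D.unitEquiv A x) :=
  D.ev_lift_comp p x

end Produoidal

end Produo

theorem mainTheorem6 {V : Type u} [SmallCategory V] (D : Produoidal V) :
    ∃ M : Promonad D.norm,
      -- the inclusion and the multiplication of the promonad
      (∀ B : V, M.incl.app B = D.normIncl (yoneda.obj B)) ∧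
      (∀ {A B C : V} (p : (D.norm.obj B).obj (op A)) (q : (D.norm.obj C).obj (op B)),
        M.mul p q = D.actOn (D.merge (yoneda.obj C)) p q) ∧
      -- the Kleisli category is normal produoidal
      ∃ S : Produoidal (Kleisli M), S.Normal ∧
        -- parallel splits: `V(A; N ⊗ B ⊗ N ⊗ C ⊗ N)`
        (∃ e : ∀ A B C : V, (S.par.tensor.obj (⟨B⟩, ⟨C⟩)).obj (op ⟨A⟩) ≃
            (D.normPar B C).obj (op A),
          (∀ {A' A B C : V} (p : (⟨A'⟩ : Kleisli M) ⟶ ⟨A⟩)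
            (x : (S.par.tensor.obj (⟨B⟩, ⟨C⟩)).obj (op ⟨A⟩)),
            e A' B C ((S.par.tensor.obj (⟨B⟩, ⟨C⟩)).map p.op x) =
              D.actOn (D.merge _) p (e A B C x)) ∧
          (∀ {A B B' C C' : V} (q : (⟨B⟩ : Kleisli M) ⟶ ⟨B'⟩) (r : (⟨C⟩ : Kleisli M) ⟶ ⟨C'⟩)
            (x : (S.par.tensor.obj (⟨B⟩, ⟨C⟩)).obj (op ⟨A⟩)),
            e A B' C' ((S.par.tensor.map (q ×ₘ r)).app (op ⟨A⟩) x) =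
              (D.normParMap q r).app (op A) (e A B C x))) ∧
        -- sequential splits: `V(A; (N ⊗ B ⊗ N) ◁ (N ⊗ C ⊗ N))`
        (∃ e : ∀ A B C : V, (S.seq.tensor.obj (⟨B⟩, ⟨C⟩)).obj (op ⟨A⟩) ≃
            (D.normSeq B C).obj (op A),
          (∀ {A' A B C : V} (p : (⟨A'⟩ : Kleisli M) ⟶ ⟨A⟩)
            (x : (S.seq.tensor.obj (⟨B⟩, ⟨C⟩)).obj (op ⟨A⟩)),
            e A' B C ((S.seq.tensor.obj (⟨B⟩, ⟨C⟩)).map p.op x) =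
              D.actOn (D.mergeSeq _ _) p (e A B C x)) ∧
          (∀ {A B B' C C' : V} (q : (⟨B⟩ : Kleisli M) ⟶ ⟨B'⟩) (r : (⟨C⟩ : Kleisli M) ⟶ ⟨C'⟩)
            (x : (S.seq.tensor.obj (⟨B⟩, ⟨C⟩)).obj (op ⟨A⟩)),
            e A B' C' ((S.seq.tensor.map (q ×ₘ r)).app (op ⟨A⟩) x) =
              (D.normSeqMap q r).app (op A) (e A B C x))) ∧
        -- parallel units: `V(A; N)`
        (∃ e : ∀ A : V, S.par.unit.obj (op ⟨A⟩) ≃ D.n.obj (op A),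
          ∀ {A' A : V} (p : (⟨A'⟩ : Kleisli M) ⟶ ⟨A⟩) (x : S.par.unit.obj (op ⟨A⟩)),
            e A' (S.par.unit.map p.op x) = D.actOn D.mergeUnit p (e A x)) ∧
        -- sequential units: `V(A; N)`
        (∃ e : ∀ A : V, S.seq.unit.obj (op ⟨A⟩) ≃ D.n.obj (op A),
          ∀ {A' A : V} (p : (⟨A'⟩ : Kleisli M) ⟶ ⟨A⟩) (x : S.seq.unit.obj (op ⟨A⟩)),
            e A' (S.seq.unit.map p.op x) = D.actOn D.mergeUnit p (e A x)) := by
  exact ⟨D.promonad, fun _ => rfl, fun _ _ => rfl, D.normalization, D.normalization_normal,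
    ⟨D.parSplit, D.parSplit_map, D.parSplit_natural⟩,
    ⟨D.seqSplit, D.seqSplit_map, D.seqSplit_natural⟩,
    -- Both units are the nerve of the regular bimodule `N`, so one bijection serves for each.
    ⟨D.unitEquiv, D.unitEquiv_map⟩, ⟨D.unitEquiv, D.unitEquiv_map⟩⟩
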